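/- Let $L>0$ and let $N\ge 0$ be an integer. For $n\ge1$ particles let $$\psi_n(x_1,\dots,x_n)=\frac1{\sqrt{n!}}\Big|\det[\phi_k(x_j)]_{j,k=1,\dots,n}\Big|$$ be the ground state of $n$ impenetrable bosons, where the orthonormal single particle states $\phi_1,\dots,\phi_n$ and the domain $\Omega$ are: * (C, circle of circumference $L$) $\Omega=[0,L]$, $\phi_k(x)=L^{-1/2}e^{2\pi i(k-(n+1)/2)x/L}$; * (H, harmonic well) $\Omega=\mathbb R$, $\phi_k(x)=\dfrac{2^{-(k-1)}}{c^{\rm H}_{k-1}}e^{-x^2/2}H_{k-1}(x)$, with $H_k$ the (physicists') Hermite polynomials and $(c^{\rm H}_k)^2=\pi^{1/2}2^{-k}k!$, $c^{\rm H}_k>0$; * (D, Dirichlet) $\Omega=[0,L]$, $\phi_k(x)=\sqrt{2/L}\,\sin(\pi kx/L)$; * (N, Neumann) $\Omega=[0,L]$, $\phi_1(x)=\sqrt{1/L}$ and $\phi_k(x)=\sqrt{2/L}\,\cos(\pi(k-1)x/L)$ for $k\ge2$. In each case let $$\rho_{N+1}(x;y)=(N+1)\int_\Omega dx_2\cdots\int_\Omega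 dx_{N+1}\,\psi_{N+1}(x,x_2,\dots,x_{N+1})\,\psi_{N+1}(y,x_2,\dots,x_{N+1})$$ be the one-particle density matrix, written $\rho^{\rm C},\rho^{\rm H},\rho^{\rm D},\rho^{\rm N}$ respectively. Then all averages below converge absolutely, and: 1. for all $x\in\mathbb R$, $$\rho^{\rm C}_{N+1}(x;0)=\frac1L\Big\langle\prod_{l=1}^N\Big|2\sin\Big(\frac{\pi x}L-\frac{\theta_l}2\Big)\Big|\,\Big|2\sin\frac{\theta_l}2\Big|\Big\rangle_{U(N)},$$ where $e^{i\theta_1},\dots,e^{i\theta_N}$ are the eigenvalues of a Haar distributed unitary $N\times N$ matrix; 2. for all $x,y\in\mathbb R$, $$\rho^{\rm H}_{N+1}(x;y)=\frac1{(c^{\rm H}_N)^2}e^{-x^2/2-y^2/2}\Big\langle\prod_{l=1}^N|x-x_l|\,|y-x_l|\Big\rangle_{{\rm GUE}_N},$$ where $x_1,\dots,x_N$ are the eigenvalues of a random complex Hermitian $N\times N$ matrix $X$ with density proportional to $e^{-{\rm Tr}\,X^2}$ (independent centred Gaussian entries, of variance $1/2$ on the diagonal and with real and imaginary parts of variance $1/4$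 above it); 3. for all $x,y\in[0,L]$, $$\rho^{\rm D}_{N+1}(x;y)=\frac2L\sin\frac{\pi x}L\sin\frac{\pi y}L\Big\langle\prod_{l=1}^N2\Big|\cos\frac{\pi x}L-\cos\theta_l\Big|\,2\Big|\cos\frac{\pi y}L-\cos\theta_l\Big|\Big\rangle_{Sp(N)},$$ where $e^{\pm i\theta_1},\dots,e^{\pm i\theta_N}$, $\theta_l\in[0,\pi]$, are the eigenvalues of a Haar distributed symplectic unitary $2N\times2N$ matrix; 4. if $N\ge1$, for all $x,y\in[0,L]$, $$\rho^{\rm N}_{N+1}(x;y)=\frac1{2L}\Big\langle\prod_{l=1}^N2\Big|\cos\frac{\pi x}L-\cos\theta_l\Big|\,2\Big|\cos\frac{\pi y}L-\cos\theta_l\Big|\Big\rangle_{O^+(2N)},$$ where $e^{\pm i\theta_1},\dots,e^{\pm i\theta_N}$, $\theta_l\in[0,\pi]$, are the eigenvalues of a Haar distributed real orthogonal $2N\times2N$ matrix of determinant $+1$. -/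

import Mathlib

open MeasureTheory ProbabilityTheory Matrix

noncomputable section

namespace BoseGas

/-! ### Ground states and one-particle density matrices -/

/-- The bosonic (non-negative, symmetric) wave function `|det[φ_k(x_j)]| / √(n!)` obtained from the
Slater determinant of the single particle states `φ_0, …, φ_{n-1}`. -/
def slaterState {𝕜 : Type*} [RCLike 𝕜] {n : ℕ} (φ : Fin n → ℝ → 𝕜) (x : Fin n → ℝ) : ℝ :=
  ‖(Matrix.of fun j k : Fin n => φ k (x j)).det‖ / √(n.factorial : ℝ)

/-- The one-particle density matrix
`ρ_n(x;y) = n ∫_Ω dx_2 … ∫_Ω dx_n ψ(x, x_2, …, x_n) ψ(y, x_2, …, x_n)` of a real wave function of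
`n = N + 1` particles. -/
def densityMatrix {N : ℕ} (Ω : Set ℝ) (ψ : (Fin (N + 1) → ℝ) → ℝ) (x y : ℝ) : ℝ :=
  ((N + 1 : ℕ) : ℝ) * ∫ t in Set.pi Set.univ (fun _ : Fin N => Ω),
    ψ (Fin.cons x t) * ψ (Fin.cons y t)

/-- Plane waves on the circle of circumference `L`: with `n` particles the wave numbers are
`2π(k - (n-1)/2)/L`, `k = 0, …, n-1`. -/
def phiC (L : ℝ) (n : ℕ) (k : Fin n) (x : ℝ) : ℂ :=
  (1 / √L : ℝ) *
    Complex.exp (2 * Real.pi * Complex.I * (((k : ℕ) : ℂ) - ((n : ℂ) - 1) / 2) * x / L)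

/-- Physicists' Hermite polynomials: `H_0 = 1`, `H_{k+1} = 2 X H_k - H_k'`. -/
def physHermite : ℕ → Polynomial ℝ
  | 0 => 1
  | k + 1 => 2 * Polynomial.X * physHermite k - Polynomial.derivative (physHermite k)

/-- The constant `c_k > 0` with `c_k² = √π 2^{-k} k!`. -/
def cH (k : ℕ) : ℝ := √(√Real.pi * ((2 : ℝ) ^ k)⁻¹ * (k.factorial : ℝ))

/-- Normalised eigenstates of the harmonic oscillator `-d²/dx² + x²`. -/
def phiH (k : ℕ) (x : ℝ) : ℝ :=
  ((2 : ℝ) ^ k)⁻¹ / cH k * Real.exp (-x ^ 2 / 2) * (physHermite k).eval x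

/-- Dirichlet states on `[0, L]`; the index `k = 0, 1, …` stands for the state
`√(2/L) sin (π (k+1) x / L)`. -/
def phiD (L : ℝ) (k : ℕ) (x : ℝ) : ℝ :=
  √(2 / L) * Real.sin (Real.pi * ((k : ℝ) + 1) * x / L)

/-- Neumann states on `[0, L]`. -/
def phiN (L : ℝ) (k : ℕ) (x : ℝ) : ℝ :=
  if k = 0 then √(1 / L) else √(2 / L) * Real.cos (Real.pi * (k : ℝ) * x / L)

/-- Ground state of `n` impenetrable bosons on the circle of circumference `L`. -/
def psiC (L : ℝ) (n : ℕ) : (Fin n → ℝ) → ℝ := slaterState (phiC L n)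

/-- Ground state of `n` impenetrable bosons in the harmonic well. -/
def psiH (n : ℕ) : (Fin n → ℝ) → ℝ := slaterState fun k : Fin n => phiH k

/-- Ground state of `n` impenetrable bosons on `[0, L]`, Dirichlet boundary conditions. -/
def psiD (L : ℝ) (n : ℕ) : (Fin n → ℝ) → ℝ := slaterState fun k : Fin n => phiD L k

/-- Ground state of `n` impenetrable bosons on `[0, L]`, Neumann boundary conditions. -/
def psiN (L : ℝ) (n : ℕ) : (Fin n → ℝ) → ℝ := slaterState fun k : Fin n => phiN L k

/-- `rhoC L N x y` is `ρ^C_{N+1}(x;y)`. -/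
def rhoC (L : ℝ) (N : ℕ) (x y : ℝ) : ℝ := densityMatrix (Set.Icc 0 L) (psiC L (N + 1)) x y

/-- `rhoH N x y` is `ρ^H_{N+1}(x;y)`. -/
def rhoH (N : ℕ) (x y : ℝ) : ℝ := densityMatrix Set.univ (psiH (N + 1)) x y

/-- `rhoD L N x y` is `ρ^D_{N+1}(x;y)`. -/
def rhoD (L : ℝ) (N : ℕ) (x y : ℝ) : ℝ := densityMatrix (Set.Icc 0 L) (psiD L (N + 1)) x y

/-- `rhoN L N x y` is `ρ^N_{N+1}(x;y)`. -/
def rhoN (L : ℝ) (N : ℕ) (x y : ℝ) : ℝ := densityMatrix (Set.Icc 0 L) (psiN L (N + 1)) x y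

/-! ### The compact groups with Haar measure -/

/-- The group `U(N)`. -/
abbrev UGroup (N : ℕ) : Type := Matrix.unitaryGroup (Fin N) ℂ

/-- Symplectic unitary `2N × 2N` matrices, as a subgroup of `U(2N)`. -/
def spSubgroup (N : ℕ) : Subgroup (Matrix.unitaryGroup (Fin N ⊕ Fin N) ℂ) where
  carrier := {U | (U : Matrix (Fin N ⊕ Fin N) (Fin N ⊕ Fin N) ℂ) ∈
    Matrix.symplecticGroup (Fin N) ℂ}
  mul_mem' ha hb := (Matrix.symplecticGroup (Fin N) ℂ).mul_mem ha hb
  one_mem' := (Matrix.symplecticGroup (Fin N) ℂ).one_mem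
  inv_mem' := by
    intro U hU
    have h1 : ((U⁻¹ : Matrix.unitaryGroup (Fin N ⊕ Fin N) ℂ) :
        Matrix (Fin N ⊕ Fin N) (Fin N ⊕ Fin N) ℂ) * U = 1 := by
      rw [← Submonoid.coe_mul, inv_mul_cancel, Submonoid.coe_one]
    have h2 := ((⟨U, hU⟩ : Matrix.symplecticGroup (Fin N) ℂ)⁻¹).2
    have h3 : (U : Matrix (Fin N ⊕ Fin N) (Fin N ⊕ Fin N) ℂ) *
        ((⟨U, hU⟩ : Matrix.symplecticGroup (Fin N) ℂ)⁻¹ : Matrix.symplecticGroup (Fin N) ℂ) = 1 :=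
      congrArg Subtype.val (mul_inv_cancel (⟨U, hU⟩ : Matrix.symplecticGroup (Fin N) ℂ))
    have h4 := left_inv_eq_right_inv h1 h3
    rw [← h4] at h2
    exact h2

/-- The group `Sp(N)` of symplectic unitary `2N × 2N` matrices. -/
abbrev SpGroup (N : ℕ) : Type := spSubgroup N

/-- Real orthogonal `2N × 2N` matrices of determinant `+1`, as a subgroup of `O(2N)`. -/
def soSubgroup (N : ℕ) : Subgroup (Matrix.unitaryGroup (Fin (2 * N)) ℝ) where
  carrier := {U | (U : Matrix (Fin (2 * N)) (Fin (2 * N)) ℝ).det = 1}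
  mul_mem' := by
    intro a b ha hb
    simp only [Set.mem_ofPred_eq] at ha hb ⊢
    rw [Submonoid.coe_mul, Matrix.det_mul, ha, hb, one_mul]
  one_mem' := by simp
  inv_mem' := by
    intro U hU
    simp only [Set.mem_ofPred_eq] at hU ⊢
    have h1 : ((U⁻¹ : Matrix.unitaryGroup (Fin (2 * N)) ℝ) :
        Matrix (Fin (2 * N)) (Fin (2 * N)) ℝ) * U = 1 := by
      rw [← Submonoid.coe_mul, inv_mul_cancel, Submonoid.coe_one]
    have h2 := congrArg Matrix.det h1
    rwa [Matrix.det_mul, hU, mul_one, Matrix.det_one] at h2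

/-- The group `O⁺(2N)` of real orthogonal `2N × 2N` matrices of determinant `+1`. -/
abbrev OPlusGroup (N : ℕ) : Type := soSubgroup N

instance compactSpace_unitaryGroup {n 𝕜 : Type*} [Fintype n] [DecidableEq n] [RCLike 𝕜] :
    CompactSpace (Matrix.unitaryGroup n 𝕜) := by
  refine isCompact_iff_compactSpace.mp ?_
  have hK : IsCompact (Set.pi Set.univ fun _ : n => Set.pi Set.univ fun _ : n =>
      Metric.closedBall (0 : 𝕜) 1) :=
    isCompact_univ_pi fun _ => isCompact_univ_pi fun _ => isCompact_closedBall _ _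
  refine hK.of_isClosed_subset ?_ ?_
  · have : ((Matrix.unitaryGroup n 𝕜 : Submonoid (Matrix n n 𝕜)) : Set (Matrix n n 𝕜)) =
        {A | A * star A = 1} := by
      ext A
      exact Matrix.mem_unitaryGroup_iff
    rw [this]
    exact isClosed_eq (by fun_prop) continuous_const
  · intro A hA i _ j _
    simpa using entry_norm_bound_of_unitary hA i j

instance compactSpace_spGroup (N : ℕ) : CompactSpace (SpGroup N) := by
  refine isCompact_iff_compactSpace.mp (IsClosed.isCompact ?_)
  have : ((spSubgroup N : Subgroup _) : Set (Matrix.unitaryGroup (Fin N ⊕ Fin N) ℂ)) =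
      {U : Matrix.unitaryGroup (Fin N ⊕ Fin N) ℂ |
        (U : Matrix (Fin N ⊕ Fin N) (Fin N ⊕ Fin N) ℂ) * Matrix.J (Fin N) ℂ *
        (U : Matrix (Fin N ⊕ Fin N) (Fin N ⊕ Fin N) ℂ)ᵀ = Matrix.J (Fin N) ℂ} := by
    ext U
    exact SymplecticGroup.mem_iff
  rw [this]
  exact isClosed_eq (by fun_prop) continuous_const

instance compactSpace_oPlusGroup (N : ℕ) : CompactSpace (OPlusGroup N) := by
  refine isCompact_iff_compactSpace.mp (IsClosed.isCompact ?_)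
  exact isClosed_eq (f := fun U : Matrix.unitaryGroup (Fin (2 * N)) ℝ =>
    (U : Matrix (Fin (2 * N)) (Fin (2 * N)) ℝ).det) (by fun_prop) continuous_const

instance measurableSpace_unitaryGroup {n 𝕜 : Type*} [Fintype n] [DecidableEq n] [RCLike 𝕜] :
    MeasurableSpace (Matrix.unitaryGroup n 𝕜) := borel _

instance borelSpace_unitaryGroup {n 𝕜 : Type*} [Fintype n] [DecidableEq n] [RCLike 𝕜] :
    BorelSpace (Matrix.unitaryGroup n 𝕜) := ⟨rfl⟩

/-- The Haar measure of total mass one on a compact group. -/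
def haarProb (G : Type*) [Group G] [TopologicalSpace G] [IsTopologicalGroup G] [CompactSpace G]
    [MeasurableSpace G] [BorelSpace G] : Measure G := Measure.haarMeasure ⊤

/-! ### Eigenvalues -/

/-- The angles `θ_1, …, θ_n ∈ (-π, π]` of the eigenvalues `e^{iθ_l}` of a unitary matrix, listed
with multiplicity. -/
def eigenangles {n : Type*} [Fintype n] [DecidableEq n] (U : Matrix n n ℂ) : Multiset ℝ :=
  U.charpoly.roots.map Complex.arg

/-- For a unitary matrix whose eigenvalues come in complex conjugate pairs `e^{± iθ_l}`, the
angles `θ_l ∈ [0, π]`, one for each pair, listed with multiplicity. An eigenvalue `1` or `-1` of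
(even) multiplicity `2m` makes up `m` pairs. -/
def pairAngles {n : Type*} [Fintype n] [DecidableEq n] (U : Matrix n n ℂ) : Multiset ℝ := by
  classical
  exact (U.charpoly.roots.filter fun z => 0 < z.im).map Complex.arg
    + Multiset.replicate (U.charpoly.roots.count 1 / 2) 0
    + Multiset.replicate (U.charpoly.roots.count (-1) / 2) Real.pi

/-- Eigenvalue angles of `U ∈ U(N)`. -/
def anglesU {N : ℕ} (U : UGroup N) : Multiset ℝ := eigenangles (U : Matrix (Fin N) (Fin N) ℂ)

/-- Eigenvalue angles `θ_1, …, θ_N ∈ [0, π]` of `S ∈ Sp(N)`. -/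
def anglesSp {N : ℕ} (S : SpGroup N) : Multiset ℝ :=
  pairAngles (S : Matrix.unitaryGroup (Fin N ⊕ Fin N) ℂ).1

/-- Eigenvalue angles `θ_1, …, θ_N ∈ [0, π]` of `R ∈ O⁺(2N)`. -/
def anglesO {N : ℕ} (R : OPlusGroup N) : Multiset ℝ :=
  pairAngles (((R : Matrix.unitaryGroup (Fin (2 * N)) ℝ).1).map Complex.ofReal)

/-! ### The Gaussian unitary ensemble -/

/-- The Hermitian matrix with diagonal entries `g i i` and, for `i < j`, entries
`g i j + i g j i`. -/
def gueMatrix {N : ℕ} (g : Fin N → Fin N → ℝ) : Matrix (Fin N) (Fin N) ℂ :=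
  Matrix.of fun i j =>
    if i = j then (g i i : ℂ)
    else if i < j then (g i j : ℂ) + Complex.I * (g j i : ℂ)
    else (g j i : ℂ) - Complex.I * (g i j : ℂ)

theorem gueMatrix_isHermitian {N : ℕ} (g : Fin N → Fin N → ℝ) : (gueMatrix g).IsHermitian := by
  ext i j
  rcases lt_trichotomy i j with h | h | h
  · simp [gueMatrix, h.ne, h.ne', h, h.not_gt, sub_eq_add_neg]
  · simp [gueMatrix, h]
  · simp [gueMatrix, h.ne, h.ne', h, h.not_gt, sub_eq_add_neg]

/-- Law of the independent centred Gaussian entries of the `N × N` GUE, normalised so that the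
density of the matrix `H` is proportional to `exp(-Tr H²)`: variance `1/2` on the diagonal,
variance `1/4` for real and imaginary parts off the diagonal. -/
def gueMeasure (N : ℕ) : Measure (Fin N → Fin N → ℝ) :=
  Measure.pi fun i => Measure.pi fun j => gaussianReal 0 (if i = j then 1 / 2 else 1 / 4)

/-- The eigenvalues `x_1, …, x_N` of the matrix `gueMatrix g`. -/
def gueEigenvalues {N : ℕ} (g : Fin N → Fin N → ℝ) : Fin N → ℝ :=
  (gueMatrix_isHermitian g).eigenvalues

end BoseGas

end

noncomputable section

namespace BoseGas

/-! In each geometry the one-particle states are a common factor times scaled monic polynomials in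
one variable `z`, namely `e^{2πix/L}`, `x` or `2 cos (πx/L)`. Absolute Slater determinants are
therefore Vandermonde products. The product for the points `x, x_2, …` is the one for `x_2, …` times
`∏ |z x - z x_l|` and one-particle factors. Hence the density matrix is an average of `∏ |z x - z
x_l| |z y - z x_l|` for a squared `N`-point Vandermonde weight, and orthonormality of the
`N`-particle states supplies the normalisation (`densityMatrix_eq_average`). It remains to see that
this weight gives the same averages as the eigenvalues of the random matrix, that is, cases of
Weyl's integration formula.

These are obtained from loop (Schwinger–Dyson) equations instead of a change of variables. On the
matrix side, invariance of the Haar measure (partial integration for the Gaussian) along the fields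
`∑ tr (X_a U^k) X_a`, combined with Fierz identities for the generators `X_a`, yields linear
relations between the averages of polynomials in the power traces. On the eigenvalue side, partial
integration along `∑ φ₁ k (x l) ∂_l` yields the same relations, because the logarithmic derivative
of the Vandermonde weight along this field is a polynomial in the linear statistics.

The relations determine the averages up to normalisation. For the compact groups they say that the
average annihilates the range of a second order operator that preserves a filtration with
finite-dimensional pieces. Paired with the complex conjugate, this operator gives the Dirichlet form
of the weight, so its kernel consists of constants. Its range then has codimension one, and only the
value at `1` is free (`LoopEnsemble.const_of_loopOperator_eq_zero`,
`functional_eq_of_annihilate_range`, `LoopEnsemble.eq_average`). In the Gaussian case the relations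
are triangular and reduce the weight directly (`eq_zero_of_gaussian_loop`).

Products of absolute values are not polynomials in the power sums. On the compact side their squares
are, by Newton's identities; the moments of the square agree, hence so do the averages of its square
root (`LoopEnsemble.integral_prod_eq`). In the Gaussian case the bounded variable `Q exp (-Tr X² /
2)` is used; its moments are Gaussian integrals of other widths, which a dilation reduces to the
original one (`gue_mul_eigenvalue_abs`). -/

/-! ### Linear algebra: functionals annihilating the range of an operator -/

/-- Two normalised linear functionals on `V` that factor through `ev` and vanish on the range of an
operator `L`, whose kernel modulo `ker ev` consists of the constants, agree. -/
theorem functional_eq_of_annihilate_range {R W : Type*} [AddCommGroup R] [Module ℂ R]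
    [AddCommGroup W] [Module ℂ W] (V : Submodule ℂ R) (L : R →ₗ[ℂ] R) (ev : R →ₗ[ℂ] W)
    (one : R) (hone : one ∈ V) [FiniteDimensional ℂ (V.map ev)]
    (hLV : ∀ f ∈ V, L f ∈ V)
    (hker : ∀ f ∈ V, ev (L f) = 0 → ∃ c : ℂ, ev f = c • ev one)
    (E₁ E₂ : R →ₗ[ℂ] ℂ)
    (h₁ : ∀ f ∈ V, ev f = 0 → E₁ f = 0) (h₂ : ∀ f ∈ V, ev f = 0 → E₂ f = 0)
    (hL₁ : ∀ f ∈ V, E₁ (L f) = 0) (hL₂ : ∀ f ∈ V, E₂ (L f) = 0)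
    (hE : E₁ one = E₂ one) (hE₂ : E₂ one ≠ 0) :
    ∀ f ∈ V, E₁ f = E₂ f := by
  let W₀ := V.map ev
  let A : V →ₗ[ℂ] W₀ := (ev.comp V.subtype).codRestrict W₀ fun f => ⟨f, f.2, rfl⟩
  -- `L` is not assumed to preserve the kernel of `ev`, so it need not descend to an operator on
  -- `W₀`. Only its composite with `ev`, defined on all of `V`, is used.
  let T : V →ₗ[ℂ] W₀ := (ev.comp (L.comp V.subtype)).codRestrict W₀
    fun f => ⟨L f, hLV f f.2, rfl⟩
  let o : W₀ := A ⟨one, hone⟩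
  have hA : Function.Surjective A := by
    rintro ⟨w, f, hf, rfl⟩
    exact ⟨⟨f, hf⟩, rfl⟩
  have hkT : LinearMap.ker T ≤ LinearMap.ker ((Submodule.mkQ (ℂ ∙ o)).comp A) := by
    intro f hf
    obtain ⟨c, hc⟩ := hker f f.2 (congrArg Subtype.val (LinearMap.mem_ker.1 hf))
    rw [LinearMap.mem_ker, LinearMap.comp_apply, Submodule.mkQ_apply,
      Submodule.Quotient.mk_eq_zero, Submodule.mem_span_singleton]
    exact ⟨c, Subtype.ext hc.symm⟩
  let h : (V ⧸ LinearMap.ker T) →ₗ[ℂ] (W₀ ⧸ (ℂ ∙ o)) := (LinearMap.ker T).liftQ _ hkT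
  have hh : Function.Surjective h := by
    intro q
    obtain ⟨w, rfl⟩ := Submodule.mkQ_surjective _ q
    obtain ⟨f, rfl⟩ := hA w
    exact ⟨Submodule.Quotient.mk f, rfl⟩
  let h' := h.comp T.quotKerEquivRange.symm.toLinearMap
  have hh' : Function.Surjective h' := hh.comp T.quotKerEquivRange.symm.surjective
  have hdim : Module.finrank ℂ (W₀ ⧸ (ℂ ∙ o)) ≤ Module.finrank ℂ (LinearMap.range T) :=
    LinearMap.finrank_le_finrank_of_surjective hh'
  -- `E₂` factors through `ev`, kills the range of `L` and does not vanish at `one`, so the range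
  -- contains no nonzero constant. Range and constants therefore span `W₀`, and a functional killing
  -- the range is fixed by its value at `one`.
  have hdisj : LinearMap.range T ⊓ (ℂ ∙ o) = ⊥ := by
    rw [eq_bot_iff]
    rintro w ⟨⟨f, rfl⟩, hw⟩
    obtain ⟨c, hc⟩ := Submodule.mem_span_singleton.1 hw
    have h3 : ev (L f - c • one) = 0 := by
      have := congrArg Subtype.val hc
      rw [map_sub, map_smul, sub_eq_zero]
      exact this.symm
    have h4 := h₂ _ (V.sub_mem (hLV f f.2) (V.smul_mem c hone)) h3
    rw [map_sub, hL₂ f f.2, map_smul, zero_sub, neg_eq_zero, smul_eq_mul] at h4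
    rcases mul_eq_zero.1 h4 with h5 | h5
    · rw [Submodule.mem_bot, ← hc, h5, zero_smul]
    · exact absurd h5 hE₂
  have hsup : LinearMap.range T ⊔ (ℂ ∙ o) = ⊤ := by
    apply Submodule.eq_top_of_finrank_eq
    apply le_antisymm (Submodule.finrank_le _)
    have h6 := Submodule.finrank_sup_add_finrank_inf_eq (LinearMap.range T) (ℂ ∙ o)
    rw [hdisj, finrank_bot, add_zero] at h6
    have h7 := Submodule.finrank_quotient_add_finrank (ℂ ∙ o)
    omega
  intro f hf
  have h8 : A ⟨f, hf⟩ ∈ LinearMap.range T ⊔ (ℂ ∙ o) := hsup ▸ Submodule.mem_top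
  obtain ⟨_, ⟨g, rfl⟩, _, hz, hgz⟩ := Submodule.mem_sup.1 h8
  obtain ⟨c, rfl⟩ := Submodule.mem_span_singleton.1 hz
  have h9 : ev (f - (L g + c • one)) = 0 := by
    have := congrArg Subtype.val hgz
    rw [map_sub, map_add, map_smul, sub_eq_zero]
    exact this.symm
  have hm := V.sub_mem hf (V.add_mem (hLV g g.2) (V.smul_mem c hone))
  have e1 := h₁ _ hm h9
  have e2 := h₂ _ hm h9
  rw [map_sub, map_add, hL₁ g g.2, map_smul, zero_add, sub_eq_zero] at e1
  rw [map_sub, map_add, hL₂ g g.2, map_smul, zero_add, sub_eq_zero] at e2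
  rw [e1, e2, hE]

/-! ### Weighted filtration of polynomial rings -/

section Filtration

open MvPolynomial

variable {ι : Type*}

/-- Polynomials of weighted degree at most `d`, where the variable `X k` has weight `ω k`. -/
def weightLE (ω : ι → ℕ) (d : ℤ) : Submodule ℂ (MvPolynomial ι ℂ) :=
  Submodule.span ℂ {F | ∃ s : Multiset ι, ((s.map ω).sum : ℤ) ≤ d ∧ F = (s.map X).prod}

theorem weightLE_mono (ω : ι → ℕ) {d e : ℤ} (h : d ≤ e) : weightLE ω d ≤ weightLE ω e :=
  Submodule.span_mono fun _ ⟨s, hs, hF⟩ => ⟨s, hs.trans h, hF⟩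

/-- Weights are bounded by integers so that lowering below zero is meaningful and gives zero. This
is how derivatives in variables that are too heavy are seen to vanish. -/
theorem weightLE_of_neg (ω : ι → ℕ) {d : ℤ} (h : d < 0) : weightLE ω d = ⊥ := by
  rw [weightLE, Submodule.span_eq_bot]
  rintro _ ⟨s, hs, -⟩
  omega

theorem prod_X_mem_weightLE (ω : ι → ℕ) (s : Multiset ι) :
    (s.map X).prod ∈ weightLE ω ((s.map ω).sum : ℤ) :=
  Submodule.subset_span ⟨s, le_rfl, rfl⟩

theorem one_mem_weightLE (ω : ι → ℕ) {d : ℤ} (h : 0 ≤ d) : (1 : MvPolynomial ι ℂ) ∈ weightLE ω d :=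
  Submodule.subset_span ⟨0, by simpa using h, by simp⟩

theorem X_mem_weightLE (ω : ι → ℕ) (k : ι) : (X k : MvPolynomial ι ℂ) ∈ weightLE ω (ω k) :=
  Submodule.subset_span ⟨{k}, by simp, by simp⟩

theorem mul_mem_weightLE (ω : ι → ℕ) {d e : ℤ} {F G : MvPolynomial ι ℂ} (hF : F ∈ weightLE ω d)
    (hG : G ∈ weightLE ω e) : F * G ∈ weightLE ω (d + e) := by
  have h : weightLE ω d * weightLE ω e ≤ weightLE ω (d + e) := by
    rw [weightLE, weightLE, Submodule.span_mul_span]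
    apply Submodule.span_mono
    rintro _ ⟨_, ⟨s, hs, rfl⟩, _, ⟨t, ht, rfl⟩, rfl⟩
    refine ⟨s + t, ?_, by simp⟩
    rw [Multiset.map_add, Multiset.sum_add]
    rw [Nat.cast_add]
    exact add_le_add hs ht
  exact h (Submodule.mul_mem_mul hF hG)

theorem exists_mem_weightLE (ω : ι → ℕ) (F : MvPolynomial ι ℂ) : ∃ d : ℤ, F ∈ weightLE ω d := by
  induction F using MvPolynomial.induction_on with
  | C a =>
    refine ⟨0, ?_⟩
    rw [← mul_one (C a), ← smul_eq_C_mul]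
    exact Submodule.smul_mem _ _ (one_mem_weightLE ω le_rfl)
  | add p q hp hq =>
    obtain ⟨d, hd⟩ := hp
    obtain ⟨e, he⟩ := hq
    exact ⟨max d e, Submodule.add_mem _ (weightLE_mono ω (le_max_left _ _) hd)
      (weightLE_mono ω (le_max_right _ _) he)⟩
  | mul_X p k hp =>
    obtain ⟨d, hd⟩ := hp
    exact ⟨_, mul_mem_weightLE ω hd (X_mem_weightLE ω k)⟩

/-- A derivation raising the weight of each variable by at most `e` raises weights by at most
`e`. -/
theorem derivation_mem_weightLE (ω : ι → ℕ) {e : ℤ}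
    (D : Derivation ℂ (MvPolynomial ι ℂ) (MvPolynomial ι ℂ))
    (hD : ∀ j, D (X j) ∈ weightLE ω (ω j + e)) {d : ℤ} {F : MvPolynomial ι ℂ}
    (hF : F ∈ weightLE ω d) : D F ∈ weightLE ω (d + e) := by
  have key : ∀ s : Multiset ι, D ((s.map X).prod) ∈ weightLE ω ((s.map ω).sum + e) := by
    intro s
    induction s using Multiset.induction_on with
    | empty => simp
    | cons a s ih =>
      rw [Multiset.map_cons, Multiset.map_cons, Multiset.prod_cons, D.leibniz, Multiset.sum_cons,
        Nat.cast_add]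
      refine Submodule.add_mem _ ?_ ?_
      · rw [add_assoc]
        exact mul_mem_weightLE ω (X_mem_weightLE ω a) ih
      · rw [add_comm (ω a : ℤ), add_assoc]
        exact mul_mem_weightLE ω (prod_X_mem_weightLE ω s) (hD a)
  induction hF using Submodule.span_induction with
  | mem F h =>
    obtain ⟨s, hs, rfl⟩ := h
    exact weightLE_mono ω (by omega) (key s)
  | zero => simp
  | add F G _ _ hF hG => rw [map_add]; exact Submodule.add_mem _ hF hG
  | smul c F _ hF => rw [D.map_smul]; exact Submodule.smul_mem _ _ hF

theorem pderiv_mem_weightLE (ω : ι → ℕ) (k : ι) {d : ℤ} {F : MvPolynomial ι ℂ}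
    (hF : F ∈ weightLE ω d) : pderiv k F ∈ weightLE ω (d - ω k) := by
  classical
  refine derivation_mem_weightLE ω (e := -(ω k : ℤ)) (pderiv k) (fun j => ?_) hF
  rw [pderiv_X]
  by_cases h : j = k
  · subst h
    simpa using one_mem_weightLE ω le_rfl
  · rw [Pi.single_eq_of_ne h]
    exact zero_mem _

theorem pderiv_eq_zero_of_mem_weightLE (ω : ι → ℕ) {k : ι} {d : ℤ} {F : MvPolynomial ι ℂ}
    (hF : F ∈ weightLE ω d) (h : d < ω k) : pderiv k F = 0 := by
  have := pderiv_mem_weightLE ω k hF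
  rwa [weightLE_of_neg ω (by omega), Submodule.mem_bot] at this

/-- The chain rule for polynomials along a curve. -/
theorem hasDerivAt_eval_of_vars_subset {p : ℝ → ι → ℂ} {p' : ι → ℂ} {t : ℝ}
    (hp : ∀ k, HasDerivAt (fun s => p s k) (p' k) t) (S : Finset ι) {F : MvPolynomial ι ℂ}
    (hF : F.vars ⊆ S) :
    HasDerivAt (fun s => eval (p s) F) (∑ k ∈ S, eval (p t) (pderiv k F) * p' k) t := by
  classical
  have hF' : F ∈ supported ℂ (S : Set ι) := mem_supported.2 (by exact_mod_cast hF)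
  rw [supported] at hF'
  clear hF
  induction hF' using Algebra.adjoin_induction with
  | mem F h =>
    obtain ⟨k, hk, rfl⟩ := h
    rw [Finset.sum_eq_single k]
    · simpa using hp k
    · intro j _ hj
      simp [pderiv_X_of_ne hj.symm]
    · intro h
      exact absurd hk h
  | algebraMap c =>
    simpa [algebraMap_eq] using hasDerivAt_const t c
  | add F G hF1 hG1 hF hG =>
    have := hF.add hG
    simp only [map_add, add_mul, Finset.sum_add_distrib]
    exact this
  | mul F G hF1 hG1 hF hG =>
    have := hF.mul hG
    simp only [map_mul, Derivation.leibniz, smul_eq_mul, map_add, add_mul, Finset.sum_add_distrib]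
    refine this.congr_deriv ?_
    rw [Finset.sum_mul, Finset.mul_sum, add_comm]
    congr 1 <;> exact Finset.sum_congr rfl fun k _ => by ring

theorem derivation_sum_apply {κ : Type*} (S : Finset κ)
    (D : κ → Derivation ℂ (MvPolynomial ι ℂ) (MvPolynomial ι ℂ)) (F : MvPolynomial ι ℂ) :
    (∑ k ∈ S, D k) F = ∑ k ∈ S, D k F := by
  have := congrFun (map_sum (Derivation.coeFnAddMonoidHom (R := ℂ) (A := MvPolynomial ι ℂ)
    (M := MvPolynomial ι ℂ)) D S) F
  rwa [Finset.sum_apply] at this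

theorem mkDerivation_eq_sum_of_vars_subset (Γ : ι → MvPolynomial ι ℂ) (S : Finset ι)
    {F : MvPolynomial ι ℂ} (hF : F.vars ⊆ S) :
    mkDerivation ℂ Γ F = ∑ k ∈ S, pderiv k F * Γ k := by
  classical
  have h : mkDerivation ℂ Γ F = (∑ k ∈ S, Γ k • pderiv k) F := by
    apply derivation_eq_of_forall_mem_vars
    intro i hi
    rw [mkDerivation_X, derivation_sum_apply, Finset.sum_eq_single i]
    · simp
    · intro j _ hj
      simp [pderiv_X_of_ne hj.symm]
    · intro h
      exact absurd (hF hi) h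
  rw [h, derivation_sum_apply]
  exact Finset.sum_congr rfl fun k _ => by
    rw [Derivation.smul_apply, smul_eq_mul, mul_comm]

/-- Provides one finite index set for all polynomials of weight at most `d`. Finite sums over it
define operators that are linear on the whole filtration step. -/
theorem sum_pderiv_mul_eq_of_mem_weightLE {A : Type*} [CommRing A] (ev : MvPolynomial ι ℂ →+* A)
    (ω : ι → ℕ) {d : ℤ} {F : MvPolynomial ι ℂ} (hF : F ∈ weightLE ω d) (v : ι → A)
    {S S' : Finset ι} (hS : ∀ k, (ω k : ℤ) ≤ d → k ∈ S) (h : S ⊆ S') :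
    ∑ k ∈ S', ev (pderiv k F) * v k = ∑ k ∈ S, ev (pderiv k F) * v k := by
  symm
  apply Finset.sum_subset h
  intro k _ hk
  rw [pderiv_eq_zero_of_mem_weightLE ω hF (by by_contra hc; exact hk (hS k (by omega))), map_zero,
    zero_mul]

theorem hasDerivAt_eval_of_mem_weightLE (ω : ι → ℕ) {d : ℤ} {p : ℝ → ι → ℂ} {p' : ι → ℂ} {t : ℝ}
    (hp : ∀ k, HasDerivAt (fun s => p s k) (p' k) t) {S : Finset ι}
    (hS : ∀ k, (ω k : ℤ) ≤ d → k ∈ S) {F : MvPolynomial ι ℂ} (hF : F ∈ weightLE ω d) :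
    HasDerivAt (fun s => eval (p s) F) (∑ k ∈ S, eval (p t) (pderiv k F) * p' k) t := by
  classical
  rw [← sum_pderiv_mul_eq_of_mem_weightLE (eval (p t)) ω hF p' hS
    (Finset.subset_union_left (s₂ := F.vars))]
  exact hasDerivAt_eval_of_vars_subset hp _ Finset.subset_union_right

/-! ### The loop operator on the filtration -/

/-- The second order operator `f ↦ ∑ k ∈ S, c k * ∂ₖ f + D k (∂ₖ f)`, where `D k` is the derivation
`X j ↦ Γ k j`. -/
def loopOperator (c : ι → MvPolynomial ι ℂ) (Γ : ι → ι → MvPolynomial ι ℂ) (S : Finset ι) :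
    MvPolynomial ι ℂ →ₗ[ℂ] MvPolynomial ι ℂ :=
  ∑ k ∈ S, ((LinearMap.mulLeft ℂ (c k)).comp (pderiv k).toLinearMap +
    (mkDerivation ℂ (Γ k)).toLinearMap.comp (pderiv k).toLinearMap)

theorem loopOperator_apply (c : ι → MvPolynomial ι ℂ) (Γ : ι → ι → MvPolynomial ι ℂ)
    (S : Finset ι) (F : MvPolynomial ι ℂ) :
    loopOperator c Γ S F = ∑ k ∈ S, (c k * pderiv k F + mkDerivation ℂ (Γ k) (pderiv k F)) := by
  simp [loopOperator]

/-- Differentiation by the `k`-th variable lowers the weight by `ω k`. Multiplication by `c k`, or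
the derivation with values `Γ k j`, raises it again by at most `ω k`. -/
theorem loopOperator_mem_weightLE (ω : ι → ℕ) {c : ι → MvPolynomial ι ℂ}
    {Γ : ι → ι → MvPolynomial ι ℂ} (hc : ∀ k, c k ∈ weightLE ω (ω k))
    (hΓ : ∀ k j, Γ k j ∈ weightLE ω (ω j + ω k)) (S : Finset ι) {d : ℤ} {F : MvPolynomial ι ℂ}
    (hF : F ∈ weightLE ω d) : loopOperator c Γ S F ∈ weightLE ω d := by
  rw [loopOperator_apply]
  refine Submodule.sum_mem _ fun k _ => Submodule.add_mem _ ?_ ?_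
  · have := mul_mem_weightLE ω (hc k) (pderiv_mem_weightLE ω k hF)
    rwa [add_sub_cancel] at this
  · have := derivation_mem_weightLE ω (e := ω k) (mkDerivation ℂ (Γ k))
      (fun j => by rw [mkDerivation_X]; exact hΓ k j) (pderiv_mem_weightLE ω k hF)
    rwa [sub_add_cancel] at this

end Filtration

end BoseGas

end

noncomputable section
namespace BoseGas

/-! ### Integration by parts on a box -/

/-- The cube `[a, b]^N`. -/
def cube (N : ℕ) (a b : ℝ) : Set (Fin N → ℝ) := Set.pi Set.univ fun _ => Set.Icc a b

theorem isCompact_cube (N : ℕ) (a b : ℝ) : IsCompact (cube N a b) :=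
  isCompact_univ_pi fun _ => isCompact_Icc

theorem measurableSet_cube (N : ℕ) (a b : ℝ) : MeasurableSet (cube N a b) :=
  (isCompact_cube N a b).measurableSet

theorem integrableOn_cube {E : Type*} [NormedAddCommGroup E] {N : ℕ} {a b : ℝ}
    {F : (Fin N → ℝ) → E} (hF : Continuous F) : IntegrableOn F (cube N a b) :=
  hF.continuousOn.integrableOn_compact (isCompact_cube N a b)

/-- Fubini with the `l`-th coordinate integrated first: the fundamental theorem of calculus leaves
the difference of two boundary values, which `hb` cancels. -/
theorem integral_cube_partial_eq_zero {N : ℕ} {a b : ℝ} (hab : a ≤ b) (l : Fin N)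
    {F F' : (Fin N → ℝ) → ℂ} (hF' : Continuous F')
    (hd : ∀ x, HasDerivAt (fun t => F (Function.update x l t)) (F' x) (x l))
    (hb : ∀ x, F (Function.update x l a) = F (Function.update x l b)) :
    ∫ x in cube N a b, F' x = 0 := by
  obtain _ | n := N
  · exact l.elim0
  have hmp := (volume_preserving_piFinSuccAbove (fun _ : Fin (n + 1) => ℝ) l).symm
  have hins : ∀ (t : ℝ) (y : Fin n → ℝ),
      (MeasurableEquiv.piFinSuccAbove (fun _ : Fin (n + 1) => ℝ) l).symm (t, y)
        = l.insertNth t y := fun t y => rfl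
  have hupd : ∀ (s t : ℝ) (y : Fin n → ℝ), Function.update
      (l.insertNth (α := fun _ => ℝ) s y) l t = l.insertNth (α := fun _ => ℝ) t y :=
    fun s t y => Fin.update_insertNth (α := fun _ => ℝ) l s t y
  have hpre : (MeasurableEquiv.piFinSuccAbove (fun _ : Fin (n + 1) => ℝ) l).symm ⁻¹'
      (cube (n + 1) a b) = Set.Icc a b ×ˢ cube n a b := by
    ext ⟨t, y⟩
    rw [Set.mem_preimage, hins, cube, Set.mem_univ_pi, Fin.forall_iff_succAbove l]
    simp only [cube, Set.mem_prod, Set.mem_univ_pi, Fin.insertNth_apply_same,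
      Fin.insertNth_apply_succAbove]
  rw [← hmp.setIntegral_preimage_emb (MeasurableEquiv.measurableEmbedding _), hpre,
    Measure.volume_eq_prod, ← Measure.prod_restrict]
  have hcont : Continuous fun p : ℝ × (Fin n → ℝ) =>
      F' ((MeasurableEquiv.piFinSuccAbove (fun _ : Fin (n + 1) => ℝ) l).symm p) := by
    apply hF'.comp
    have : Continuous fun p : ℝ × (Fin n → ℝ) => l.insertNth (α := fun _ => ℝ) p.1 p.2 := by
      fun_prop
    exact this
  rw [integral_prod_symm]
  · apply integral_eq_zero_of_ae
    filter_upwards with y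
    rw [integral_Icc_eq_integral_Ioc, ← intervalIntegral.integral_of_le hab]
    rw [intervalIntegral.integral_eq_sub_of_hasDerivAt
      (f := fun t => F (l.insertNth t y))]
    · have := hb (l.insertNth (α := fun _ => ℝ) a y)
      rw [hupd, hupd] at this
      rw [this, sub_self]
      rfl
    · intro t _
      have := hd (l.insertNth (α := fun _ => ℝ) t y)
      simp only [hupd, Fin.insertNth_apply_same] at this
      exact this
    · apply Continuous.intervalIntegrable
      exact hcont.comp (by fun_prop)
  · rw [Measure.prod_restrict]
    exact hcont.continuousOn.integrableOn_compact (isCompact_Icc.prod (isCompact_cube n a b))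

theorem cube_eq_closure_interior {N : ℕ} {a b : ℝ} (hab : a < b) :
    cube N a b = closure (Set.pi Set.univ fun _ : Fin N => Set.Ioo a b) := by
  rw [closure_pi_set]
  simp [cube, closure_Ioo hab.ne]

/-- Coincidences of two coordinates lie on finitely many proper subspaces, which are null sets.
Hence it is harmless that Vandermonde weights vanish there. -/
theorem ae_injective {N : ℕ} : ∀ᵐ x : Fin N → ℝ, Function.Injective x := by
  have h : ∀ i j : Fin N, i ≠ j → ∀ᵐ x : Fin N → ℝ, x i ≠ x j := by
    intro i j hij
    let K : Submodule ℝ (Fin N → ℝ) :=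
      LinearMap.ker (LinearMap.proj (R := ℝ) (φ := fun _ : Fin N => ℝ) i - LinearMap.proj j)
    have hK : K ≠ ⊤ := by
      intro h
      have : (Pi.single i 1 : Fin N → ℝ) ∈ K := h ▸ Submodule.mem_top
      simp [K, LinearMap.mem_ker, Pi.single_eq_of_ne hij.symm] at this
    have := Measure.addHaar_submodule (volume : Measure (Fin N → ℝ)) K hK
    rw [ae_iff]
    convert this using 2
    ext x
    simp [K, LinearMap.mem_ker, sub_eq_zero]
  have h2 : ∀ᵐ x : Fin N → ℝ, ∀ i j : Fin N, i ≠ j → x i ≠ x j := by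
    rw [ae_all_iff]; intro i
    rw [ae_all_iff]; intro j
    by_cases hij : i = j
    · simp [hij]
    · filter_upwards [h i j hij] with x hx _
      exact hx
  filter_upwards [h2] with x hx i j hij
  by_contra hne
  exact hx i j hne hij

/-- A differentiable function on `[a, b]^N` whose gradient has zero mean square with respect to a
weight that is positive at the injective points is constant. -/
theorem const_on_cube_of_integral_grad_eq_zero {N : ℕ} {a b : ℝ} (hab : a < b)
    {f : (Fin N → ℝ) → ℂ} (hf : Differentiable ℝ f) {f' : Fin N → (Fin N → ℝ) → ℂ}
    (hf'c : ∀ l, Continuous (f' l))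
    (hd : ∀ l x, HasDerivAt (fun t => f (Function.update x l t)) (f' l x) (x l))
    {W : (Fin N → ℝ) → ℝ} (hWc : Continuous W) (hW : ∀ x, 0 ≤ W x)
    (hpos : ∀ x ∈ Set.pi Set.univ fun _ : Fin N => Set.Ioo a b, Function.Injective x → 0 < W x)
    (h0 : ∫ x in cube N a b, (∑ l, ‖f' l x‖ ^ 2) * W x = 0) :
    ∃ c : ℂ, ∀ x ∈ cube N a b, f x = c := by
  set U : Set (Fin N → ℝ) := Set.pi Set.univ fun _ : Fin N => Set.Ioo a b with hU
  have hUo : IsOpen U := isOpen_set_pi Set.finite_univ fun _ _ => isOpen_Ioo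
  have hUsub : U ⊆ cube N a b := Set.pi_mono fun _ _ => Set.Ioo_subset_Icc_self
  have hg : Continuous fun x => ∑ l, ‖f' l x‖ ^ 2 := by fun_prop
  have hnn : ∀ x, 0 ≤ ∑ l, ‖f' l x‖ ^ 2 := fun x => Finset.sum_nonneg fun l _ => by positivity
  have hae := (setIntegral_eq_zero_iff_of_nonneg_ae
    (Filter.Eventually.of_forall fun x => mul_nonneg (hnn x) (hW x))
    (integrableOn_cube (hg.mul hWc))).1 h0
  have haeU : (fun x => ∑ l, ‖f' l x‖ ^ 2) =ᵐ[volume.restrict U] 0 := by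
    have h1 := ae_mono (Measure.restrict_mono_set volume hUsub) hae
    filter_upwards [h1, ae_restrict_of_ae ae_injective, ae_restrict_mem hUo.measurableSet]
      with x hx hi hxU
    have : (∑ l, ‖f' l x‖ ^ 2) * W x = 0 := hx
    exact (mul_eq_zero.1 this).resolve_right (hpos x hxU hi).ne'
  -- The gradient vanishes almost everywhere on the open cube, hence everywhere on it by continuity.
  -- No regularity at the zeros of `W` is needed.
  have hzero : Set.EqOn (fun x => ∑ l, ‖f' l x‖ ^ 2) 0 U :=
    Measure.eqOn_open_of_ae_eq haeU hUo hg.continuousOn continuousOn_const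
  have hfd : Set.EqOn (fderiv ℝ f) 0 U := by
    intro x hx
    have hx0 : ∀ l, f' l x = 0 := by
      intro l
      have := (Finset.sum_eq_zero_iff_of_nonneg (fun l _ => by positivity)).1 (hzero hx) l
        (Finset.mem_univ l)
      simpa using this
    have hsingle : ∀ l, fderiv ℝ f x (Pi.single l 1) = 0 := by
      intro l
      have h1 : HasFDerivAt f (fderiv ℝ f x) (Function.update x l (x l)) := by
        rw [Function.update_eq_self]
        exact (hf x).hasFDerivAt
      have h2 := h1.comp_hasDerivAt (x l) (hasDerivAt_update x l (x l))
      rw [h2.unique (hd l x), hx0 l]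
    ext v
    rw [pi_eq_sum_univ' v, map_sum]
    simp only [Pi.zero_apply, _root_.zero_apply]
    refine Finset.sum_eq_zero fun l _ => ?_
    rw [map_smul]
    simp [hsingle l]
  have hconv : Convex ℝ U := convex_pi fun _ _ => convex_Ioo a b
  obtain ⟨c, hc⟩ := hUo.exists_is_const_of_fderiv_eq_zero hconv.isPreconnected
    hf.differentiableOn hfd
  refine ⟨c, fun x hx => ?_⟩
  rw [cube_eq_closure_interior hab] at hx
  have : Set.EqOn f (fun _ => c) (closure U) :=
    Set.EqOn.closure (fun y hy => hc y hy) hf.continuous continuous_const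
  exact this hx

end BoseGas
end

noncomputable section
namespace BoseGas

/-! ### Ensembles of angles satisfying loop equations -/

open MvPolynomial in
/-- A density `W` on the cube `[a, b]^N` together with one-variable functions `φ k`, such that the
vector fields `∑ l, φ₁ k (x l) ∂_l`, `φ₁ k = (φ k)'`, have divergence `c k` with respect to `W` and
satisfy `∑ l, φ₁ k (x l) φ₁ j (x l) = Γ k j`; here `c k` and `Γ k j` are polynomials in the linear
statistics `∑ l, φ k (x l)`. -/
structure LoopEnsemble (ι : Type*) (N : ℕ) where
  a : ℝ
  b : ℝ
  hab : a < b
  φ : ι → ℝ → ℂ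
  φ₁ : ι → ℝ → ℂ
  φ₂ : ι → ℝ → ℂ
  hφ : ∀ k t, HasDerivAt (φ k) (φ₁ k t) t
  hφ₁ : ∀ k t, HasDerivAt (φ₁ k) (φ₂ k t) t
  hφ₂ : ∀ k, Continuous (φ₂ k)
  W : (Fin N → ℝ) → ℝ
  W' : Fin N → (Fin N → ℝ) → ℝ
  hW : Continuous W
  hW' : ∀ l, Continuous (W' l)
  hWd : ∀ l x, HasDerivAt (fun t => W (Function.update x l t)) (W' l x) (x l)
  W_nonneg : ∀ x, 0 ≤ W x
  W_pos : ∀ x ∈ Set.pi Set.univ fun _ : Fin N => Set.Ioo a b, Function.Injective x → 0 < W x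
  ω : ι → ℕ
  c : ι → MvPolynomial ι ℂ
  Γ : ι → ι → MvPolynomial ι ℂ
  c_mem : ∀ k, c k ∈ weightLE ω (ω k)
  Γ_mem : ∀ k j, Γ k j ∈ weightLE ω (ω j + ω k)
  div_eq : ∀ k x, ∑ l, (φ₂ k (x l) * W x + φ₁ k (x l) * W' l x) =
    eval (fun j => ∑ l, φ j (x l)) (c k) * W x
  grad_eq : ∀ k j (x : Fin N → ℝ), ∑ l, φ₁ k (x l) * φ₁ j (x l) =
    eval (fun j => ∑ l, φ j (x l)) (Γ k j)
  -- Two ways to have no boundary terms: the fields vanish at the ends, or fields, statistics and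
  -- density are all periodic.
  boundary : (∀ k, φ₁ k a = 0 ∧ φ₁ k b = 0) ∨ ((∀ k, φ k a = φ k b ∧ φ₁ k a = φ₁ k b) ∧
    ∀ x l, W (Function.update x l a) = W (Function.update x l b))
  finite_weight : ∀ d : ℤ, {k | (ω k : ℤ) ≤ d}.Finite
  -- A variable of weight zero has powers of weight zero, so bounded weight alone does not give
  -- finite dimension. As a statistic such a variable must be constant.
  const_of_weight_zero : ∀ k, ω k = 0 → ∀ s t, φ k s = φ k t

/-! ### Partial integration, Dirichlet form and uniqueness for a loop ensemble -/

namespace LoopEnsemble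

open MvPolynomial

variable {ι : Type*} {N : ℕ} (A : LoopEnsemble ι N)

/-- The linear statistics of a configuration. -/
def stat (x : Fin N → ℝ) (k : ι) : ℂ := ∑ l, A.φ k (x l)

theorem continuous_φ (k : ι) : Continuous (A.φ k) :=
  continuous_iff_continuousAt.2 fun t => (A.hφ k t).continuousAt

theorem continuous_φ₁ (k : ι) : Continuous (A.φ₁ k) :=
  continuous_iff_continuousAt.2 fun t => (A.hφ₁ k t).continuousAt

theorem continuous_stat (k : ι) : Continuous fun x => A.stat x k := by
  have := A.continuous_φ k
  unfold stat
  fun_prop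

theorem continuous_eval_stat (f : MvPolynomial ι ℂ) : Continuous fun x => eval (A.stat x) f := by
  induction f using MvPolynomial.induction_on with
  | C z => simpa using continuous_const
  | add p q hp hq => simpa only [map_add] using hp.fun_add hq
  | mul_X p k hp => simpa only [map_mul, eval_X] using hp.fun_mul (A.continuous_stat k)

theorem differentiable_eval_stat (f : MvPolynomial ι ℂ) :
    Differentiable ℝ fun x => eval (A.stat x) f := by
  have hφ : ∀ k, Differentiable ℝ (A.φ k) := fun k t => (A.hφ k t).differentiableAt
  have hs : ∀ k, Differentiable ℝ fun x => A.stat x k := by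
    intro k
    have := hφ k
    unfold stat
    fun_prop
  induction f using MvPolynomial.induction_on with
  | C z => simp
  | add p q hp hq => simpa only [map_add] using hp.fun_add hq
  | mul_X p k hp => simpa only [map_mul, eval_X] using hp.fun_mul (hs k)

theorem hasDerivAt_stat (x : Fin N → ℝ) (l : Fin N) (k : ι) :
    HasDerivAt (fun t => A.stat (Function.update x l t) k) (A.φ₁ k (x l)) (x l) := by
  unfold stat
  have h : ∀ i ∈ Finset.univ, HasDerivAt (fun t => A.φ k (Function.update x l t i))
      (if i = l then A.φ₁ k (x l) else 0) (x l) := by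
    intro i _
    by_cases hi : i = l
    · subst hi
      simpa using A.hφ k (x i)
    · simpa [hi] using hasDerivAt_const (x l) (A.φ k (x i))
  simpa using HasDerivAt.fun_sum h

/-- A finite set of indices containing those of weight at most `d`. -/
def idx (d : ℤ) : Finset ι := (A.finite_weight d).toFinset

theorem mem_idx {d : ℤ} {k : ι} (h : (A.ω k : ℤ) ≤ d) : k ∈ A.idx d := by
  simpa [idx] using h

/-- The partial derivatives of a polynomial in the linear statistics. -/
def grad (d : ℤ) (f : MvPolynomial ι ℂ) (l : Fin N) (x : Fin N → ℝ) : ℂ :=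
  ∑ k ∈ A.idx d, eval (A.stat x) (pderiv k f) * A.φ₁ k (x l)

theorem hasDerivAt_eval_stat {d : ℤ} {f : MvPolynomial ι ℂ} (hf : f ∈ weightLE A.ω d)
    (x : Fin N → ℝ) (l : Fin N) :
    HasDerivAt (fun t => eval (A.stat (Function.update x l t)) f) (A.grad d f l x) (x l) := by
  have := hasDerivAt_eval_of_mem_weightLE A.ω (p := fun t => A.stat (Function.update x l t))
    (A.hasDerivAt_stat x l) (fun k hk => A.mem_idx hk) hf
  simpa [grad, Function.update_eq_self] using this

theorem continuous_grad (d : ℤ) (f : MvPolynomial ι ℂ) (l : Fin N) : Continuous (A.grad d f l) := by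
  unfold grad
  refine continuous_finsetSum _ fun k _ => (A.continuous_eval_stat _).mul ?_
  exact (A.continuous_φ₁ k).comp (continuous_apply l)

/-- Integration by parts along the vector field `∑ l, φ₁ k (x l) ∂_l`. -/
theorem integral_div_add_grad (k : ι) {h : (Fin N → ℝ) → ℂ} {h' : Fin N → (Fin N → ℝ) → ℂ}
    (hc : Continuous h) (hc' : ∀ l, Continuous (h' l))
    (hd : ∀ l x, HasDerivAt (fun t => h (Function.update x l t)) (h' l x) (x l))
    (hb : (∀ k, A.φ k A.a = A.φ k A.b) → ∀ x l, h (Function.update x l A.a) =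
      h (Function.update x l A.b)) :
    ∫ x in cube N A.a A.b, (eval (A.stat x) (A.c k) * h x + ∑ l, A.φ₁ k (x l) * h' l x) * A.W x
      = 0 := by
  have hφ₁ := A.continuous_φ₁ k
  have hφ₂ := A.hφ₂ k
  have hW := A.hW
  have hW' := A.hW'
  -- `F' l` is the `l`-th partial derivative of `φ₁ k (x l) * h * W`. In the sum over `l`, `div_eq`
  -- turns the terms without derivatives of `h` into `c k * h * W`.
  set F' : Fin N → (Fin N → ℝ) → ℂ := fun l x =>
    A.φ₂ k (x l) * (h x * A.W x) + A.φ₁ k (x l) * (h' l x * A.W x + h x * A.W' l x) with hF'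
  have hF'c : ∀ l, Continuous (F' l) := by
    intro l
    have := hc' l
    have := hW' l
    simp only [hF']
    fun_prop
  have h1 : ∀ l, ∫ x in cube N A.a A.b, F' l x = 0 := by
    intro l
    refine integral_cube_partial_eq_zero A.hab.le l
      (F := fun x => A.φ₁ k (x l) * (h x * A.W x)) (hF'c l) (fun x => ?_) fun x => ?_
    · have e1 : HasDerivAt (fun t => A.φ₁ k (Function.update x l t l)) (A.φ₂ k (x l)) (x l) := by
        simpa using A.hφ₁ k (x l)
      have := e1.fun_mul ((hd l x).fun_mul (A.hWd l x).ofReal_comp)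
      simpa [hF', Function.update_eq_self] using this
    · rcases A.boundary with hbd | ⟨hbd, hbW⟩
      · simp [(hbd k).1, (hbd k).2]
      · simp only [Function.update_self, (hbd k).2, hbW, hb fun k => (hbd k).1]
  have h2 : ∀ x, (eval (A.stat x) (A.c k) * h x + ∑ l, A.φ₁ k (x l) * h' l x) * A.W x =
      ∑ l, F' l x := by
    intro x
    have := A.div_eq k x
    change _ = eval (A.stat x) (A.c k) * _ at this
    rw [add_mul, mul_right_comm, ← this, Finset.sum_mul, Finset.sum_mul, ← Finset.sum_add_distrib]
    refine Finset.sum_congr rfl fun l _ => ?_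
    simp only [hF']
    ring
  simp_rw [h2]
  rw [integral_finsetSum _ fun l _ => integrableOn_cube (hF'c l)]
  exact Finset.sum_eq_zero fun l _ => h1 l

/-- By the chain rule and `grad_eq`, the `k`-th vector field acts on functions of the statistics as
the derivation `X j ↦ Γ k j`. -/
theorem sum_φ₁_mul_grad {d : ℤ} {g : MvPolynomial ι ℂ} (hg : g ∈ weightLE A.ω d) (k : ι)
    (x : Fin N → ℝ) :
    ∑ l, A.φ₁ k (x l) * A.grad d g l x = eval (A.stat x) (mkDerivation ℂ (A.Γ k) g) := by
  classical
  rw [mkDerivation_eq_sum_of_vars_subset (A.Γ k) (A.idx d ∪ g.vars) Finset.subset_union_right,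
    map_sum]
  simp_rw [map_mul]
  rw [sum_pderiv_mul_eq_of_mem_weightLE (eval (A.stat x)) A.ω hg _ (fun k hk => A.mem_idx hk)
    Finset.subset_union_left]
  simp_rw [grad, Finset.mul_sum]
  rw [Finset.sum_comm]
  refine Finset.sum_congr rfl fun j _ => ?_
  rw [show eval (A.stat x) (A.Γ k j) = _ from (A.grad_eq k j x).symm, Finset.mul_sum]
  exact Finset.sum_congr rfl fun l _ => by ring

theorem eval_update_eq (hb : ∀ k, A.φ k A.a = A.φ k A.b) (f : MvPolynomial ι ℂ) (x : Fin N → ℝ)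
    (l : Fin N) :
    eval (A.stat (Function.update x l A.a)) f = eval (A.stat (Function.update x l A.b)) f := by
  congr 2
  ext k
  refine Finset.sum_congr rfl fun i _ => ?_
  by_cases hi : i = l
  · subst hi; simp [hb]
  · simp [hi]

/-- The unnormalised average of a polynomial in the linear statistics. -/
def functional : MvPolynomial ι ℂ →ₗ[ℂ] ℂ where
  toFun f := ∫ x in cube N A.a A.b, eval (A.stat x) f * A.W x
  map_add' f g := by
    have h : ∀ f, Integrable (fun x => eval (A.stat x) f * (A.W x : ℂ))
        (volume.restrict (cube N A.a A.b)) := fun f => integrableOn_cube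
      ((A.continuous_eval_stat f).mul (Complex.continuous_ofReal.comp A.hW))
    simp_rw [map_add, add_mul]
    exact integral_add (h f) (h g)
  map_smul' z f := by
    simp only [smul_eval, mul_assoc, integral_const_mul, RingHom.id_apply, smul_eq_mul]

theorem functional_apply (f : MvPolynomial ι ℂ) :
    A.functional f = ∫ x in cube N A.a A.b, eval (A.stat x) f * A.W x := rfl

theorem functional_loop (k : ι) (g : MvPolynomial ι ℂ) :
    A.functional (A.c k * g + mkDerivation ℂ (A.Γ k) g) = 0 := by
  obtain ⟨d, hg⟩ := exists_mem_weightLE A.ω g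
  have := A.integral_div_add_grad k (h := fun x => eval (A.stat x) g) (h' := A.grad d g)
    (A.continuous_eval_stat g) (A.continuous_grad d g) (fun l x => A.hasDerivAt_eval_stat hg x l)
    (fun hb x l => A.eval_update_eq hb g x l)
  simp_rw [A.sum_φ₁_mul_grad hg k] at this
  simpa [functional_apply] using this

theorem functional_loopOperator (S : Finset ι) (f : MvPolynomial ι ℂ) :
    A.functional (loopOperator A.c A.Γ S f) = 0 := by
  rw [loopOperator_apply, map_sum]
  exact Finset.sum_eq_zero fun k _ => A.functional_loop k _

/-- The Dirichlet form identity. Partial integration along the `k`-th field is applied to `∂ₖf *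
conj f`. In the sum over `k`, the terms without a derivative of `conj f` form `loopOperator f * conj
f`, and those with one form `|∇f|²`. -/
theorem integral_loopOperator_mul_conj {d : ℤ} {f : MvPolynomial ι ℂ} (hf : f ∈ weightLE A.ω d) :
    ∫ x in cube N A.a A.b, (eval (A.stat x) (loopOperator A.c A.Γ (A.idx d) f) *
      (starRingEnd ℂ) (eval (A.stat x) f) + ∑ l, ((‖A.grad d f l x‖ ^ 2 : ℝ) : ℂ)) * A.W x = 0 := by
  have hW := A.hW
  have hcg := A.continuous_grad d f
  have hcf := A.continuous_eval_stat f
  have hk : ∀ k, ∃ d', pderiv k f ∈ weightLE A.ω d' := fun k => exists_mem_weightLE A.ω _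
  choose d' hd' using hk
  let h : ι → (Fin N → ℝ) → ℂ := fun k x =>
    eval (A.stat x) (pderiv k f) * (starRingEnd ℂ) (eval (A.stat x) f)
  let h' : ι → Fin N → (Fin N → ℝ) → ℂ := fun k l x =>
    A.grad (d' k) (pderiv k f) l x * (starRingEnd ℂ) (eval (A.stat x) f) +
      eval (A.stat x) (pderiv k f) * (starRingEnd ℂ) (A.grad d f l x)
  have hhc : ∀ k, Continuous (h k) := fun k =>
    (A.continuous_eval_stat _).mul (Complex.continuous_conj.comp hcf)
  have hhc' : ∀ k l, Continuous (h' k l) := fun k l =>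
    ((A.continuous_grad _ _ l).mul (Complex.continuous_conj.comp hcf)).add
      ((A.continuous_eval_stat _).mul (Complex.continuous_conj.comp (hcg l)))
  have hI : ∀ k, ∫ x in cube N A.a A.b, (eval (A.stat x) (A.c k) * h k x +
      ∑ l, A.φ₁ k (x l) * h' k l x) * A.W x = 0 := by
    intro k
    refine A.integral_div_add_grad k (hhc k) (hhc' k) (fun l x => ?_) fun hb x l => ?_
    · have e1 := A.hasDerivAt_eval_stat (hd' k) x l
      have e2 := Complex.conjCLE.hasFDerivAt.comp_hasDerivAt (x l) (A.hasDerivAt_eval_stat hf x l)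
      have := e1.fun_mul e2
      simpa [h, h', Function.update_eq_self] using this
    · simp only [h, A.eval_update_eq hb]
  have hpt : ∀ x, (eval (A.stat x) (loopOperator A.c A.Γ (A.idx d) f) *
      (starRingEnd ℂ) (eval (A.stat x) f) + ∑ l, ((‖A.grad d f l x‖ ^ 2 : ℝ) : ℂ)) * A.W x =
      ∑ k ∈ A.idx d, (eval (A.stat x) (A.c k) * h k x + ∑ l, A.φ₁ k (x l) * h' k l x) * A.W x := by
    intro x
    rw [← Finset.sum_mul, loopOperator_apply, map_sum, Finset.sum_mul]
    congr 1
    -- One factor of `|∇f|² = ∇f · conj ∇f` is expanded along the fields `φ₁ k`; the other stays as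
    -- the gradient of `conj f`. The fields may be complex, but the coordinate derivatives are real
    -- and commute with conjugation.
    have e3 : ∑ l, ((‖A.grad d f l x‖ ^ 2 : ℝ) : ℂ) = ∑ k ∈ A.idx d, ∑ l,
        A.φ₁ k (x l) * (eval (A.stat x) (pderiv k f) * (starRingEnd ℂ) (A.grad d f l x)) := by
      rw [Finset.sum_comm]
      refine Finset.sum_congr rfl fun l _ => ?_
      rw [Complex.ofReal_pow, ← Complex.mul_conj']
      conv_lhs => enter [1]; rw [grad]
      rw [Finset.sum_mul]
      exact Finset.sum_congr rfl fun k _ => by ring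
    rw [e3, ← Finset.sum_add_distrib]
    refine Finset.sum_congr rfl fun k _ => ?_
    simp only [h, h', mul_add, Finset.sum_add_distrib, map_add, map_mul]
    rw [← A.sum_φ₁_mul_grad (hd' k) k x]
    rw [add_mul, Finset.sum_mul]
    simp only [mul_assoc, add_assoc]
  simp_rw [hpt]
  rw [integral_finsetSum]
  · exact Finset.sum_eq_zero fun k _ => hI k
  · intro k _
    apply integrableOn_cube
    have e4 := hhc k
    have e5 := hhc' k
    have e6 := A.continuous_eval_stat (A.c k)
    have e7 := A.continuous_φ₁ k
    fun_prop

theorem const_of_loopOperator_eq_zero {d : ℤ} {f : MvPolynomial ι ℂ} (hf : f ∈ weightLE A.ω d)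
    (h : ∀ x ∈ cube N A.a A.b, eval (A.stat x) (loopOperator A.c A.Γ (A.idx d) f) = 0) :
    ∃ z : ℂ, ∀ x ∈ cube N A.a A.b, eval (A.stat x) f = z := by
  refine const_on_cube_of_integral_grad_eq_zero A.hab (A.differentiable_eval_stat f)
    (A.continuous_grad d f) (fun l x => A.hasDerivAt_eval_stat hf x l) A.hW A.W_nonneg A.W_pos ?_
  have h1 := A.integral_loopOperator_mul_conj hf
  have h2 : ∫ x in cube N A.a A.b, (((∑ l, ‖A.grad d f l x‖ ^ 2) * A.W x : ℝ) : ℂ) = 0 := by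
    rw [← h1]
    refine setIntegral_congr_fun (measurableSet_cube N A.a A.b) fun x hx => ?_
    simp only [h x hx, zero_mul, zero_add]
    push_cast
    rfl
  rw [integral_complex_ofReal] at h2
  exact_mod_cast h2

/-- Evaluation on the cube. -/
def evalCube : MvPolynomial ι ℂ →ₗ[ℂ] (cube N A.a A.b → ℂ) :=
  LinearMap.pi fun x => (aeval (R := ℂ) (A.stat x)).toLinearMap

theorem evalCube_apply (f : MvPolynomial ι ℂ) (x : cube N A.a A.b) :
    A.evalCube f x = eval (A.stat x) f := by
  simp [evalCube, aeval_eq_eval]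

/-- On configurations the variables of weight zero are constants and can be stripped from a
monomial. What is left has at most `d` factors, taken from finitely many variables. -/
theorem finiteDimensional_map_evalCube (d : ℤ) :
    FiniteDimensional ℂ ((weightLE A.ω d).map A.evalCube) := by
  classical
  let S := {k | (A.ω k : ℤ) ≤ d}
  have : Finite S := A.finite_weight d
  let T : Set (MvPolynomial ι ℂ) := (fun l : List S => (l.map fun k : S => X (k : ι)).prod) ''
    {l | l.length ≤ d.toNat}
  have hT : T.Finite := (List.finite_length_le S d.toNat).image _
  have hle : (weightLE A.ω d).map A.evalCube ≤ Submodule.span ℂ (A.evalCube '' T) := by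
    rw [weightLE, Submodule.map_span, Submodule.span_le]
    rintro _ ⟨_, ⟨s, hs, rfl⟩, rfl⟩
    have hsub : ∀ k ∈ s, (A.ω k : ℤ) ≤ d := fun k hk =>
      le_trans (Nat.cast_le.2 (Multiset.single_le_sum (fun _ _ => Nat.zero_le _) _
        (Multiset.mem_map_of_mem A.ω hk))) hs
    have key : ∀ s : Multiset ι, (∀ k ∈ s, (A.ω k : ℤ) ≤ d) → ∃ (z : ℂ) (l : List S),
        l.length ≤ (s.map A.ω).sum ∧ A.evalCube (s.map X).prod =
          z • A.evalCube ((l.map fun k : S => X (k : ι)).prod) := by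
      intro s
      induction s using Multiset.induction_on with
      | empty => exact fun _ => ⟨1, [], by simp, by simp⟩
      | cons k s ih =>
        intro hk
        obtain ⟨z, l, hl, he⟩ := ih fun j hj => hk j (Multiset.mem_cons_of_mem hj)
        have he' := fun x => congrFun he x
        simp only [evalCube_apply, Pi.smul_apply, smul_eq_mul] at he'
        by_cases h0 : A.ω k = 0
        · refine ⟨(∑ _ : Fin N, A.φ k A.a) * z, l, by simpa [h0] using hl, ?_⟩
          ext x
          simp only [evalCube_apply, Multiset.map_cons, Multiset.prod_cons, map_mul, eval_X,
            Pi.smul_apply, smul_eq_mul, he', stat]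
          rw [Finset.sum_congr rfl fun i _ => A.const_of_weight_zero k h0 (x.1 i) A.a]
          ring
        · refine ⟨z, ⟨k, hk k (Multiset.mem_cons_self k s)⟩ :: l, ?_, ?_⟩
          · simp only [List.length_cons, Multiset.map_cons, Multiset.sum_cons]
            omega
          · ext x
            simp only [evalCube_apply, Multiset.map_cons, Multiset.prod_cons, map_mul, eval_X,
              Pi.smul_apply, smul_eq_mul, he', List.map_cons, List.prod_cons]
            ring
    obtain ⟨z, l, hl, he⟩ := key s hsub
    rw [SetLike.mem_coe, he]
    refine Submodule.smul_mem _ _ (Submodule.subset_span ⟨_, ⟨l, ?_, rfl⟩, rfl⟩)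
    simp only [Set.mem_ofPred_eq]
    omega
  have := FiniteDimensional.span_of_finite ℂ (hT.image A.evalCube)
  exact Submodule.finiteDimensional_of_le hle

theorem integral_W_pos : 0 < ∫ x in cube N A.a A.b, A.W x := by
  rw [setIntegral_pos_iff_support_of_nonneg_ae
    (Filter.Eventually.of_forall fun x => A.W_nonneg x) (integrableOn_cube A.hW)]
  set U : Set (Fin N → ℝ) := Set.pi Set.univ fun _ : Fin N => Set.Ioo A.a A.b with hU
  have hUv : 0 < volume U := by
    have := A.hab
    rw [hU, volume_pi_pi]
    simp only [Real.volume_Ioo, Finset.prod_const]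
    exact pos_iff_ne_zero.2 (pow_ne_zero _ (ENNReal.ofReal_pos.2 (sub_pos.2 this)).ne')
  refine hUv.trans_le (measure_mono_ae ?_)
  filter_upwards [ae_injective] with x hi hx
  exact ⟨(A.W_pos x hx hi).ne', fun i hi => Set.Ioo_subset_Icc_self (hx i hi)⟩

theorem functional_one : A.functional 1 = ((∫ x in cube N A.a A.b, A.W x : ℝ) : ℂ) := by
  rw [functional_apply, ← integral_complex_ofReal]
  simp

/-- **Weyl integration principle**: a normalised functional satisfying the loop equations of the
ensemble and vanishing on polynomials that vanish on the cube is the average over the ensemble. -/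
theorem eq_average (E : MvPolynomial ι ℂ →ₗ[ℂ] ℂ) (h1 : E 1 = 1)
    (hloop : ∀ k g, E (A.c k * g + mkDerivation ℂ (A.Γ k) g) = 0)
    (hker : ∀ f, (∀ x ∈ cube N A.a A.b, eval (A.stat x) f = 0) → E f = 0)
    (f : MvPolynomial ι ℂ) :
    A.functional f = (∫ x in cube N A.a A.b, A.W x : ℝ) * E f := by
  set Z : ℝ := ∫ x in cube N A.a A.b, A.W x with hZ
  obtain ⟨d₀, hd₀⟩ := exists_mem_weightLE A.ω f
  -- The filtration step must also contain `1`, hence the maximum with zero.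
  set d := max d₀ 0
  have hd := weightLE_mono A.ω (le_max_left d₀ 0) hd₀
  have := A.finiteDimensional_map_evalCube d
  refine functional_eq_of_annihilate_range (weightLE A.ω d)
    (loopOperator A.c A.Γ (A.idx d)) A.evalCube 1 (one_mem_weightLE _ (le_max_right _ _))
    (fun f hf => loopOperator_mem_weightLE A.ω A.c_mem A.Γ_mem _ hf) (fun f hf h => ?_)
    A.functional ((Z : ℂ) • E) (fun f _ h => ?_) (fun f _ h => ?_)
    (fun f _ => A.functional_loopOperator _ f) (fun f _ => ?_) ?_ ?_ f hd
  · obtain ⟨z, hz⟩ := A.const_of_loopOperator_eq_zero hf fun x hx => by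
      rw [← A.evalCube_apply _ ⟨x, hx⟩, h]
      rfl
    refine ⟨z, funext fun x => ?_⟩
    rw [evalCube_apply, hz x x.2]
    simp [evalCube_apply]
  · rw [functional_apply]
    rw [setIntegral_congr_fun (g := fun _ => (0 : ℂ)) (measurableSet_cube N A.a A.b), integral_zero]
    intro x hx
    have := congrFun h ⟨x, hx⟩
    rw [evalCube_apply] at this
    simp only [this, Pi.zero_apply, zero_mul]
  · rw [LinearMap.smul_apply, hker f fun x hx => ?_, smul_zero]
    have := congrFun h ⟨x, hx⟩
    rwa [evalCube_apply] at this
  · rw [LinearMap.smul_apply, loopOperator_apply, map_sum, Finset.sum_eq_zero, smul_zero]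
    exact fun k _ => hloop k _
  · rw [functional_one, LinearMap.smul_apply, h1, smul_eq_mul, mul_one]
  · rw [LinearMap.smul_apply, h1, smul_eq_mul, mul_one]
    exact_mod_cast A.integral_W_pos.ne'

end LoopEnsemble

end BoseGas
end

noncomputable section
namespace BoseGas

/-! ### Derivatives along complex directions -/

section DirDeriv

variable {N : ℕ}

/-- The derivative of a real function along a complex direction. -/
def dirDeriv (v : Fin N → ℂ) (W : (Fin N → ℝ) → ℝ) (x : Fin N → ℝ) : ℂ :=
  ∑ l, v l * (fderiv ℝ W x (Pi.single l 1) : ℝ)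

theorem dirDeriv_of_hasFDerivAt {v : Fin N → ℂ} {W : (Fin N → ℝ) → ℝ} {x : Fin N → ℝ}
    {i j : Fin N} {α β : ℝ}
    (h : HasFDerivAt W (α • ContinuousLinearMap.proj (R := ℝ) (φ := fun _ : Fin N => ℝ) i +
      β • ContinuousLinearMap.proj (R := ℝ) (φ := fun _ : Fin N => ℝ) j) x) :
    dirDeriv v W x = α * v i + β * v j := by
  rw [dirDeriv, h.fderiv]
  simp only [_root_.add_apply, _root_.smul_apply, ContinuousLinearMap.proj_apply, smul_eq_mul,
    Complex.ofReal_add, Complex.ofReal_mul, mul_add, Finset.sum_add_distrib, Pi.single_apply]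
  congr 1
  · rw [Finset.sum_eq_single i (fun l _ hl => by simp [hl.symm]) (by simp)]
    simp [mul_comm]
  · rw [Finset.sum_eq_single j (fun l _ hl => by simp [hl.symm]) (by simp)]
    simp [mul_comm]

/-- Logarithmic derivatives in multiplied-out form: writing `a * W` in place of a quotient by `W`
keeps the product rule valid at the zeros of the weight. -/
theorem dirDeriv_mul {v : Fin N → ℂ} {W₁ W₂ : (Fin N → ℝ) → ℝ} {x : Fin N → ℝ}
    (h₁ : DifferentiableAt ℝ W₁ x) (h₂ : DifferentiableAt ℝ W₂ x) {a₁ a₂ : ℂ}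
    (e₁ : dirDeriv v W₁ x = a₁ * W₁ x) (e₂ : dirDeriv v W₂ x = a₂ * W₂ x) :
    dirDeriv v (fun y => W₁ y * W₂ y) x = (a₁ + a₂) * (W₁ x * W₂ x : ℝ) := by
  have : dirDeriv v (fun y => W₁ y * W₂ y) x = W₁ x * dirDeriv v W₂ x + W₂ x * dirDeriv v W₁ x := by
    simp only [dirDeriv, fderiv_fun_mul h₁ h₂, Finset.mul_sum, ← Finset.sum_add_distrib]
    refine Finset.sum_congr rfl fun l _ => ?_
    simp only [_root_.add_apply, _root_.smul_apply, smul_eq_mul, Complex.ofReal_add,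
      Complex.ofReal_mul]
    ring
  rw [this, e₁, e₂]
  push_cast
  ring

theorem differentiableAt_finset_prod {κ : Type*} {s : Finset κ} {W : κ → (Fin N → ℝ) → ℝ}
    {x : Fin N → ℝ} (h : ∀ i ∈ s, DifferentiableAt ℝ (W i) x) :
    DifferentiableAt ℝ (fun y => ∏ i ∈ s, W i y) x := by
  classical
  induction s using Finset.induction_on with
  | empty => simp
  | insert i s hi ih =>
    simp only [Finset.prod_insert hi]
    exact (h i (Finset.mem_insert_self i s)).fun_mul
      (ih fun j hj => h j (Finset.mem_insert_of_mem hj))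

theorem dirDeriv_prod {κ : Type*} (s : Finset κ) {v : Fin N → ℂ} {W : κ → (Fin N → ℝ) → ℝ}
    {x : Fin N → ℝ} (h : ∀ i ∈ s, DifferentiableAt ℝ (W i) x) {a : κ → ℂ}
    (e : ∀ i ∈ s, dirDeriv v (W i) x = a i * W i x) :
    dirDeriv v (fun y => ∏ i ∈ s, W i y) x = (∑ i ∈ s, a i) * (∏ i ∈ s, W i x : ℝ) := by
  classical
  induction s using Finset.induction_on with
  | empty => simp [dirDeriv]
  | insert i s hi ih =>
    simp only [Finset.prod_insert hi, Finset.sum_insert hi]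
    exact dirDeriv_mul (W₂ := fun y => ∏ j ∈ s, W j y) (h i (Finset.mem_insert_self i s))
      (differentiableAt_finset_prod fun j hj => h j (Finset.mem_insert_of_mem hj))
      (e i (Finset.mem_insert_self i s))
      (ih (fun j hj => h j (Finset.mem_insert_of_mem hj))
        fun j hj => e j (Finset.mem_insert_of_mem hj))

theorem hasDerivAt_update_of_differentiableAt {W : (Fin N → ℝ) → ℝ} {x : Fin N → ℝ}
    (h : DifferentiableAt ℝ W x) (l : Fin N) :
    HasDerivAt (fun t => W (Function.update x l t)) (fderiv ℝ W x (Pi.single l 1)) (x l) := by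
  have h1 : HasFDerivAt W (fderiv ℝ W x) (Function.update x l (x l)) := by
    rw [Function.update_eq_self]
    exact h.hasFDerivAt
  exact h1.comp_hasDerivAt (x l) (hasDerivAt_update x l (x l))

end DirDeriv

/-! ### The circular unitary ensemble of angles -/

section CUE

open MvPolynomial

/-- Symmetrised geometric sum. It removes the pole of `(x + y) (x ^ k - y ^ k) / (x - y)`, which is
the shape of the logarithmic derivative of a chord. -/
theorem mul_geom_sum_eq {k : ℕ} (x y : ℂ) :
    (∑ r ∈ Finset.range k, (x ^ (k - r) * y ^ r + y ^ (k - r) * x ^ r)) * (x - y) =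
      (x + y) * (x ^ k - y ^ k) := by
  have h1 := (Commute.all x y).geom_sum₂_mul k
  have h2 : ∑ r ∈ Finset.range k, (x ^ (k - r) * y ^ r + y ^ (k - r) * x ^ r) =
      (x + y) * ∑ r ∈ Finset.range k, x ^ r * y ^ (k - 1 - r) := by
    rw [Finset.sum_add_distrib, add_mul, Finset.mul_sum, Finset.mul_sum]
    congr 1
    · rw [← Finset.sum_range_reflect]
      refine Finset.sum_congr rfl fun r hr => ?_
      have := Finset.mem_range.1 hr
      rw [show k - (k - 1 - r) = r + 1 by omega, pow_succ]
      ring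
    · refine Finset.sum_congr rfl fun r hr => ?_
      have := Finset.mem_range.1 hr
      rw [show k - r = (k - 1 - r) + 1 by omega, pow_succ]
      ring
  rw [h2, mul_assoc, h1]

/-- The squared distance `|e^{is} - e^{it}|²`. -/
def chordSq (s t : ℝ) : ℝ := 2 - 2 * Real.cos (s - t)

/-- For unimodular `z` and `w`, `|z - w|² = -(z - w)² / (z w)`. Allowing `ε = -1` treats negative
wave numbers by the same computation. -/
theorem chordSq_eq (s t : ℝ) {ε : ℝ} (hε : ε = 1 ∨ ε = -1) : (chordSq s t : ℂ) =
    -(Complex.exp (ε * s * Complex.I) - Complex.exp (ε * t * Complex.I)) ^ 2 /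
      (Complex.exp (ε * s * Complex.I) * Complex.exp (ε * t * Complex.I)) := by
  have hc : Real.cos (s - t) = Real.cos (ε * s - ε * t) := by
    rcases hε with rfl | rfl
    · simp
    · rw [← Real.cos_neg]; ring_nf
  rw [chordSq, hc]
  push_cast
  rw [Complex.cos, show (ε * s - ε * t : ℂ) * Complex.I = ε * s * Complex.I - ε * t * Complex.I by
    ring, show -(ε * s - ε * t : ℂ) * Complex.I = ε * t * Complex.I - ε * s * Complex.I by ring,
    Complex.exp_sub, Complex.exp_sub]
  have := Complex.exp_ne_zero (ε * s * Complex.I)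
  have := Complex.exp_ne_zero (ε * t * Complex.I)
  field_simp
  ring

theorem two_mul_sin_sub_eq (s t : ℝ) {ε : ℝ} (hε : ε = 1 ∨ ε = -1) :
    ((2 * Real.sin (s - t) : ℝ) : ℂ) = -ε * Complex.I *
      (Complex.exp (ε * s * Complex.I) ^ 2 - Complex.exp (ε * t * Complex.I) ^ 2) /
      (Complex.exp (ε * s * Complex.I) * Complex.exp (ε * t * Complex.I)) := by
  have hc : Real.sin (s - t) = ε * Real.sin (ε * s - ε * t) := by
    rcases hε with rfl | rfl
    · simp
    · rw [show -1 * s - -1 * t = -(s - t) by ring, Real.sin_neg]; ring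
  rw [hc]
  push_cast
  rw [Complex.sin, show (ε * s - ε * t : ℂ) * Complex.I = ε * s * Complex.I - ε * t * Complex.I by
    ring, show -(ε * s - ε * t : ℂ) * Complex.I = ε * t * Complex.I - ε * s * Complex.I by ring,
    Complex.exp_sub, Complex.exp_sub]
  have := Complex.exp_ne_zero (ε * s * Complex.I)
  have := Complex.exp_ne_zero (ε * t * Complex.I)
  field_simp
  ring

theorem hasFDerivAt_chordSq {N : ℕ} (i j : Fin N) (x : Fin N → ℝ) :
    HasFDerivAt (fun y : Fin N → ℝ => chordSq (y i) (y j))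
      ((2 * Real.sin (x i - x j)) •
          ContinuousLinearMap.proj (R := ℝ) (φ := fun _ : Fin N => ℝ) i +
        (-(2 * Real.sin (x i - x j))) •
          ContinuousLinearMap.proj (R := ℝ) (φ := fun _ : Fin N => ℝ) j) x := by
  have h := (((hasFDerivAt_apply (𝕜 := ℝ) i x).sub (hasFDerivAt_apply j x)).cos.const_mul 2).const_sub 2
  refine h.congr_fderiv ?_
  ext v
  simp
  ring

/-- With `z`, `w` the two exponentials, the logarithmic derivative is `-k (z + w) (z ^ k - w ^ k) /
(z - w)`, which `mul_geom_sum_eq` makes a polynomial. -/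
theorem dirDeriv_chordSq {N : ℕ} (i j : Fin N) (x : Fin N → ℝ) {ε : ℝ} (hε : ε = 1 ∨ ε = -1)
    (k : ℕ) :
    dirDeriv (fun l => ε * k * Complex.I * Complex.exp (ε * x l * Complex.I) ^ k)
      (fun y => chordSq (y i) (y j)) x =
    (-k * ∑ r ∈ Finset.range k,
      (Complex.exp (ε * x j * Complex.I) ^ (k - r) * Complex.exp (ε * x i * Complex.I) ^ r +
        Complex.exp (ε * x i * Complex.I) ^ (k - r) * Complex.exp (ε * x j * Complex.I) ^ r)) *
      (chordSq (x i) (x j) : ℂ) := by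
  rw [dirDeriv_of_hasFDerivAt (hasFDerivAt_chordSq i j x), Complex.ofReal_neg,
    two_mul_sin_sub_eq _ _ hε, chordSq_eq _ _ hε]
  have h := mul_geom_sum_eq (k := k) (Complex.exp (ε * x j * Complex.I))
    (Complex.exp (ε * x i * Complex.I))
  have h1 := Complex.exp_ne_zero (ε * x i * Complex.I)
  have h2 := Complex.exp_ne_zero (ε * x j * Complex.I)
  have hε2 : (ε : ℂ) ^ 2 = 1 := by rcases hε with rfl | rfl <;> norm_num
  have hI := Complex.I_sq
  set z := Complex.exp (ε * x i * Complex.I)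
  set w := Complex.exp (ε * x j * Complex.I)
  set S := ∑ r ∈ Finset.range k, (w ^ (k - r) * z ^ r + z ^ (k - r) * w ^ r)
  field_simp
  linear_combination (k * (z - w) : ℂ) * h - (k * (z ^ 2 - w ^ 2) * (z ^ k - w ^ k)) * hI * ε ^ 2
    + (k * (z ^ 2 - w ^ 2) * (z ^ k - w ^ k)) * hε2

/-- The joint eigenvalue density of the circular unitary ensemble, `∏_{i<j} |e^{iθ_i} - e^{iθ_j}|²`,
up to normalisation. -/
def weightU (N : ℕ) (x : Fin N → ℝ) : ℝ := ∏ i, ∏ j ∈ Finset.Ioi i, chordSq (x i) (x j)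

theorem contDiff_weightU (N : ℕ) : ContDiff ℝ 1 (weightU N) := by
  unfold weightU chordSq
  fun_prop

/-- The sum over pairs is a full double sum, a polynomial in the power sums, minus its diagonal `k ∑
z_l ^ k`. In `ensembleU` the diagonal cancels against the derivatives `φ₂` of the vector field. -/
theorem dirDeriv_weightU {N : ℕ} (x : Fin N → ℝ) {ε : ℝ} (hε : ε = 1 ∨ ε = -1) (k : ℕ) :
    dirDeriv (fun l => ε * k * Complex.I * Complex.exp (ε * x l * Complex.I) ^ k) (weightU N) x =
    (-k * ((∑ r ∈ Finset.range k, (∑ l, Complex.exp (ε * x l * Complex.I) ^ r) *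
        ∑ l, Complex.exp (ε * x l * Complex.I) ^ (k - r)) -
      k * ∑ l, Complex.exp (ε * x l * Complex.I) ^ k)) * (weightU N x : ℂ) := by
  have hd : ∀ i j, DifferentiableAt ℝ (fun y : Fin N → ℝ => chordSq (y i) (y j)) x := fun i j =>
    (hasFDerivAt_chordSq i j x).differentiableAt
  unfold weightU
  rw [dirDeriv_prod _ (fun i _ => differentiableAt_finset_prod fun j _ => hd i j)
    (fun i _ => dirDeriv_prod _ (fun j _ => hd i j) fun j _ => dirDeriv_chordSq i j x hε k)]
  congr 1
  simp_rw [← Finset.mul_sum]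
  congr 1
  set z : Fin N → ℂ := fun l => Complex.exp (ε * x l * Complex.I)
  change ∑ i, ∑ j ∈ Finset.Ioi i, ∑ r ∈ Finset.range k,
    (z j ^ (k - r) * z i ^ r + z i ^ (k - r) * z j ^ r) =
    ∑ r ∈ Finset.range k, (∑ l, z l ^ r) * ∑ l, z l ^ (k - r) - k * ∑ l, z l ^ k
  simp_rw [Finset.sum_add_distrib (s := Finset.range k)]
  rw [Finset.sum_sum_Ioi_add_eq_sum_sum_off_diag
    (fun j i => ∑ r ∈ Finset.range k, z j ^ (k - r) * z i ^ r)]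
  have h1 : ∀ i, ∑ j ∈ {i}ᶜ, ∑ r ∈ Finset.range k, z j ^ (k - r) * z i ^ r =
      (∑ r ∈ Finset.range k, z i ^ r * ∑ j, z j ^ (k - r)) - k * z i ^ k := by
    intro i
    have h2 := Finset.sum_compl_add_sum {i} fun j => ∑ r ∈ Finset.range k, z j ^ (k - r) * z i ^ r
    rw [Finset.sum_singleton, Finset.sum_comm (s := Finset.univ)] at h2
    have h3 : ∑ r ∈ Finset.range k, z i ^ (k - r) * z i ^ r = k * z i ^ k := by
      rw [Finset.sum_congr rfl fun r hr => by
        rw [← pow_add, Nat.sub_add_cancel (Finset.mem_range.1 hr).le]]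
      simp
    rw [h3] at h2
    rw [eq_sub_iff_add_eq, h2]
    exact Finset.sum_congr rfl fun r _ => by rw [Finset.mul_sum]; simp_rw [mul_comm]
  simp_rw [h1, Finset.sum_sub_distrib, ← Finset.mul_sum]
  rw [Finset.sum_comm]
  simp_rw [← Finset.sum_mul]

theorem continuous_fderiv_single {N : ℕ} {W : (Fin N → ℝ) → ℝ} (h : ContDiff ℝ 1 W) (l : Fin N) :
    Continuous fun x => fderiv ℝ W x (Pi.single l 1) :=
  (h.continuous_fderiv one_ne_zero).clm_apply continuous_const

theorem chordSq_nonneg (s t : ℝ) : 0 ≤ chordSq s t := by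
  have := Real.cos_le_one (s - t)
  unfold chordSq
  linarith

theorem chordSq_pos {s t : ℝ} (hs : s ∈ Set.Ioo 0 (2 * Real.pi)) (ht : t ∈ Set.Ioo 0 (2 * Real.pi))
    (h : s ≠ t) : 0 < chordSq s t := by
  refine lt_of_le_of_ne (chordSq_nonneg s t) fun h0 => h ?_
  have h1 : Real.cos (s - t) = 1 := by unfold chordSq at h0; linarith
  rw [Real.cos_eq_one_iff_of_lt_of_lt (by linarith [hs.1, ht.2]) (by linarith [hs.2, ht.1])] at h1
  linarith

theorem exp_int_mul_ofReal_mul_I (k : ℤ) (t : ℝ) (m : ℕ) {ε : ℝ} (h : (k : ℝ) = ε * m) :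
    Complex.exp (k * t * Complex.I) = Complex.exp (ε * t * Complex.I) ^ m := by
  rw [← Complex.exp_nat_mul]
  congr 1
  have : (k : ℂ) = ε * m := by exact_mod_cast congrArg Complex.ofReal h
  rw [this]
  ring

/-- The angles of the circular unitary ensemble, with linear statistics `∑ l, e^{ikθ_l}`. -/
def ensembleU (N : ℕ) : LoopEnsemble ℤ N where
  a := 0
  b := 2 * Real.pi
  hab := Real.two_pi_pos
  φ k t := Complex.exp (k * t * Complex.I)
  φ₁ k t := k * Complex.I * Complex.exp (k * t * Complex.I)
  φ₂ k t := -k ^ 2 * Complex.exp (k * t * Complex.I)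
  hφ k t := by
    have h : HasDerivAt (fun t : ℝ => (k * t * Complex.I : ℂ)) (k * Complex.I) t := by
      simpa using ((hasDerivAt_id t).ofReal_comp.const_mul (k : ℂ)).mul_const Complex.I
    simpa [mul_comm] using h.cexp
  hφ₁ k t := by
    have h : HasDerivAt (fun t : ℝ => (k * t * Complex.I : ℂ)) (k * Complex.I) t := by
      simpa using ((hasDerivAt_id t).ofReal_comp.const_mul (k : ℂ)).mul_const Complex.I
    refine (h.cexp.const_mul (k * Complex.I)).congr_deriv ?_
    linear_combination (k : ℂ) ^ 2 * Complex.exp (k * t * Complex.I) * Complex.I_sq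
  hφ₂ k := by fun_prop
  W := weightU N
  W' l x := fderiv ℝ (weightU N) x (Pi.single l 1)
  hW := (contDiff_weightU N).continuous
  hW' := continuous_fderiv_single (contDiff_weightU N)
  hWd l x := hasDerivAt_update_of_differentiableAt
    ((contDiff_weightU N).differentiable one_ne_zero x) l
  W_nonneg x := Finset.prod_nonneg fun i _ => Finset.prod_nonneg fun j _ => chordSq_nonneg _ _
  W_pos x hx hi := Finset.prod_pos fun i _ => Finset.prod_pos fun j hj =>
    chordSq_pos (hx i trivial) (hx j trivial) (hi.ne (Finset.mem_Ioi.1 hj).ne)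
  ω := Int.natAbs
  -- The factor `k.sign` makes the index run from `0` towards `k`. Both indices lie between `0` and
  -- `k`, so their absolute values add up to `|k|`, as the weight bound requires.
  c k := -C (k.natAbs : ℂ) * ∑ r ∈ Finset.range k.natAbs, X (k.sign * r) * X (k - k.sign * r)
  Γ k j := -C (k * j : ℂ) * X (k + j)
  c_mem k := by
    rw [neg_mul, ← smul_eq_C_mul]
    refine Submodule.neg_mem _ (Submodule.smul_mem _ _ (Submodule.sum_mem _ fun r hr => ?_))
    have hr := Finset.mem_range.1 hr
    refine weightLE_mono _ ?_ (mul_mem_weightLE _ (X_mem_weightLE _ _) (X_mem_weightLE _ _))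
    obtain ⟨m, rfl | rfl⟩ := k.eq_nat_or_neg
    · rw [Int.natAbs_natCast] at hr
      rw [Int.sign_eq_one_of_pos (by omega)]
      omega
    · rw [Int.natAbs_neg, Int.natAbs_natCast] at hr
      rw [Int.sign_eq_neg_one_of_neg (by omega)]
      omega
  Γ_mem k j := by
    rw [neg_mul, ← smul_eq_C_mul]
    refine Submodule.neg_mem _ (Submodule.smul_mem _ _ ?_)
    exact weightLE_mono _ (by omega) (X_mem_weightLE _ _)
  div_eq k x := by
    -- Writing `k = ε m` reduces both signs to `dirDeriv_weightU`. The sign of `k` equals `ε` only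
    -- for `m ≠ 0`, and for `m = 0` the sum over `r` is empty.
    obtain ⟨m, ε, hε, hk, hs⟩ : ∃ (m : ℕ) (ε : ℝ), (ε = 1 ∨ ε = -1) ∧ (k : ℝ) = ε * m ∧
        k.natAbs = m ∧ (m ≠ 0 → (k.sign : ℝ) = ε) := by
      obtain ⟨m, rfl | rfl⟩ := k.eq_nat_or_neg
      · refine ⟨m, 1, Or.inl rfl, by simp, by simp, fun h => ?_⟩
        rw [Int.sign_eq_one_of_pos (by omega)]; simp
      · refine ⟨m, -1, Or.inr rfl, by simp, by simp, fun h => ?_⟩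
        rw [Int.sign_eq_neg_one_of_neg (by omega)]; simp
    have hkC : (k : ℂ) = ε * m := by exact_mod_cast congrArg Complex.ofReal hk
    have hε2 : (ε : ℂ) ^ 2 = 1 := by rcases hε with rfl | rfl <;> norm_num
    have h := dirDeriv_weightU x hε m
    rw [dirDeriv] at h
    simp_rw [exp_int_mul_ofReal_mul_I k _ m hk]
    rw [Finset.sum_add_distrib, ← Finset.sum_mul, ← Finset.mul_sum, hkC, h, hs.1]
    simp only [map_mul, map_neg, eval_C, map_sum, eval_X]
    have h2 : ∀ r ∈ Finset.range m,
        (∑ l, Complex.exp (((k.sign * r : ℤ) : ℂ) * x l * Complex.I)) *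
          ∑ l, Complex.exp (((k - k.sign * r : ℤ) : ℂ) * x l * Complex.I) =
        (∑ l, Complex.exp (ε * x l * Complex.I) ^ r) *
          ∑ l, Complex.exp (ε * x l * Complex.I) ^ (m - r) := by
      intro r hr
      have hr := Finset.mem_range.1 hr
      have hsg := hs.2 (by omega)
      congr 1
      · exact Finset.sum_congr rfl fun l _ => exp_int_mul_ofReal_mul_I _ _ _ (by simp [hsg])
      · refine Finset.sum_congr rfl fun l _ => exp_int_mul_ofReal_mul_I _ _ _ ?_
        rw [Nat.cast_sub hr.le]
        push_cast
        rw [hk, hsg]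
        ring
    rw [Finset.sum_congr rfl h2]
    linear_combination (-(m : ℂ) ^ 2 * (∑ l, Complex.exp (ε * x l * Complex.I) ^ m) *
      (weightU N x : ℂ)) * hε2
  grad_eq k j x := by
    simp only [map_mul, map_neg, eval_C, eval_X, Finset.mul_sum]
    refine Finset.sum_congr rfl fun l _ => ?_
    have : Complex.exp (((k + j : ℤ) : ℂ) * x l * Complex.I) =
        Complex.exp (k * x l * Complex.I) * Complex.exp (j * x l * Complex.I) := by
      rw [← Complex.exp_add]
      push_cast
      ring_nf
    rw [this]
    linear_combination (k * j * Complex.exp (k * x l * Complex.I) *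
      Complex.exp (j * x l * Complex.I) : ℂ) * Complex.I_sq
  boundary := by
    right
    have hper : ∀ k : ℤ, Complex.exp (k * ((0 : ℝ) : ℂ) * Complex.I) =
        Complex.exp (k * ((2 * Real.pi : ℝ) : ℂ) * Complex.I) := by
      intro k
      have := Complex.exp_int_mul_two_pi_mul_I k
      rw [Complex.ofReal_zero, mul_zero, zero_mul, Complex.exp_zero, ← this]
      push_cast
      ring_nf
    refine ⟨fun k => ⟨hper k, by rw [hper k]⟩, fun x l => ?_⟩
    unfold weightU
    refine Finset.prod_congr rfl fun i _ => Finset.prod_congr rfl fun j hj => ?_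
    have hij := (Finset.mem_Ioi.1 hj).ne
    unfold chordSq
    by_cases hi : i = l
    · subst hi
      simp [Function.update_of_ne hij.symm, Real.cos_two_pi_sub]
    · by_cases hj : j = l
      · subst hj
        simp [Function.update_of_ne hij]
      · simp [hi, hj]
  finite_weight d := by
    refine (Set.finite_Icc (-d) d).subset fun k hk => ?_
    have : ((k.natAbs : ℕ) : ℤ) ≤ d := hk
    simp only [Set.mem_Icc]
    omega
  const_of_weight_zero k hk s t := by
    rw [Int.natAbs_eq_zero.1 hk]
    simp

end CUE
end BoseGas
end

noncomputable section
namespace BoseGas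

/-! ### Ensembles of angles of symplectic and orthogonal matrices -/

section Jacobi

open MvPolynomial

theorem two_cos_mul_two_cos (s t : ℝ) :
    2 * Real.cos s * (2 * Real.cos t) = 2 * Real.cos (s + t) + 2 * Real.cos (s - t) := by
  rw [Real.cos_add, Real.cos_sub]; ring

theorem two_cos_natAbs (k : ℤ) (t : ℝ) :
    2 * Real.cos (k.natAbs * t) = 2 * Real.cos (k * t) := by
  obtain ⟨m, rfl | rfl⟩ := k.eq_nat_or_neg
  · simp
  · simp only [Int.natAbs_neg, Int.natAbs_natCast, Int.cast_neg, Int.cast_natCast, neg_mul,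
      Real.cos_neg]

/-- A telescoping of Christoffel–Darboux type: multiplication by `2 cos s` shifts `r` up and down,
multiplication by `2 cos t` shifts `k - r`, and the difference is that of two consecutive terms. -/
theorem two_cos_sub_mul_sum (k : ℕ) (s t : ℝ) :
    (2 * Real.cos s - 2 * Real.cos t) * ∑ r ∈ Finset.range k,
      2 * Real.cos (r * s) * (2 * Real.cos ((k - r : ℝ) * t)) =
    (2 * Real.cos (k * s) * (2 * Real.cos t) - 2 * Real.cos ((k - 1 : ℝ) * s) * 2) -
      (2 * (2 * Real.cos ((k + 1 : ℝ) * t)) - 2 * Real.cos s * (2 * Real.cos (k * t))) := by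
  have h := Finset.sum_range_sub (fun r : ℕ => 2 * Real.cos (r * s) *
    (2 * Real.cos ((k - r + 1 : ℝ) * t)) - 2 * Real.cos ((r - 1 : ℝ) * s) *
    (2 * Real.cos ((k - r : ℝ) * t))) k
  rw [Finset.mul_sum]
  have h2 : ∀ r ∈ Finset.range k, (2 * Real.cos s - 2 * Real.cos t) *
      (2 * Real.cos (r * s) * (2 * Real.cos ((k - r : ℝ) * t))) =
      (2 * Real.cos ((r + 1 : ℕ) * s) *
    (2 * Real.cos ((k - (r + 1 : ℕ) + 1 : ℝ) * t)) - 2 * Real.cos (((r + 1 : ℕ) - 1 : ℝ) * s) *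
    (2 * Real.cos ((k - (r + 1 : ℕ) : ℝ) * t))) - (2 * Real.cos (r * s) *
    (2 * Real.cos ((k - r + 1 : ℝ) * t)) - 2 * Real.cos ((r - 1 : ℝ) * s) *
    (2 * Real.cos ((k - r : ℝ) * t))) := by
    intro r _
    have e1 := two_cos_mul_two_cos (r * s) s
    have e2 := two_cos_mul_two_cos ((k - r : ℝ) * t) t
    push_cast
    rw [show (r * s + s : ℝ) = (r + 1 : ℝ) * s by ring, show (r * s - s : ℝ) = (r - 1 : ℝ) * s by ring]
      at e1
    rw [show ((k - r : ℝ) * t + t : ℝ) = (k - r + 1 : ℝ) * t by ring,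
      show ((k - r : ℝ) * t - t : ℝ) = (k - (r + 1) : ℝ) * t by ring] at e2
    rw [show (k - (r + 1) + 1 : ℝ) = k - r by ring, show (r + 1 - 1 : ℝ) = r by ring]
    linear_combination 2 * Real.cos ((k - r : ℝ) * t) * e1 - 2 * Real.cos (r * s) * e2
  rw [Finset.sum_congr rfl h2, h]
  simp

/-- Exchanging `s` and `t` and combining the two boundary expressions leaves only the products of
sines. These occur when the interaction is differentiated along `sin (kθ)`. -/
theorem two_cos_sub_mul_symm_sum (k : ℕ) (s t : ℝ) :
    (2 * Real.cos s - 2 * Real.cos t) * ∑ r ∈ Finset.range k,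
      (2 * Real.cos (r * t) * (2 * Real.cos ((k - r : ℝ) * s)) +
        2 * Real.cos (r * s) * (2 * Real.cos ((k - r : ℝ) * t))) =
    8 * (Real.sin (k * t) * Real.sin t - Real.sin (k * s) * Real.sin s) := by
  have h1 := two_cos_sub_mul_sum k s t
  have h2 := two_cos_sub_mul_sum k t s
  rw [Finset.sum_add_distrib]
  have e : ∀ u : ℝ, Real.cos ((k + 1 : ℝ) * u) = Real.cos (k * u) * Real.cos u -
      Real.sin (k * u) * Real.sin u := fun u => by
    rw [add_mul, one_mul, Real.cos_add]
  have e' : ∀ u : ℝ, Real.cos ((k - 1 : ℝ) * u) = Real.cos (k * u) * Real.cos u +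
      Real.sin (k * u) * Real.sin u := fun u => by
    rw [sub_mul, one_mul, Real.cos_sub]
  rw [e, e'] at h1 h2
  linear_combination h1 - h2

/-- Dirichlet kernel telescoping: `2 sin t cos ((2r - k)t)` is a difference of sines at consecutive
`r`. -/
theorem two_sin_mul_sum (k : ℕ) (t : ℝ) :
    Real.sin t * ∑ r ∈ Finset.range k, 2 * Real.cos ((2 * r - k : ℝ) * t) =
      2 * Real.sin (k * t) * Real.cos t := by
  have h := Finset.sum_range_sub (fun r : ℕ => Real.sin ((2 * r - k - 1 : ℝ) * t)) k
  rw [Finset.mul_sum]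
  have h2 : ∀ r ∈ Finset.range k, Real.sin t * (2 * Real.cos ((2 * r - k : ℝ) * t)) =
      Real.sin ((2 * (r + 1 : ℕ) - k - 1 : ℝ) * t) - Real.sin ((2 * r - k - 1 : ℝ) * t) := by
    intro r _
    rw [show (2 * (r + 1 : ℕ) - k - 1 : ℝ) * t = (2 * r - k : ℝ) * t + t by push_cast; ring,
      show (2 * r - k - 1 : ℝ) * t = (2 * r - k : ℝ) * t - t by ring, Real.sin_add, Real.sin_sub]
    ring
  rw [Finset.sum_congr rfl h2, h, show (2 * k - k - 1 : ℝ) * t = k * t - t by ring,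
    show (2 * (0 : ℕ) - k - 1 : ℝ) * t = -(k * t + t) by push_cast; ring, Real.sin_neg, Real.sin_add,
    Real.sin_sub]
  ring

variable {N : ℕ}

theorem hasFDerivAt_cosDiffSq (i j : Fin N) (x : Fin N → ℝ) :
    HasFDerivAt (fun y : Fin N → ℝ => (2 * Real.cos (y i) - 2 * Real.cos (y j)) ^ 2)
      ((-(4 * (2 * Real.cos (x i) - 2 * Real.cos (x j)) * Real.sin (x i))) •
          ContinuousLinearMap.proj (R := ℝ) (φ := fun _ : Fin N => ℝ) i +
        (4 * (2 * Real.cos (x i) - 2 * Real.cos (x j)) * Real.sin (x j)) •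
          ContinuousLinearMap.proj (R := ℝ) (φ := fun _ : Fin N => ℝ) j) x := by
  have h := (((hasFDerivAt_apply (𝕜 := ℝ) i x).cos.const_mul 2).sub
    ((hasFDerivAt_apply (𝕜 := ℝ) j x).cos.const_mul 2)).pow 2
  refine h.congr_fderiv ?_
  ext v
  simp
  ring

theorem hasFDerivAt_sinSq (i : Fin N) (x : Fin N → ℝ) :
    HasFDerivAt (fun y : Fin N → ℝ => (2 * Real.sin (y i)) ^ 2)
      ((8 * Real.sin (x i) * Real.cos (x i)) •
          ContinuousLinearMap.proj (R := ℝ) (φ := fun _ : Fin N => ℝ) i +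
        (0 : ℝ) • ContinuousLinearMap.proj (R := ℝ) (φ := fun _ : Fin N => ℝ) i) x := by
  have h := ((hasFDerivAt_apply (𝕜 := ℝ) i x).sin.const_mul 2).pow 2
  refine h.congr_fderiv ?_
  ext v
  simp
  ring

theorem dirDeriv_cosDiffSq (i j : Fin N) (x : Fin N → ℝ) (k : ℕ) :
    dirDeriv (fun l => ((-(2 * k * Real.sin (k * x l)) : ℝ) : ℂ))
      (fun y => (2 * Real.cos (y i) - 2 * Real.cos (y j)) ^ 2) x =
    ((-k * ∑ r ∈ Finset.range k,
      (2 * Real.cos (r * x j) * (2 * Real.cos ((k - r : ℝ) * x i)) +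
        2 * Real.cos (r * x i) * (2 * Real.cos ((k - r : ℝ) * x j))) : ℝ) : ℂ) *
      (((2 * Real.cos (x i) - 2 * Real.cos (x j)) ^ 2 : ℝ) : ℂ) := by
  rw [dirDeriv_of_hasFDerivAt (hasFDerivAt_cosDiffSq i j x)]
  have h := two_cos_sub_mul_symm_sum k (x i) (x j)
  simp only [← Complex.ofReal_mul, ← Complex.ofReal_add]
  congr 1
  linear_combination (k * (2 * Real.cos (x i) - 2 * Real.cos (x j))) * h

theorem dirDeriv_sinSq (i : Fin N) (x : Fin N → ℝ) (k : ℕ) :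
    dirDeriv (fun l => ((-(2 * k * Real.sin (k * x l)) : ℝ) : ℂ))
      (fun y => (2 * Real.sin (y i)) ^ 2) x =
    ((-(2 * k) * ∑ r ∈ Finset.range k, 2 * Real.cos ((2 * r - k : ℝ) * x i) : ℝ) : ℂ) *
      (((2 * Real.sin (x i)) ^ 2 : ℝ) : ℂ) := by
  rw [dirDeriv_of_hasFDerivAt (hasFDerivAt_sinSq i x)]
  have h := two_sin_mul_sum k (x i)
  simp only [← Complex.ofReal_mul, ← Complex.ofReal_add]
  congr 1
  linear_combination (8 * k * Real.sin (x i)) * h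

/-- The joint density `∏_{i<j} (2 cos θ_i - 2 cos θ_j)² ∏_i (2 sin θ_i)^{2s}` of the eigenvalue
angles of orthogonal (`s = 0`) and symplectic (`s = 1`) matrices, up to normalisation. -/
def weightJ (N s : ℕ) (x : Fin N → ℝ) : ℝ :=
  (∏ i, ∏ j ∈ Finset.Ioi i, (2 * Real.cos (x i) - 2 * Real.cos (x j)) ^ 2) *
    ∏ i, ∏ _ : Fin s, (2 * Real.sin (x i)) ^ 2

theorem contDiff_weightJ (N s : ℕ) : ContDiff ℝ 1 (weightJ N s) := by
  unfold weightJ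
  fun_prop

/-- The diagonal product of cosines splits into `cos (k x)` and `cos ((2r - k) x)`. The first is
compensated by the divergence of the field, the second is a genuine extra term of the loop
equations. -/
theorem sum_off_diag_two_cos (x : Fin N → ℝ) (k : ℕ) :
    ∑ i, ∑ j ∈ Finset.Ioi i, ∑ r ∈ Finset.range k,
      (2 * Real.cos (r * x j) * (2 * Real.cos ((k - r : ℝ) * x i)) +
        2 * Real.cos (r * x i) * (2 * Real.cos ((k - r : ℝ) * x j))) =
    ∑ r ∈ Finset.range k, ((∑ l, 2 * Real.cos (r * x l)) *
      (∑ l, 2 * Real.cos ((k - r : ℝ) * x l)) - ∑ l, 2 * Real.cos ((2 * r - k : ℝ) * x l)) -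
      k * ∑ l, 2 * Real.cos (k * x l) := by
  simp_rw [Finset.sum_add_distrib (s := Finset.range k)]
  rw [Finset.sum_sum_Ioi_add_eq_sum_sum_off_diag
    (fun j i => ∑ r ∈ Finset.range k, 2 * Real.cos (r * x j) * (2 * Real.cos ((k - r : ℝ) * x i)))]
  have h1 : ∀ i, ∑ j ∈ {i}ᶜ, ∑ r ∈ Finset.range k,
      2 * Real.cos (r * x j) * (2 * Real.cos ((k - r : ℝ) * x i)) =
      (∑ r ∈ Finset.range k, ((∑ j, 2 * Real.cos (r * x j)) * (2 * Real.cos ((k - r : ℝ) * x i)) -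
        2 * Real.cos ((2 * r - k : ℝ) * x i))) - k * (2 * Real.cos (k * x i)) := by
    intro i
    have h2 := Finset.sum_compl_add_sum {i} fun j => ∑ r ∈ Finset.range k,
      2 * Real.cos (r * x j) * (2 * Real.cos ((k - r : ℝ) * x i))
    rw [Finset.sum_singleton, Finset.sum_comm (s := Finset.univ)] at h2
    have h3 : ∑ r ∈ Finset.range k, 2 * Real.cos (r * x i) * (2 * Real.cos ((k - r : ℝ) * x i)) =
        k * (2 * Real.cos (k * x i)) +
          ∑ r ∈ Finset.range k, 2 * Real.cos ((2 * r - k : ℝ) * x i) := by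
      rw [Finset.sum_congr rfl fun r _ => two_cos_mul_two_cos _ _, Finset.sum_add_distrib]
      congr 1
      · rw [Finset.sum_congr rfl fun r _ => by
          rw [show (r * x i + (k - r : ℝ) * x i) = k * x i by ring]]
        simp
      · exact Finset.sum_congr rfl fun r _ => by
          rw [show (r * x i - (k - r : ℝ) * x i) = (2 * r - k : ℝ) * x i by ring]
    rw [h3] at h2
    simp_rw [Finset.sum_sub_distrib, Finset.sum_mul]
    linarith
  simp_rw [h1, Finset.sum_sub_distrib, ← Finset.mul_sum]
  congr 1
  rw [Finset.sum_comm]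
  conv_lhs => enter [2]; rw [Finset.sum_comm]
  simp_rw [← Finset.mul_sum]

/-- The diagonal of the interaction contributes the statistic of index `2r - k` with coefficient
`-1` and each factor `(2 sin)²` adds `2`, whence `-(1 - 2s)`. -/
theorem dirDeriv_weightJ (s : ℕ) (x : Fin N → ℝ) (k : ℕ) :
    dirDeriv (fun l => ((-(2 * k * Real.sin (k * x l)) : ℝ) : ℂ)) (weightJ N s) x =
    ((-k * (∑ r ∈ Finset.range k, ((∑ l, 2 * Real.cos (r * x l)) *
      (∑ l, 2 * Real.cos ((k - r : ℝ) * x l)) -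
        (1 - 2 * s) * ∑ l, 2 * Real.cos ((2 * r - k : ℝ) * x l)) -
      k * ∑ l, 2 * Real.cos (k * x l)) : ℝ) : ℂ) * (weightJ N s x : ℂ) := by
  have hd : ∀ i j, DifferentiableAt ℝ
      (fun y : Fin N → ℝ => (2 * Real.cos (y i) - 2 * Real.cos (y j)) ^ 2) x :=
    fun i j => (hasFDerivAt_cosDiffSq i j x).differentiableAt
  have hd' : ∀ i, DifferentiableAt ℝ (fun y : Fin N → ℝ => (2 * Real.sin (y i)) ^ 2) x :=
    fun i => (hasFDerivAt_sinSq i x).differentiableAt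
  have e1 := dirDeriv_prod Finset.univ
    (fun i _ => differentiableAt_finset_prod (s := Finset.Ioi i) fun j _ => hd i j)
    (fun i _ => dirDeriv_prod _ (fun j _ => hd i j) fun j _ => dirDeriv_cosDiffSq i j x k)
  have e2 := dirDeriv_prod Finset.univ
    (fun i _ => differentiableAt_finset_prod (s := (Finset.univ : Finset (Fin s))) fun _ _ => hd' i)
    (fun i _ => dirDeriv_prod _ (fun _ _ => hd' i) fun _ _ => dirDeriv_sinSq i x k)
  have := dirDeriv_mul
    (differentiableAt_finset_prod fun i _ => differentiableAt_finset_prod fun j _ => hd i j)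
    (differentiableAt_finset_prod fun i _ => differentiableAt_finset_prod fun _ _ => hd' i) e1 e2
  refine this.trans ?_
  change _ * (weightJ N s x : ℂ) = _
  congr 1
  simp only [← Complex.ofReal_sum, ← Complex.ofReal_add]
  congr 1
  simp_rw [← Finset.mul_sum, Finset.sum_const, Finset.card_univ, Fintype.card_fin, nsmul_eq_mul]
  have h := sum_off_diag_two_cos x k
  have h2 : ∑ i, ∑ r ∈ Finset.range k, 2 * Real.cos ((2 * r - k : ℝ) * x i) =
    ∑ r ∈ Finset.range k, ∑ i, 2 * Real.cos ((2 * r - k : ℝ) * x i) := Finset.sum_comm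
  simp only [Finset.sum_sub_distrib, ← Finset.mul_sum] at h h2 ⊢
  rw [h]
  linear_combination (-(2 * k) * s : ℝ) * h2

/-- The angles `θ_l ∈ [0, π]` with density `weightJ N s` and linear statistics
`∑ l, 2 cos (kθ_l)`. -/
def ensembleJ (N s : ℕ) : LoopEnsemble ℕ N where
  a := 0
  b := Real.pi
  hab := Real.pi_pos
  φ k t := ((2 * Real.cos (k * t) : ℝ) : ℂ)
  φ₁ k t := ((-(2 * k * Real.sin (k * t)) : ℝ) : ℂ)
  φ₂ k t := ((-(2 * k ^ 2 * Real.cos (k * t)) : ℝ) : ℂ)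
  hφ k t := by
    have h : HasDerivAt (fun t : ℝ => k * t) (k : ℝ) t := by
      simpa using (hasDerivAt_id t).const_mul (k : ℝ)
    refine ((h.cos.const_mul 2).congr_deriv ?_).ofReal_comp
    ring
  hφ₁ k t := by
    have h : HasDerivAt (fun t : ℝ => k * t) (k : ℝ) t := by
      simpa using (hasDerivAt_id t).const_mul (k : ℝ)
    refine ((h.sin.const_mul (2 * k : ℝ)).neg.congr_deriv ?_).ofReal_comp
    ring
  hφ₂ k := by fun_prop
  W := weightJ N s
  W' l x := fderiv ℝ (weightJ N s) x (Pi.single l 1)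
  hW := (contDiff_weightJ N s).continuous
  hW' := continuous_fderiv_single (contDiff_weightJ N s)
  hWd l x := hasDerivAt_update_of_differentiableAt
    ((contDiff_weightJ N s).differentiable one_ne_zero x) l
  W_nonneg x := mul_nonneg
    (Finset.prod_nonneg fun i _ => Finset.prod_nonneg fun j _ => sq_nonneg _)
    (Finset.prod_nonneg fun i _ => Finset.prod_nonneg fun j _ => sq_nonneg _)
  W_pos x hx hi := by
    refine mul_pos (Finset.prod_pos fun i _ => Finset.prod_pos fun j hj => ?_)
      (Finset.prod_pos fun i _ => Finset.prod_pos fun _ _ => ?_)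
    · refine sq_pos_of_ne_zero fun h => (hi.ne (Finset.mem_Ioi.1 hj).ne) ?_
      exact Real.injOn_cos (Set.Ioo_subset_Icc_self (hx i trivial))
        (Set.Ioo_subset_Icc_self (hx j trivial)) (by linarith)
    · have := Real.sin_pos_of_mem_Ioo (hx i trivial)
      positivity
  ω := id
  -- `natAbs` is used because cosines are even. The factor `1 - 2s` is matched with the sign `η` of
  -- the bilinear form: `1` for the orthogonal group (`s = 0`), `-1` for the symplectic one (`s =
  -- 1`).
  c k := -C (k : ℂ) * ∑ r ∈ Finset.range k,
    (X r * X (k - r) - C (1 - 2 * s : ℂ) * X (2 * r - k : ℤ).natAbs)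
  Γ k j := C (k * j : ℂ) * (X (k - j : ℤ).natAbs - X (k + j))
  c_mem k := by
    rw [neg_mul, ← smul_eq_C_mul]
    refine Submodule.neg_mem _ (Submodule.smul_mem _ _ (Submodule.sum_mem _ fun r hr =>
      Submodule.sub_mem _ ?_ ?_))
    · have hr := Finset.mem_range.1 hr
      refine weightLE_mono _ ?_ (mul_mem_weightLE _ (X_mem_weightLE _ _) (X_mem_weightLE _ _))
      simp only [id]
      omega
    · have hr := Finset.mem_range.1 hr
      rw [← smul_eq_C_mul]
      refine Submodule.smul_mem _ _ (weightLE_mono _ ?_ (X_mem_weightLE _ _))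
      simp only [id]
      omega
  Γ_mem k j := by
    rw [← smul_eq_C_mul]
    refine Submodule.smul_mem _ _ (Submodule.sub_mem _ ?_ ?_)
    · refine weightLE_mono _ ?_ (X_mem_weightLE _ _)
      simp only [id]
      omega
    · refine weightLE_mono _ ?_ (X_mem_weightLE _ _)
      simp only [id]
      omega
  div_eq k x := by
    have h := dirDeriv_weightJ s x k
    rw [dirDeriv] at h
    rw [Finset.sum_add_distrib, h, ← Finset.sum_mul, ← add_mul]
    congr 1
    simp only [map_mul, map_neg, eval_C, map_sum, eval_X, map_sub, ← Complex.ofReal_sum]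
    simp only [Nat.cast_natAbs, Int.cast_abs]
    have h2 : ∀ r ∈ Finset.range k, ∀ l, Real.cos (((k - r : ℕ) : ℝ) * x l) =
        Real.cos ((k - r : ℝ) * x l) := fun r hr l => by
      rw [Nat.cast_sub (Finset.mem_range.1 hr).le]
    have h3 : ∀ (r : ℕ) l, 2 * Real.cos (|((2 * r - k : ℤ) : ℝ)| * x l) =
        2 * Real.cos ((2 * r - k : ℝ) * x l) := fun r l => by
      have := two_cos_natAbs (2 * r - k) (x l)
      rw [Nat.cast_natAbs, Int.cast_abs] at this
      rw [this]
      push_cast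
      rfl
    simp_rw [h3]
    rw [show (1 - 2 * s : ℂ) = ((1 - 2 * s : ℝ) : ℂ) by push_cast; rfl,
      show (k : ℂ) = ((k : ℝ) : ℂ) by push_cast; rfl]
    simp only [← Complex.ofReal_mul, ← Complex.ofReal_sub, ← Complex.ofReal_sum,
      ← Complex.ofReal_neg, ← Complex.ofReal_add]
    congr 1
    have h4 : ∑ i, -(2 * k ^ 2 * Real.cos (k * x i)) = -k ^ 2 * ∑ i, 2 * Real.cos (k * x i) := by
      rw [Finset.mul_sum]
      exact Finset.sum_congr rfl fun i _ => by ring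
    have h5 : ∑ r ∈ Finset.range k, ((∑ l, 2 * Real.cos (r * x l)) *
        (∑ l, 2 * Real.cos (((k - r : ℕ) : ℝ) * x l)) -
          (1 - 2 * s) * ∑ l, 2 * Real.cos ((2 * r - k : ℝ) * x l)) =
        ∑ r ∈ Finset.range k, ((∑ l, 2 * Real.cos (r * x l)) *
        (∑ l, 2 * Real.cos ((k - r : ℝ) * x l)) -
          (1 - 2 * s) * ∑ l, 2 * Real.cos ((2 * r - k : ℝ) * x l)) :=
      Finset.sum_congr rfl fun r hr => by simp_rw [h2 r hr]
    rw [h4, h5]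
    ring
  grad_eq k j x := by
    simp only [map_mul, map_sub, eval_C, eval_X, ← Finset.sum_sub_distrib, Finset.mul_sum]
    refine Finset.sum_congr rfl fun l _ => ?_
    rw [two_cos_natAbs, show (k * j : ℂ) = ((k * j : ℝ) : ℂ) by push_cast; rfl]
    simp only [← Complex.ofReal_mul, ← Complex.ofReal_sub]
    congr 1
    push_cast
    rw [sub_mul, add_mul, Real.cos_add, Real.cos_sub]
    ring
  boundary := by
    -- The fields `sin (kθ)` vanish at `0` and `π`. So there is no boundary term even for `s = 0`,
    -- where the density itself need not vanish there.
    left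
    intro k
    simp [Real.sin_nat_mul_pi]
  finite_weight d := by
    refine (Set.finite_Iic d.toNat).subset fun k hk => ?_
    have : (k : ℤ) ≤ d := hk
    simp only [Set.mem_Iic]
    omega
  const_of_weight_zero k hk s t := by
    have : k = 0 := hk
    simp [this]

end Jacobi
end BoseGas
end

noncomputable section
namespace BoseGas

set_option linter.unusedSectionVars false

/-! ### Loop equations for the Haar measure -/

section HaarLoop

variable {G : Type*} [Group G] [TopologicalSpace G] [IsTopologicalGroup G] [CompactSpace G]
  [MeasurableSpace G] [BorelSpace G] {μ : Measure G} [IsFiniteMeasure μ] [μ.IsMulLeftInvariant]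

theorem integrable_of_continuous {G : Type*} [TopologicalSpace G] [CompactSpace G]
    [MeasurableSpace G] [BorelSpace G] {μ : Measure G} [IsFiniteMeasure μ] {E : Type*} [NormedAddCommGroup E] [SecondCountableTopology E]
    {F : G → E} (hF : Continuous F) : Integrable F μ := by
  borelize E
  obtain ⟨C, hC⟩ := (isCompact_range hF).isBounded.exists_norm_le
  exact Integrable.of_bound hF.aestronglyMeasurable C
    (Filter.Eventually.of_forall fun g => hC _ ⟨g, rfl⟩)

/-- The Haar integral of the derivative of a function along a one-parameter group vanishes. -/
theorem integral_deriv_eq_zero {F F' : G → ℂ} (hF : Continuous F) (hF' : Continuous F') {γ : ℝ → G}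
    (hγ : ∀ s t, γ (s + t) = γ s * γ t)
    (hd : ∀ g, HasDerivAt (fun t => F (γ t * g)) (F' g) 0) : ∫ g, F' g ∂μ = 0 := by
  have hγ0 : γ 0 = 1 := by
    have := hγ 0 0
    rw [add_zero] at this
    exact left_eq_mul.1 this
  -- The group law moves the derivative at `0`, taken at the point `γ t * g`, to the derivative at
  -- time `t`.
  have hd' : ∀ g t, HasDerivAt (fun t => F (γ t * g)) (F' (γ t * g)) t := by
    intro g t
    have h1 := hd (γ t * g)
    rw [← sub_self t] at h1
    have h2 := HasDerivAt.comp_sub_const t t h1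
    refine h2.congr_of_eventuallyEq (Filter.Eventually.of_forall fun s => ?_)
    simp only
    rw [← mul_assoc, ← hγ, sub_add_cancel]
  obtain ⟨C, hC⟩ := (isCompact_range hF').isBounded.exists_norm_le
  have h := (hasDerivAt_integral_of_dominated_loc_of_deriv_le (μ := μ) (x₀ := (0 : ℝ))
    (F := fun t g => F (γ t * g)) (F' := fun t g => F' (γ t * g)) (bound := fun _ => C)
    Filter.univ_mem
    (Filter.Eventually.of_forall fun t =>
      (integrable_of_continuous (hF.comp (continuous_const_mul (γ t)))).aestronglyMeasurable)
    (integrable_of_continuous (hF.comp (continuous_const_mul (γ 0))))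
    (integrable_of_continuous (hF'.comp (continuous_const_mul (γ 0)))).aestronglyMeasurable
    (Filter.Eventually.of_forall fun g t _ => hC _ ⟨_, rfl⟩) (integrable_const C)
    (Filter.Eventually.of_forall fun g t _ => hd' g t)).2
  -- By invariance the integral of `F (γ t * g)` does not depend on `t`, so its derivative, the
  -- integral of `F'`, is zero.
  simp_rw [integral_mul_left_eq_self F, hγ0, one_mul] at h
  exact h.unique (hasDerivAt_const 0 _)

theorem continuous_eval_of_continuous {ι T : Type*} [TopologicalSpace T] {p : T → ι → ℂ}
    (hp : ∀ j, Continuous fun g => p g j) (f : MvPolynomial ι ℂ) :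
    Continuous fun g => MvPolynomial.eval (p g) f := by
  induction f using MvPolynomial.induction_on with
  | C z => simpa using continuous_const
  | add f g hf hg => simpa only [map_add] using hf.fun_add hg
  | mul_X f k hf => simpa only [map_mul, MvPolynomial.eval_X] using hf.fun_mul (hp k)

open MvPolynomial in
/-- Loop equations for the Haar measure, from one-parameter groups `γ a` along which the
statistics `p j` have derivatives `p' a j` and the coefficients `f a` derivatives `f' a`. -/
theorem haar_loop {ι α : Type*} [Fintype α] {p : G → ι → ℂ} (hp : ∀ j, Continuous fun g => p g j)
    {γ : α → ℝ → G} (hγ : ∀ a s t, γ a (s + t) = γ a s * γ a t) {p' : α → ι → G → ℂ}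
    (hp' : ∀ a j, Continuous (p' a j))
    (hpd : ∀ a j g, HasDerivAt (fun t => p (γ a t * g) j) (p' a j g) 0)
    {f f' : α → G → ℂ} (hf : ∀ a, Continuous (f a)) (hf' : ∀ a, Continuous (f' a))
    (hfd : ∀ a g, HasDerivAt (fun t => f a (γ a t * g)) (f' a g) 0)
    {c : MvPolynomial ι ℂ} {Γ : ι → MvPolynomial ι ℂ}
    (hc : ∀ g, ∑ a, f' a g = eval (p g) c)
    (hΓ : ∀ j g, ∑ a, f a g * p' a j g = eval (p g) (Γ j)) (F : MvPolynomial ι ℂ) :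
    ∫ g, eval (p g) (c * F + mkDerivation ℂ Γ F) ∂μ = 0 := by
  have hγ0 : ∀ a, γ a 0 = 1 := by
    intro a
    have := hγ a 0 0
    rw [add_zero] at this
    exact left_eq_mul.1 this
  -- `D a` is the derivative of `F (p g)` along `γ a`. Invariance is applied to the products `f a *
  -- F (p g)`, summed over `a`.
  let D : α → G → ℂ := fun a g => ∑ j ∈ F.vars, eval (p g) (pderiv j F) * p' a j g
  have hD : ∀ a, Continuous (D a) := fun a => continuous_finsetSum _ fun j _ =>
    (continuous_eval_of_continuous hp _).mul (hp' a j)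
  have hc1 : ∀ a, Continuous fun g => f' a g * eval (p g) F + f a g * D a g := fun a =>
    ((hf' a).mul (continuous_eval_of_continuous hp F)).add ((hf a).mul (hD a))
  have h1 : ∀ a, ∫ g, (f' a g * eval (p g) F + f a g * D a g) ∂μ = 0 := by
    intro a
    refine integral_deriv_eq_zero (F := fun g => f a g * eval (p g) F)
      ((hf a).mul (continuous_eval_of_continuous hp F)) (hc1 a) (hγ a) fun g => ?_
    have h2 := hasDerivAt_eval_of_vars_subset (p := fun t => p (γ a t * g)) (t := 0)
      (fun j => hpd a j g) F.vars (F := F) le_rfl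
    have := (hfd a g).fun_mul h2
    simpa [hγ0, D] using this
  have h3 : ∀ g, eval (p g) (c * F + mkDerivation ℂ Γ F) =
      ∑ a, (f' a g * eval (p g) F + f a g * D a g) := by
    intro g
    rw [map_add, map_mul, ← hc, mkDerivation_eq_sum_of_vars_subset Γ F.vars le_rfl, map_sum,
      Finset.sum_add_distrib, Finset.sum_mul]
    congr 1
    simp only [D, Finset.mul_sum, map_mul, ← hΓ]
    rw [Finset.sum_comm]
    exact Finset.sum_congr rfl fun a _ => Finset.sum_congr rfl fun j _ => by ring
  simp_rw [h3]
  rw [integral_finsetSum _ fun a _ => integrable_of_continuous (hc1 a)]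
  exact Finset.sum_eq_zero fun a _ => h1 a

end HaarLoop

/-! ### Matrix calculus -/

section MatrixCalculus

variable {n : Type*} [Fintype n] [DecidableEq n]

/-- Entrywise differentiability of a curve of matrices. -/
def HasMatrixDerivAt (M : ℝ → Matrix n n ℂ) (M' : Matrix n n ℂ) (t : ℝ) : Prop :=
  ∀ i j, HasDerivAt (fun s => M s i j) (M' i j) t

theorem HasMatrixDerivAt.mul {M P : ℝ → Matrix n n ℂ} {M' P' : Matrix n n ℂ} {t : ℝ}
    (hM : HasMatrixDerivAt M M' t) (hP : HasMatrixDerivAt P P' t) :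
    HasMatrixDerivAt (fun s => M s * P s) (M' * P t + M t * P') t := by
  intro i j
  simp only [Matrix.mul_apply, Matrix.add_apply, ← Finset.sum_add_distrib]
  exact HasDerivAt.fun_sum fun k _ => (hM i k).fun_mul (hP k j)

theorem hasMatrixDerivAt_const (P : Matrix n n ℂ) (t : ℝ) :
    HasMatrixDerivAt (fun _ => P) 0 t := fun _ _ => hasDerivAt_const t _

theorem HasMatrixDerivAt.pow {M : ℝ → Matrix n n ℂ} {M' : Matrix n n ℂ} {t : ℝ}
    (hM : HasMatrixDerivAt M M' t) (k : ℕ) : HasMatrixDerivAt (fun s => M s ^ k)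
      (∑ r ∈ Finset.range k, M t ^ r * M' * M t ^ (k - 1 - r)) t := by
  induction k with
  | zero => simpa using hasMatrixDerivAt_const (1 : Matrix n n ℂ) t
  | succ k ih =>
    have h := ih.mul hM
    simp only [pow_succ]
    convert h using 1
    rw [Finset.sum_range_succ, Finset.sum_mul]
    congr 1
    · refine Finset.sum_congr rfl fun r hr => ?_
      have := Finset.mem_range.1 hr
      rw [mul_assoc (M t ^ r * M'), ← pow_succ, show k - 1 - r + 1 = k + 1 - 1 - r by omega]
    · simp

theorem HasMatrixDerivAt.trace {M : ℝ → Matrix n n ℂ} {M' : Matrix n n ℂ} {t : ℝ}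
    (hM : HasMatrixDerivAt M M' t) : HasDerivAt (fun s => (M s).trace) M'.trace t := by
  simp only [Matrix.trace, Matrix.diag]
  exact HasDerivAt.fun_sum fun i _ => hM i i

/-- Along a curve with velocity `X * U`, `tr (A M^k)` has derivative
`∑_{r<k} tr (A U^r X U^{k-r})`. -/
theorem hasDerivAt_trace_mul_pow {M : ℝ → Matrix n n ℂ} {X U A : Matrix n n ℂ} {t : ℝ}
    (hM : HasMatrixDerivAt M (X * U) t) (hU : M t = U) (k : ℕ) :
    HasDerivAt (fun s => (A * M s ^ k).trace)
      (∑ r ∈ Finset.range k, (A * U ^ r * X * U ^ (k - r)).trace) t := by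
  have h := ((hasMatrixDerivAt_const A t).mul (hM.pow k)).trace
  refine h.congr_deriv ?_
  rw [zero_mul, zero_add, hU, Finset.mul_sum, Matrix.trace_sum]
  refine Finset.sum_congr rfl fun r hr => ?_
  have := Finset.mem_range.1 hr
  rw [show k - r = (k - 1 - r) + 1 by omega, pow_succ']
  simp only [mul_assoc]

theorem hasDerivAt_trace_pow {M : ℝ → Matrix n n ℂ} {X U : Matrix n n ℂ} {t : ℝ}
    (hM : HasMatrixDerivAt M (X * U) t) (hU : M t = U) (k : ℕ) :
    HasDerivAt (fun s => (M s ^ k).trace) (k * (X * U ^ k).trace) t := by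
  have h := hasDerivAt_trace_mul_pow (A := 1) hM hU k
  simp only [one_mul] at h
  refine h.congr_deriv ?_
  have : ∀ r ∈ Finset.range k, (U ^ r * X * U ^ (k - r)).trace = (X * U ^ k).trace := by
    intro r hr
    rw [Matrix.trace_mul_cycle, ← pow_add, Nat.sub_add_cancel (Finset.mem_range.1 hr).le,
      Matrix.trace_mul_comm]
  rw [Finset.sum_congr rfl this]
  simp

theorem hasMatrixDerivAt_exp (X U : Matrix n n ℂ) :
    HasMatrixDerivAt (fun t : ℝ => NormedSpace.exp (t • X) * U) (X * U) 0 := by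
  open scoped Matrix.Norms.Operator in
  have h := hasDerivAt_exp_smul_const (𝕂 := ℝ) X (0 : ℝ)
  have h2 : HasMatrixDerivAt (fun t : ℝ => NormedSpace.exp (t • X)) X 0 := by
    intro i j
    rw [zero_smul, NormedSpace.exp_zero, one_mul] at h
    exact (hasDerivAt_pi.1 ((hasDerivAt_pi.1 h) i)) j
  have := h2.mul (hasMatrixDerivAt_const U 0)
  simpa using this

theorem exp_smul_add (X : Matrix n n ℂ) (s t : ℝ) :
    NormedSpace.exp ((s + t) • X) = NormedSpace.exp (s • X) * NormedSpace.exp (t • X) := by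
  rw [add_smul, Matrix.exp_add_of_commute]
  exact (Commute.refl X).smul_left s |>.smul_right t

theorem exp_smul_mul_exp_neg (X : Matrix n n ℂ) (t : ℝ) :
    NormedSpace.exp (t • X) * NormedSpace.exp (-(t • X)) = 1 := by
  rw [← neg_smul, ← exp_smul_add]
  simp

theorem exp_smul_mem_unitaryGroup {X : Matrix n n ℂ} (hX : Xᴴ = -X) (t : ℝ) :
    NormedSpace.exp (t • X) ∈ Matrix.unitaryGroup n ℂ := by
  rw [Matrix.mem_unitaryGroup_iff, Matrix.star_eq_conjTranspose, ← Matrix.exp_conjTranspose,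
    Matrix.conjTranspose_smul, hX, star_trivial, smul_neg]
  exact exp_smul_mul_exp_neg X t

end MatrixCalculus

/-! ### Fierz identities -/

section Fierz

variable {n : Type*} [Fintype n] [DecidableEq n]

/-- The skew-Hermitian matrices `z E_{ij} - z̄ E_{ji}`, `z ∈ {1, i}`. -/
def skewUnit (a : Bool × n × n) : Matrix n n ℂ :=
  Matrix.single a.2.1 a.2.2 (if a.1 then Complex.I else 1) -
    Matrix.single a.2.2 a.2.1 (if a.1 then -Complex.I else 1)

theorem conjTranspose_skewUnit (a : Bool × n × n) : (skewUnit a)ᴴ = -skewUnit a := by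
  obtain ⟨b, i, j⟩ := a
  have h : ∀ (i j : n) (z : ℂ), (Matrix.single i j z)ᴴ = Matrix.single j i (star z) := by
    intro i j z
    ext k l
    simp only [Matrix.conjTranspose_apply, Matrix.single_apply]
    split_ifs <;> simp_all
  cases b <;> simp [skewUnit, Matrix.conjTranspose_sub, h]

theorem trace_skewUnit_mul (b : Bool) (i j : n) (A : Matrix n n ℂ) :
    (skewUnit (b, i, j) * A).trace = (if b then Complex.I else 1) * A j i -
      (if b then -Complex.I else 1) * A i j := by
  simp [skewUnit, sub_mul, Matrix.trace_sub, Matrix.trace_single_mul]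

/-- Completeness relation of the Lie algebra `u(n)`, merging two traces into one. For each pair the
choices `z = 1` and `z = i` combine so that the products `A i j * B i j` cancel. The factor is `4`
because every unordered pair of indices is counted twice. -/
theorem sum_trace_skewUnit_mul_trace (A B : Matrix n n ℂ) :
    ∑ a, (skewUnit a * A).trace * (skewUnit a * B).trace = -4 * (A * B).trace := by
  have h : ∀ i j : n, ∑ b : Bool, (skewUnit (b, i, j) * A).trace * (skewUnit (b, i, j) * B).trace =
      -2 * (A j i * B i j) - 2 * (A i j * B j i) := by
    intro i j
    simp only [Fintype.sum_bool, trace_skewUnit_mul]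
    simp
    linear_combination (A j i + A i j) * (B j i + B i j) * Complex.I_sq
  rw [Fintype.sum_prod_type_right]
  rw [Fintype.sum_prod_type]
  simp_rw [h, Finset.sum_sub_distrib, ← Finset.mul_sum]
  have h1 : (A * B).trace = ∑ i, ∑ j, A i j * B j i := by
    simp [Matrix.trace, Matrix.mul_apply]
  rw [h1, Finset.sum_comm]
  ring

/-- The companion relation, splitting one trace into two. -/
theorem sum_trace_skewUnit_mul_skewUnit_mul (A B : Matrix n n ℂ) :
    ∑ a, (skewUnit a * A * skewUnit a * B).trace = -4 * (A.trace * B.trace) := by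
  have h0 : ∀ (i j k l : n) (z w : ℂ),
      (Matrix.single i j z * A * Matrix.single k l w * B).trace = z * w * (A j k * B l i) := by
    intro i j k l z w
    rw [Matrix.single_mul_mul_single, Matrix.trace_single_mul]
    simp
    ring
  have h : ∀ i j : n, ∑ b : Bool, (skewUnit (b, i, j) * A * skewUnit (b, i, j) * B).trace =
      -2 * (A j j * B i i) - 2 * (A i i * B j j) := by
    intro i j
    simp only [Fintype.sum_bool, skewUnit, sub_mul, mul_sub, Matrix.trace_sub, h0]
    simp
    ring
  rw [Fintype.sum_prod_type_right]
  rw [Fintype.sum_prod_type]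
  simp_rw [h, Finset.sum_sub_distrib, ← Finset.mul_sum, ← Finset.sum_mul, ← Finset.mul_sum]
  simp only [Matrix.trace, Matrix.diag]
  ring

/-- With one generator transposed the trace does not split. This produces the term that
distinguishes orthogonal and symplectic loop equations from unitary ones. -/
theorem sum_trace_skewUnit_mul_transpose_mul (A B : Matrix n n ℂ) :
    ∑ a, (skewUnit a * A * (skewUnit a)ᵀ * B).trace = -4 * (Aᵀ * B).trace := by
  have h0 : ∀ (i j k l : n) (z w : ℂ),
      (Matrix.single i j z * A * Matrix.single k l w * B).trace = z * w * (A j k * B l i) := by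
    intro i j k l z w
    rw [Matrix.single_mul_mul_single, Matrix.trace_single_mul]
    simp
    ring
  have h : ∀ i j : n, ∑ b : Bool, (skewUnit (b, i, j) * A * (skewUnit (b, i, j))ᵀ * B).trace =
      -2 * (A j i * B j i) - 2 * (A i j * B i j) := by
    intro i j
    simp only [Fintype.sum_bool, skewUnit, Matrix.transpose_sub, Matrix.transpose_single, sub_mul,
      mul_sub, Matrix.trace_sub, h0]
    simp
    ring
  rw [Fintype.sum_prod_type_right]
  rw [Fintype.sum_prod_type]
  simp_rw [h, Finset.sum_sub_distrib, ← Finset.mul_sum]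
  have h1 : (Aᵀ * B).trace = ∑ i, ∑ j, A j i * B j i := by
    simp [Matrix.trace, Matrix.mul_apply]
  rw [h1, Finset.sum_comm (f := fun i j => A i j * B i j)]
  ring

end Fierz

end BoseGas
end

noncomputable section
namespace BoseGas

/-! ### Bounded random variables are determined by their moments -/

/-- Weierstrass approximation on `[-M, M]`: equal moments give equal integrals of polynomials, and a
uniform error `ε` costs at most `ε` times the total masses. The measures need not be normalised. -/
theorem integral_comp_eq_of_moments {S T : Type*} [MeasurableSpace S] [MeasurableSpace T]
    {μ : Measure S} {ν : Measure T} [IsFiniteMeasure μ] [IsFiniteMeasure ν] {f : S → ℝ} {g : T → ℝ}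
    (hf : AEStronglyMeasurable f μ) (hg : AEStronglyMeasurable g ν) {M : ℝ}
    (hfM : ∀ᵐ x ∂μ, f x ∈ Set.Icc (-M) M) (hgM : ∀ᵐ x ∂ν, g x ∈ Set.Icc (-M) M)
    (hmom : ∀ m : ℕ, ∫ x, f x ^ m ∂μ = ∫ x, g x ^ m ∂ν) {h : ℝ → ℝ} (hh : Continuous h) :
    ∫ x, h (f x) ∂μ = ∫ x, h (g x) ∂ν := by
  have bdd : ∀ k : ℝ → ℝ, Continuous k → ∃ B, ∀ x ∈ Set.Icc (-M) M, ‖k x‖ ≤ B := by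
    intro k hk
    obtain ⟨B, hB⟩ := (isCompact_Icc.image hk).isBounded.exists_norm_le
    exact ⟨B, fun x hx => hB _ ⟨x, hx, rfl⟩⟩
  have intf : ∀ k : ℝ → ℝ, Continuous k → Integrable (fun x => k (f x)) μ := by
    intro k hk
    obtain ⟨B, hB⟩ := bdd k hk
    exact Integrable.of_bound (hk.comp_aestronglyMeasurable hf) B (hfM.mono fun x hx => hB _ hx)
  have intg : ∀ k : ℝ → ℝ, Continuous k → Integrable (fun x => k (g x)) ν := by
    intro k hk
    obtain ⟨B, hB⟩ := bdd k hk
    exact Integrable.of_bound (hk.comp_aestronglyMeasurable hg) B (hgM.mono fun x hx => hB _ hx)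
  have poly : ∀ P : Polynomial ℝ, ∫ x, P.eval (f x) ∂μ = ∫ x, P.eval (g x) ∂ν := by
    intro P
    simp only [Polynomial.eval_eq_sum_range]
    rw [integral_finsetSum _ fun i _ => (intf (fun x => x ^ i) (by fun_prop)).const_mul _,
      integral_finsetSum _ fun i _ => (intg (fun x => x ^ i) (by fun_prop)).const_mul _]
    refine Finset.sum_congr rfl fun i _ => ?_
    rw [integral_const_mul, integral_const_mul, hmom]
  have key : ∀ ε > 0, |∫ x, h (f x) ∂μ - ∫ x, h (g x) ∂ν| ≤
      ε * (μ.real Set.univ + ν.real Set.univ) := by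
    intro ε hε
    obtain ⟨P, hP⟩ := exists_polynomial_near_of_continuousOn (-M) M h hh.continuousOn ε hε
    have h1 : |∫ x, h (f x) ∂μ - ∫ x, P.eval (f x) ∂μ| ≤ ε * μ.real Set.univ := by
      rw [← integral_sub (intf h hh) (intf _ P.continuous), ← Real.norm_eq_abs]
      refine norm_integral_le_of_norm_le_const (hfM.mono fun x hx => ?_)
      rw [norm_sub_rev]
      exact (hP _ hx).le
    have h2 : |∫ x, h (g x) ∂ν - ∫ x, P.eval (g x) ∂ν| ≤ ε * ν.real Set.univ := by
      rw [← integral_sub (intg h hh) (intg _ P.continuous), ← Real.norm_eq_abs]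
      refine norm_integral_le_of_norm_le_const (hgM.mono fun x hx => ?_)
      rw [norm_sub_rev]
      exact (hP _ hx).le
    rw [poly] at h1
    rw [abs_le] at *
    constructor <;> linarith [h1.1, h1.2, h2.1, h2.2]
  rw [← sub_eq_zero]
  by_contra hne
  have hpos := abs_pos.2 hne
  set K := μ.real Set.univ + ν.real Set.univ
  have hK : 0 ≤ K := by positivity
  -- With this `ε` the bound is less than half of the difference it is supposed to dominate.
  have h3 := key (|∫ x, h (f x) ∂μ - ∫ x, h (g x) ∂ν| / (2 * (K + 1))) (by positivity)
  rw [div_mul_eq_mul_div, le_div_iff₀ (by positivity)] at h3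
  nlinarith

/-! ### Products as polynomials in linear statistics -/

theorem exists_eval_eq_sum_of_mem_span {ι : Type*} {N : ℕ} {φ : ι → ℝ → ℂ} {y : ℝ → ℂ}
    (hy : y ∈ Submodule.span ℂ (Set.range φ)) : ∃ F : MvPolynomial ι ℂ, ∀ x : Fin N → ℝ,
      MvPolynomial.eval (fun k => ∑ l, φ k (x l)) F = ∑ l, y (x l) := by
  induction hy using Submodule.span_induction with
  | mem y hy =>
    obtain ⟨k, rfl⟩ := hy
    exact ⟨MvPolynomial.X k, fun x => by simp⟩
  | zero => exact ⟨0, fun x => by simp⟩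
  | add y z _ _ hy hz =>
    obtain ⟨F, hF⟩ := hy
    obtain ⟨G, hG⟩ := hz
    exact ⟨F + G, fun x => by simp [hF, hG, Finset.sum_add_distrib]⟩
  | smul c y _ hy =>
    obtain ⟨F, hF⟩ := hy
    exact ⟨MvPolynomial.C c * F, fun x => by simp [hF, Finset.mul_sum]⟩

/-- Newton's identities: a product over the particles is a polynomial in the power sums. -/
theorem exists_eval_eq_prod_of_power_sums {ι T : Type*} {N : ℕ} {p : T → ι → ℂ}
    {y : T → Fin N → ℂ}
    (hy : ∀ m : ℕ, ∃ F : MvPolynomial ι ℂ, ∀ t, MvPolynomial.eval (p t) F = ∑ l, y t l ^ m) :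
    ∃ F : MvPolynomial ι ℂ, ∀ t, MvPolynomial.eval (p t) F = ∏ l, y t l := by
  have key : ∀ k : ℕ, ∃ F : MvPolynomial ι ℂ, ∀ t, MvPolynomial.eval (p t) F =
      MvPolynomial.eval (y t) (MvPolynomial.esymm (Fin N) ℂ k) := by
    intro k
    induction k using Nat.strong_induction_on with
    | _ k ih =>
      rcases Nat.eq_zero_or_pos k with rfl | hk
      · exact ⟨1, fun t => by simp⟩
      choose! F hF using ih
      choose P hP using hy
      refine ⟨MvPolynomial.C ((k : ℂ)⁻¹) * ((-1) ^ (k + 1) *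
        ∑ a ∈ Finset.HasAntidiagonal.antidiagonal k with a.1 < k, (-1) ^ a.1 * F a.1 * P a.2), fun t => ?_⟩
      have h := congrArg (MvPolynomial.eval (y t)) (MvPolynomial.mul_esymm_eq_sum (Fin N) ℂ k)
      simp only [map_mul, map_sum, map_pow, map_neg, map_one, map_natCast] at h ⊢
      rw [MvPolynomial.eval_C, inv_mul_eq_iff_eq_mul₀ (by exact_mod_cast hk.ne'), h]
      congr 1
      refine Finset.sum_congr rfl fun a ha => ?_
      rw [hF _ (Finset.mem_filter.1 ha).2, hP]
      simp [MvPolynomial.psum]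
  obtain ⟨F, hF⟩ := key N
  refine ⟨F, fun t => ?_⟩
  rw [hF, MvPolynomial.esymm]
  have : (Finset.univ : Finset (Fin N)).powersetCard N = {Finset.univ} := by
    have h := Finset.powersetCard_self (Finset.univ : Finset (Fin N))
    rwa [Finset.card_univ, Fintype.card_fin] at h
  rw [this]
  simp

/-! ### From polynomial statistics to products of non-negative functions -/

namespace LoopEnsemble

variable {ι : Type*} {N : ℕ} (A : LoopEnsemble ι N)

/-- The one-particle functions whose linear statistics are polynomials in the basic ones. -/
def oneParticle : Submodule ℂ (ℝ → ℂ) := Submodule.span ℂ (Set.range A.φ)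

theorem mul_mem_oneParticle (hmul : ∀ j k, A.φ j * A.φ k ∈ A.oneParticle) {y z : ℝ → ℂ}
    (hy : y ∈ A.oneParticle) (hz : z ∈ A.oneParticle) : y * z ∈ A.oneParticle := by
  refine Submodule.span_induction₂ (p := fun a b _ _ => a * b ∈ A.oneParticle) ?_ ?_ ?_ ?_ ?_ ?_ ?_
    hy hz
  · rintro _ _ ⟨j, rfl⟩ ⟨k, rfl⟩
    exact hmul j k
  · simp
  · simp
  · intro a b c _ _ _ ha hb
    rw [add_mul]
    exact add_mem ha hb
  · intro a b c _ _ _ ha hb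
    rw [mul_add]
    exact add_mem ha hb
  · intro r a b _ _ h
    rw [smul_mul_assoc]
    exact Submodule.smul_mem _ _ h
  · intro r a b _ _ h
    rw [mul_smul_comm]
    exact Submodule.smul_mem _ _ h

theorem pow_mem_oneParticle (h1 : (1 : ℝ → ℂ) ∈ A.oneParticle)
    (hmul : ∀ j k, A.φ j * A.φ k ∈ A.oneParticle) {y : ℝ → ℂ} (hy : y ∈ A.oneParticle) (m : ℕ) :
    y ^ m ∈ A.oneParticle := by
  induction m with
  | zero => simpa using h1
  | succ m ih =>
    rw [pow_succ]
    exact A.mul_mem_oneParticle hmul ih hy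

theorem exists_eval_stat_eq_prod (h1 : (1 : ℝ → ℂ) ∈ A.oneParticle)
    (hmul : ∀ j k, A.φ j * A.φ k ∈ A.oneParticle) {y : ℝ → ℂ} (hy : y ∈ A.oneParticle) :
    ∃ F, ∀ x, MvPolynomial.eval (A.stat x) F = ∏ l, y (x l) :=
  exists_eval_eq_prod_of_power_sums fun m =>
    exists_eval_eq_sum_of_mem_span (A.pow_mem_oneParticle h1 hmul hy m)

/-- Equality of averages of polynomials in the linear statistics yields the equality for products
of non-negative one-particle functions with square in `A.oneParticle`. -/
theorem integral_prod_eq (h1 : (1 : ℝ → ℂ) ∈ A.oneParticle)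
    (hmul : ∀ j k, A.φ j * A.φ k ∈ A.oneParticle) {G : Type*} [TopologicalSpace G] [CompactSpace G]
    [MeasurableSpace G] [BorelSpace G] {μ : Measure G} [IsFiniteMeasure μ] {p : G → ι → ℂ}
    (hp : ∀ j, Continuous fun g => p g j)
    (hav : ∀ f, A.functional f =
      (∫ x in cube N A.a A.b, A.W x : ℝ) * ∫ g, MvPolynomial.eval (p g) f ∂μ)
    {θ : G → Fin N → ℝ} (hθ : ∀ g, θ g ∈ cube N A.a A.b) (hpθ : ∀ g, p g = A.stat (θ g))
    {y : ℝ → ℝ} (hy0 : ∀ t, 0 ≤ y t) (hy : (fun t => ((y t ^ 2 : ℝ) : ℂ)) ∈ A.oneParticle) :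
    Integrable (fun g => ∏ l, y (θ g l)) μ ∧
      ∫ x in cube N A.a A.b, (∏ l, y (x l)) * A.W x =
        (∫ x in cube N A.a A.b, A.W x) * ∫ g, ∏ l, y (θ g l) ∂μ := by
  obtain ⟨F, hF⟩ := A.exists_eval_stat_eq_prod h1 hmul hy
  have hF' : ∀ x, MvPolynomial.eval (A.stat x) F = (((∏ l, y (x l)) ^ 2 : ℝ) : ℂ) := by
    intro x
    rw [hF, ← Complex.ofReal_prod, Finset.prod_pow]
  -- The product itself may involve absolute values, but its square is a polynomial in the
  -- statistics. The product is recovered as `√Q` since `y` is non-negative.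
  set Q : (Fin N → ℝ) → ℝ := fun x => (∏ l, y (x l)) ^ 2 with hQ
  have hQc : Continuous Q := by
    have h : Q = fun x => (MvPolynomial.eval (A.stat x) F).re := by
      funext x
      rw [hF', Complex.ofReal_re]
    rw [h]
    exact Complex.continuous_re.comp (A.continuous_eval_stat F)
  -- The labelling `θ` is an arbitrary choice and need not be measurable. Through `F` the composite
  -- is a polynomial in the continuous statistics `p`.
  have hQG : Continuous fun g => Q (θ g) := by
    have h : (fun g => Q (θ g)) = fun g => (MvPolynomial.eval (p g) F).re := by
      funext g
      rw [hpθ, hF', Complex.ofReal_re]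
    rw [h]
    exact Complex.continuous_re.comp (continuous_eval_of_continuous hp F)
  have hsqrt : ∀ x, √(Q x) = ∏ l, y (x l) := fun x =>
    Real.sqrt_sq (Finset.prod_nonneg fun l _ => hy0 _)
  obtain ⟨M, hM⟩ := ((isCompact_cube N A.a A.b).image hQc).isBounded.exists_norm_le
  have hM' : ∀ x ∈ cube N A.a A.b, Q x ∈ Set.Icc (-M) M := fun x hx =>
    abs_le.1 (hM _ ⟨x, hx, rfl⟩)
  have hint : Integrable (fun g => ∏ l, y (θ g l)) μ := by
    simp_rw [← hsqrt]
    exact integrable_of_continuous hQG.sqrt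
  refine ⟨hint, ?_⟩
  set Z := ∫ x in cube N A.a A.b, A.W x with hZ
  have hZpos : 0 < Z := A.integral_W_pos
  let w : (Fin N → ℝ) → NNReal := fun x => Real.toNNReal (A.W x)
  have hw : Measurable w := A.hW.measurable.real_toNNReal
  let ν := (volume.restrict (cube N A.a A.b)).withDensity fun x => (w x : ENNReal)
  have hν : ∀ f : (Fin N → ℝ) → ℝ, ∫ x, f x ∂ν = ∫ x in cube N A.a A.b, f x * A.W x := by
    intro f
    rw [integral_withDensity_eq_integral_smul hw]
    refine integral_congr_ae (Filter.Eventually.of_forall fun x => ?_)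
    simp only [w, NNReal.smul_def, Real.coe_toNNReal _ (A.W_nonneg x), smul_eq_mul, mul_comm]
  have hνfin : IsFiniteMeasure ν := by
    have : Integrable (fun x => (w x : ℝ)) (volume.restrict (cube N A.a A.b)) := by
      refine (integrableOn_cube A.hW).congr (Filter.Eventually.of_forall fun x => ?_)
      simp [w, Real.coe_toNNReal _ (A.W_nonneg x)]
    exact isFiniteMeasure_withDensity (by
      have h2 := this.lintegral_lt_top
      simpa using h2.ne)
  have hνcube : ∀ᵐ x ∂ν, x ∈ cube N A.a A.b :=
    (withDensity_absolutelyContinuous _ _).ae_le (ae_restrict_mem (measurableSet_cube N A.a A.b))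
  -- The law of `Q` under the density `W` is compared with its law on the group, rescaled to total
  -- mass `Z`. The `m`-th moments agree by `hav` for `F ^ m`.
  have key := integral_comp_eq_of_moments (μ := ν) (ν := (Real.toNNReal Z) • μ) (f := Q)
    (g := fun g => Q (θ g)) hQc.aestronglyMeasurable
    hQG.aestronglyMeasurable (M := M) (hνcube.mono fun x hx => hM' x hx)
    (Filter.Eventually.of_forall fun g => hM' _ (hθ g)) (h := Real.sqrt) (by
      intro m
      rw [hν, integral_smul_nnreal_measure, NNReal.smul_def, Real.coe_toNNReal _ hZpos.le,
        smul_eq_mul]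
      have h3 := hav (F ^ m)
      rw [A.functional_apply] at h3
      simp only [map_pow, hpθ, hF', ← Complex.ofReal_pow, ← Complex.ofReal_mul] at h3
      rw [integral_complex_ofReal, integral_complex_ofReal, ← Complex.ofReal_mul] at h3
      exact_mod_cast h3) Real.continuous_sqrt
  rw [hν, integral_smul_nnreal_measure, NNReal.smul_def, Real.coe_toNNReal _ hZpos.le,
    smul_eq_mul] at key
  simpa only [hsqrt] using key

end LoopEnsemble

/-- The average of polynomials in the statistics `p`. -/
def averageFunctional {ι G : Type*} [TopologicalSpace G] [CompactSpace G]
    [MeasurableSpace G] [BorelSpace G] (μ : Measure G) [IsFiniteMeasure μ] (p : G → ι → ℂ)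
    (hp : ∀ j, Continuous fun g => p g j) : MvPolynomial ι ℂ →ₗ[ℂ] ℂ where
  toFun f := ∫ g, MvPolynomial.eval (p g) f ∂μ
  map_add' f g := by
    simp only [map_add]
    exact integral_add (integrable_of_continuous (continuous_eval_of_continuous hp f))
      (integrable_of_continuous (continuous_eval_of_continuous hp g))
  map_smul' c f := by
    simp only [MvPolynomial.smul_eval, RingHom.id_apply, smul_eq_mul]
    exact integral_const_mul c _

/-- Averages over a compact group with the loop equations of `A`. -/
theorem LoopEnsemble.integral_prod_eq_of_loop {ι G : Type*} {N : ℕ} (A : LoopEnsemble ι N)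
    (h1 : (1 : ℝ → ℂ) ∈ A.oneParticle) (hmul : ∀ j k, A.φ j * A.φ k ∈ A.oneParticle)
    [TopologicalSpace G] [CompactSpace G] [MeasurableSpace G] [BorelSpace G] {μ : Measure G}
    [IsProbabilityMeasure μ] {p : G → ι → ℂ} (hp : ∀ j, Continuous fun g => p g j)
    (hloop : ∀ k f, ∫ g, MvPolynomial.eval (p g)
      (A.c k * f + MvPolynomial.mkDerivation ℂ (A.Γ k) f) ∂μ = 0)
    {θ : G → Fin N → ℝ} (hθ : ∀ g, θ g ∈ cube N A.a A.b) (hpθ : ∀ g, p g = A.stat (θ g))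
    {y : ℝ → ℝ} (hy0 : ∀ t, 0 ≤ y t) (hy : (fun t => ((y t ^ 2 : ℝ) : ℂ)) ∈ A.oneParticle) :
    Integrable (fun g => ∏ l, y (θ g l)) μ ∧
      ∫ x in cube N A.a A.b, (∏ l, y (x l)) * A.W x =
        (∫ x in cube N A.a A.b, A.W x) * ∫ g, ∏ l, y (θ g l) ∂μ := by
  refine A.integral_prod_eq h1 hmul hp (fun f => ?_) hθ hpθ hy0 hy
  refine A.eq_average (averageFunctional μ p hp) ?_ hloop ?_ f
  · simp [averageFunctional]
  · intro f hf
    have : ∀ g, MvPolynomial.eval (p g) f = 0 := fun g => by rw [hpθ]; exact hf _ (hθ g)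
    simp [averageFunctional, this]

end BoseGas
end

noncomputable section
namespace BoseGas

/-! ### Eigenvalues of matrices -/

section Eigenvalues

variable {n : Type*} [Fintype n] [DecidableEq n]

theorem card_roots_charpoly (M : Matrix n n ℂ) : M.charpoly.roots.card = Fintype.card n := by
  rw [IsAlgClosed.card_roots_eq_natDegree, Matrix.charpoly_natDegree_eq_dim]

theorem charpoly_eq_prod_roots (M : Matrix n n ℂ) :
    M.charpoly = (M.charpoly.roots.map fun u => Polynomial.X - Polynomial.C u).prod := by
  have h := (IsAlgClosed.splits M.charpoly).eq_prod_roots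
  rwa [M.charpoly_monic.leadingCoeff, Polynomial.C_1, one_mul] at h

theorem det_sub_scalar (M : Matrix n n ℂ) (a : ℂ) :
    (M - Matrix.scalar n a).det = (M.charpoly.roots.map fun u => u - a).prod := by
  have h1 : M.charpoly.eval a = (M.charpoly.roots.map fun u => a - u).prod := by
    conv_lhs => rw [charpoly_eq_prod_roots M]
    rw [Polynomial.eval_multiset_prod, Multiset.map_map]
    simp
  have h2 : (M - Matrix.scalar n a) = -(Matrix.scalar n a - M) := by abel
  rw [h2, Matrix.det_neg, ← Matrix.eval_charpoly, h1, ← card_roots_charpoly M]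
  have h3 : (fun u : ℂ => u - a) = fun u => -1 * (a - u) := by
    funext u
    ring
  rw [h3, Multiset.prod_map_mul]
  simp

/-- Spectral mapping with multiplicities, without diagonalising: `q` is factored into linear factors
and the determinant is multiplicative. -/
theorem det_aeval (M : Matrix n n ℂ) (q : Polynomial ℂ) :
    (Polynomial.aeval M q).det = (M.charpoly.roots.map fun u => q.eval u).prod := by
  have key : ∀ s : Multiset ℂ,
      (Polynomial.aeval M (s.map fun a => Polynomial.X - Polynomial.C a).prod).det =
        (M.charpoly.roots.map fun u =>
          ((s.map fun a => Polynomial.X - Polynomial.C a).prod : Polynomial ℂ).eval u).prod := by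
    intro s
    induction s using Multiset.induction_on with
    | empty => simp
    | cons a s ih =>
      have h : (Polynomial.aeval M (Polynomial.X - Polynomial.C a)) = M - Matrix.scalar n a := by
        rw [map_sub, Polynomial.aeval_X, Polynomial.aeval_C]
        rfl
      simp only [Multiset.map_cons, Multiset.prod_cons, map_mul, Matrix.det_mul, h, det_sub_scalar,
        ih, Polynomial.eval_mul, Multiset.prod_map_mul, Polynomial.eval_sub, Polynomial.eval_X,
        Polynomial.eval_C]
  have h := (IsAlgClosed.splits q).eq_prod_roots
  rw [h]
  simp only [map_mul, Matrix.det_mul, key, Polynomial.eval_mul, Multiset.prod_map_mul,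
    Polynomial.eval_C, Polynomial.aeval_C]
  congr 1
  rw [Multiset.map_const', Multiset.prod_replicate, card_roots_charpoly]
  change (Matrix.scalar n q.leadingCoeff).det = _
  simp

/-- The value at `z` of the characteristic polynomial of `M ^ k` is the determinant of `z - X ^ k`
evaluated at `M`, so `det_aeval` applies. -/
theorem roots_charpoly_pow (M : Matrix n n ℂ) (k : ℕ) :
    (M ^ k).charpoly.roots = M.charpoly.roots.map (· ^ k) := by
  have h : (M ^ k).charpoly =
      ((M.charpoly.roots.map (· ^ k)).map fun u => Polynomial.X - Polynomial.C u).prod := by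
    refine Polynomial.funext fun z => ?_
    have h2 := det_aeval M (Polynomial.C z - Polynomial.X ^ k)
    rw [map_sub, map_pow, Polynomial.aeval_X, Polynomial.aeval_C] at h2
    rw [Matrix.eval_charpoly, Polynomial.eval_multiset_prod, Multiset.map_map, Multiset.map_map]
    refine Eq.trans h2 ?_
    simp
  rw [h, Polynomial.roots_multiset_prod_X_sub_C]

theorem trace_pow_eq_sum_roots (M : Matrix n n ℂ) (k : ℕ) :
    (M ^ k).trace = (M.charpoly.roots.map (· ^ k)).sum := by
  rw [Matrix.trace_eq_sum_roots_charpoly, roots_charpoly_pow]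

theorem norm_eq_one_of_mem_roots {M : Matrix n n ℂ} (hM : M ∈ Matrix.unitaryGroup n ℂ) {u : ℂ}
    (hu : u ∈ M.charpoly.roots) : ‖u‖ = 1 := by
  open scoped Matrix.Norms.L2Operator in
  have h1 : u ∈ spectrum ℂ M :=
    Matrix.mem_spectrum_iff_isRoot_charpoly.2 (Polynomial.isRoot_of_mem_roots hu)
  have := spectrum.subset_circle_of_unitary (𝕜 := ℂ) hM h1
  simpa using this

theorem exists_eq_univ_map {α : Type*} {N : ℕ} {s : Multiset α} (hs : s.card = N) :
    ∃ u : Fin N → α, s = Finset.univ.val.map u := by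
  subst hs
  obtain ⟨l, rfl⟩ := Quot.exists_rep s
  exact ⟨l.get, ((Fin.univ_val_map l.get).trans (congrArg _ (List.ofFn_get l))).symm⟩

/-- An angle in `[0, 2π)`. -/
def posArg (u : ℂ) : ℝ := if u.arg < 0 then u.arg + 2 * Real.pi else u.arg

theorem posArg_mem (u : ℂ) : posArg u ∈ Set.Icc 0 (2 * Real.pi) := by
  unfold posArg
  have h1 := Complex.neg_pi_lt_arg u
  have h2 := Complex.arg_le_pi u
  have h3 := Real.pi_pos
  split_ifs with h
  · constructor <;> linarith
  · exact ⟨not_lt.1 h, by linarith⟩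

theorem apply_posArg {y : ℝ → ℝ} (hy : ∀ t, y (t + 2 * Real.pi) = y t) (u : ℂ) :
    y (posArg u) = y u.arg := by
  unfold posArg
  split_ifs
  · exact hy _
  · rfl

theorem exp_posArg {u : ℂ} (hu : ‖u‖ = 1) : Complex.exp (posArg u * Complex.I) = u := by
  have h : Complex.exp (u.arg * Complex.I) = u := by
    have := Complex.norm_mul_exp_arg_mul_I u
    rwa [hu, Complex.ofReal_one, one_mul] at this
  unfold posArg
  split_ifs
  · push_cast
    rw [add_mul, Complex.exp_add, h, Complex.exp_two_pi_mul_I, mul_one]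
  · exact h

end Eigenvalues

instance isProbabilityMeasure_haarProb (G : Type*) [Group G] [TopologicalSpace G]
    [IsTopologicalGroup G] [CompactSpace G] [MeasurableSpace G] [BorelSpace G] :
    IsProbabilityMeasure (haarProb G) :=
  ⟨by
    have := Measure.haarMeasure_self (K₀ := (⊤ : TopologicalSpace.PositiveCompacts G))
    simpa [haarProb] using this⟩

instance isMulLeftInvariant_haarProb (G : Type*) [Group G] [TopologicalSpace G]
    [IsTopologicalGroup G] [CompactSpace G] [MeasurableSpace G] [BorelSpace G] :
    (haarProb G).IsMulLeftInvariant := Measure.isMulLeftInvariant_haarMeasure _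

/-! ### The unitary group -/

section UnitaryGroup

open MvPolynomial

variable {N : ℕ}

/-- The one-parameter group `t ↦ exp (t X)` for a skew-Hermitian matrix `X = skewUnit a`. -/
def unitaryFlow (a : Bool × Fin N × Fin N) (t : ℝ) : UGroup N :=
  ⟨NormedSpace.exp (t • skewUnit a), exp_smul_mem_unitaryGroup (conjTranspose_skewUnit a) t⟩

theorem unitaryFlow_add (a : Bool × Fin N × Fin N) (s t : ℝ) :
    unitaryFlow a (s + t) = unitaryFlow a s * unitaryFlow a t :=
  Subtype.ext (exp_smul_add _ s t)

/-- The power traces of a unitary matrix. -/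
def unitaryTrace (U : UGroup N) (k : ℤ) : ℂ := Matrix.trace (U ^ k : UGroup N).1

theorem unitaryTrace_natCast (U : UGroup N) (k : ℕ) : unitaryTrace U k = (U.1 ^ k).trace := by
  simp [unitaryTrace]

theorem unitaryTrace_neg (U : UGroup N) (k : ℤ) : unitaryTrace U (-k) = star (unitaryTrace U k) := by
  rw [unitaryTrace, _root_.zpow_neg, Matrix.UnitaryGroup.inv_val, Matrix.star_eq_conjTranspose,
    Matrix.trace_conjTranspose]
  rfl

theorem continuous_unitaryTrace (k : ℤ) : Continuous fun U : UGroup N => unitaryTrace U k := by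
  have h : ∀ k : ℕ, Continuous fun U : UGroup N => unitaryTrace U k := by
    intro k
    simp only [unitaryTrace_natCast]
    exact (continuous_subtype_val.pow k).matrix_trace
  obtain ⟨k, rfl | rfl⟩ := k.eq_nat_or_neg
  · exact h k
  · simp only [unitaryTrace_neg]
    exact (h k).star

/-- `tr (X U^k)`. -/
def skewTrace (a : Bool × Fin N × Fin N) (U : UGroup N) (k : ℤ) : ℂ :=
  (skewUnit a * (U ^ k : UGroup N).1).trace

theorem skewTrace_natCast (a : Bool × Fin N × Fin N) (U : UGroup N) (k : ℕ) :
    skewTrace a U k = (skewUnit a * U.1 ^ k).trace := by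
  simp [skewTrace]

theorem skewTrace_neg (a : Bool × Fin N × Fin N) (U : UGroup N) (k : ℤ) :
    skewTrace a U (-k) = -star (skewTrace a U k) := by
  rw [skewTrace, skewTrace, ← Matrix.trace_conjTranspose, Matrix.conjTranspose_mul,
    conjTranspose_skewUnit, mul_neg, Matrix.trace_neg, neg_neg, Matrix.trace_mul_comm, _root_.zpow_neg,
    Matrix.UnitaryGroup.inv_val, Matrix.star_eq_conjTranspose]

theorem continuous_skewTrace (a : Bool × Fin N × Fin N) (k : ℤ) :
    Continuous fun U : UGroup N => skewTrace a U k := by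
  have h : ∀ k : ℕ, Continuous fun U : UGroup N => skewTrace a U k := by
    intro k
    simp only [skewTrace_natCast]
    exact (continuous_const.matrix_mul (continuous_subtype_val.pow k)).matrix_trace
  obtain ⟨k, rfl | rfl⟩ := k.eq_nat_or_neg
  · exact h k
  · simp only [skewTrace_neg]
    exact (h k).star.neg

theorem hasMatrixDerivAt_unitaryFlow (a : Bool × Fin N × Fin N) (U : UGroup N) :
    HasMatrixDerivAt (fun t => (unitaryFlow a t * U).1) (skewUnit a * U.1) 0 :=
  hasMatrixDerivAt_exp (skewUnit a) U.1

theorem unitaryFlow_zero_mul (a : Bool × Fin N × Fin N) (U : UGroup N) :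
    (unitaryFlow a 0 * U).1 = U.1 := by
  simp [unitaryFlow]

theorem hasDerivAt_unitaryTrace (a : Bool × Fin N × Fin N) (k : ℤ) (U : UGroup N) :
    HasDerivAt (fun t => unitaryTrace (unitaryFlow a t * U) k) (k * skewTrace a U k) 0 := by
  have h : ∀ k : ℕ, HasDerivAt (fun t => unitaryTrace (unitaryFlow a t * U) k)
      (k * skewTrace a U k) 0 := by
    intro k
    simp only [unitaryTrace_natCast, skewTrace_natCast]
    exact hasDerivAt_trace_pow (hasMatrixDerivAt_unitaryFlow a U) (unitaryFlow_zero_mul a U) k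
  obtain ⟨k, rfl | rfl⟩ := k.eq_nat_or_neg
  · simpa using h k
  · simp only [unitaryTrace_neg, skewTrace_neg]
    refine (h k).star.congr_deriv ?_
    simp

/-- The derivative of `tr (X U^k)` along `X`. -/
def skewTraceDeriv (a : Bool × Fin N × Fin N) (k : ℕ) (U : UGroup N) : ℂ :=
  ∑ r ∈ Finset.range k, (skewUnit a * U.1 ^ r * skewUnit a * U.1 ^ (k - r)).trace

theorem hasDerivAt_skewTrace (a : Bool × Fin N × Fin N) (k : ℕ) (U : UGroup N) :
    HasDerivAt (fun t => skewTrace a (unitaryFlow a t * U) k) (skewTraceDeriv a k U) 0 := by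
  simp only [skewTrace_natCast]
  exact hasDerivAt_trace_mul_pow (hasMatrixDerivAt_unitaryFlow a U) (unitaryFlow_zero_mul a U) k

theorem continuous_skewTraceDeriv (a : Bool × Fin N × Fin N) (k : ℕ) :
    Continuous (skewTraceDeriv a k) := by
  refine continuous_finsetSum _ fun r _ => ?_
  have h : Continuous fun U : UGroup N => U.1 := continuous_subtype_val
  exact (((continuous_const.matrix_mul (h.pow r)).matrix_mul continuous_const).matrix_mul
    (h.pow (k - r))).matrix_trace

theorem sum_skewTraceDeriv (k : ℕ) (U : UGroup N) : ∑ a, skewTraceDeriv a k U =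
    -4 * ∑ r ∈ Finset.range k, unitaryTrace U r * unitaryTrace U (k - r) := by
  simp only [skewTraceDeriv]
  rw [Finset.sum_comm, Finset.mul_sum]
  refine Finset.sum_congr rfl fun r hr => ?_
  rw [sum_trace_skewUnit_mul_skewUnit_mul, ← Nat.cast_sub (Finset.mem_range.1 hr).le,
    unitaryTrace_natCast, unitaryTrace_natCast]

theorem sum_skewTrace_mul (U : UGroup N) (j k : ℤ) :
    ∑ a, skewTrace a U j * skewTrace a U k = -4 * unitaryTrace U (j + k) := by
  simp only [skewTrace]
  rw [sum_trace_skewUnit_mul_trace, unitaryTrace, _root_.zpow_add, Matrix.UnitaryGroup.mul_val]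

/-- The field is `∑ (k/4) tr (X_a U^k) X_a`. Its divergence is computed by the splitting Fierz
identity and its action on traces by the merging one; `1/4` cancels their factor `4`. -/
theorem unitary_loop (k : ℤ) (F : MvPolynomial ℤ ℂ) :
    ∫ U : UGroup N, eval (unitaryTrace U) ((ensembleU N).c k * F +
      mkDerivation ℂ ((ensembleU N).Γ k) F) ∂(haarProb (UGroup N)) = 0 := by
  have hΓ : ∀ (k j : ℤ) (U : UGroup N), ∑ a, k / 4 * skewTrace a U k * (j * skewTrace a U j) =
      eval (unitaryTrace U) ((ensembleU N).Γ k j) := by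
    intro k j U
    have : ∀ a, (k : ℂ) / 4 * skewTrace a U k * (j * skewTrace a U j) =
        k * j / 4 * (skewTrace a U k * skewTrace a U j) := fun a => by ring
    simp only [this]
    rw [← Finset.mul_sum, sum_skewTrace_mul]
    simp [ensembleU]
    ring
  have hp' : ∀ (a : Bool × Fin N × Fin N) (j : ℤ),
      Continuous fun U : UGroup N => (j : ℂ) * skewTrace a U j := fun a j =>
    continuous_const.mul (continuous_skewTrace a j)
  obtain ⟨k, rfl | rfl⟩ := k.eq_nat_or_neg
  · refine haar_loop (p := unitaryTrace) continuous_unitaryTrace unitaryFlow_add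
      (p' := fun a j U => j * skewTrace a U j) hp' hasDerivAt_unitaryTrace
      (f := fun a U => (k : ℤ) / 4 * skewTrace a U k) (f' := fun a U => k / 4 * skewTraceDeriv a k U)
      (fun a => continuous_const.mul (continuous_skewTrace a k))
      (fun a => continuous_const.mul (continuous_skewTraceDeriv a k))
      (fun a U => ?_) (fun U => ?_) (fun j U => hΓ k j U) F
    · simpa using (hasDerivAt_skewTrace a k U).const_mul ((k : ℂ) / 4)
    · rw [← Finset.mul_sum, sum_skewTraceDeriv]
      have h : ∀ r ∈ Finset.range k, eval (unitaryTrace U)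
          (X (Int.sign k * r) * X ((k : ℤ) - Int.sign k * r)) =
          unitaryTrace U r * unitaryTrace U (k - r) := by
        intro r hr
        have : 0 < k := Nat.zero_lt_of_lt (Finset.mem_range.1 hr)
        rw [Int.sign_eq_one_of_pos (by exact_mod_cast this)]
        simp
      simp only [ensembleU, Int.natAbs_natCast, map_mul, map_neg, map_sum] at h ⊢
      rw [Finset.sum_congr rfl h]
      simp
      ring
  -- For negative wave numbers the coefficients and the divergence are complex conjugates of those
  -- for `k`, because `U` is unitary and the generators are skew-Hermitian.
  · refine haar_loop (p := unitaryTrace) continuous_unitaryTrace unitaryFlow_add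
      (p' := fun a j U => j * skewTrace a U j) hp' hasDerivAt_unitaryTrace
      (f := fun a U => (-k : ℤ) / 4 * skewTrace a U (-k))
      (f' := fun a U => star (k / 4 * skewTraceDeriv a k U))
      (fun a => continuous_const.mul (continuous_skewTrace a (-k)))
      (fun a => (continuous_const.mul (continuous_skewTraceDeriv a k)).star)
      (fun a U => ?_) (fun U => ?_) (fun j U => hΓ (-k) j U) F
    · refine ((hasDerivAt_skewTrace a k U).const_mul ((k : ℂ) / 4)).star.congr_of_eventuallyEq
        (Filter.Eventually.of_forall fun t => ?_)
      simp only [skewTrace_neg]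
      simp [neg_div]
    · rw [← star_sum, ← Finset.mul_sum, sum_skewTraceDeriv]
      have h : ∀ r ∈ Finset.range k, eval (unitaryTrace U)
          (X (Int.sign (-k) * r) * X (-(k : ℤ) - Int.sign (-k) * r)) =
          star (unitaryTrace U r * unitaryTrace U (k - r)) := by
        intro r hr
        have : 0 < k := Nat.zero_lt_of_lt (Finset.mem_range.1 hr)
        rw [Int.sign_eq_neg_one_of_neg (by omega), star_mul', ← unitaryTrace_neg,
          ← unitaryTrace_neg]
        simp only [map_mul, eval_X]
        congr 2
        · ring
        · ring
      simp only [ensembleU, Int.natAbs_neg, Int.natAbs_natCast, map_mul, map_neg, map_sum] at h ⊢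
      rw [Finset.sum_congr rfl h, ← star_sum]
      simp
      ring

/-- The angles are defined in `(-π, π]` and the ensemble lives on `[0, 2π]`. For periodic
observables moving the negative ones by `2π` changes nothing. -/
theorem exists_angles_unitary (U : UGroup N) : ∃ θ : Fin N → ℝ,
    θ ∈ cube N 0 (2 * Real.pi) ∧ (unitaryTrace U = (ensembleU N).stat θ) ∧
      ∀ y : ℝ → ℝ, (∀ t, y (t + 2 * Real.pi) = y t) →
        ((anglesU U).map y).prod = ∏ l, y (θ l) := by
  obtain ⟨u, hu⟩ := exists_eq_univ_map ((card_roots_charpoly U.1).trans (Fintype.card_fin N))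
  have hu1 : ∀ l, ‖u l‖ = 1 := fun l => norm_eq_one_of_mem_roots U.2 (by
    rw [hu]
    exact Multiset.mem_map_of_mem _ (Finset.mem_univ l))
  have hnat : ∀ k : ℕ, unitaryTrace U k = ∑ l, u l ^ k := by
    intro k
    rw [unitaryTrace_natCast, trace_pow_eq_sum_roots, hu, Multiset.map_map]
    rfl
  have hexp : ∀ l, Complex.exp (posArg (u l) * Complex.I) = u l := fun l => exp_posArg (hu1 l)
  refine ⟨fun l => posArg (u l), fun l _ => posArg_mem _, ?_, fun y hy => ?_⟩
  · funext k
    change _ = ∑ l, Complex.exp (k * posArg (u l) * Complex.I)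
    simp only [mul_assoc, Complex.exp_int_mul, hexp]
    obtain ⟨k, rfl | rfl⟩ := k.eq_nat_or_neg
    · simpa using hnat k
    · rw [unitaryTrace_neg, hnat, star_sum]
      refine Finset.sum_congr rfl fun l _ => ?_
      rw [_root_.zpow_neg, zpow_natCast, star_pow, ← inv_pow, Complex.inv_eq_conj (hu1 l)]
      rfl
  · simp only [apply_posArg hy]
    rw [anglesU, eigenangles, hu, Multiset.map_map, Multiset.map_map]
    rfl

theorem one_mem_oneParticle_ensembleU : (1 : ℝ → ℂ) ∈ (ensembleU N).oneParticle := by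
  refine Submodule.subset_span ⟨0, ?_⟩
  funext t
  simp [ensembleU]

theorem mul_mem_oneParticle_ensembleU (j k : ℤ) :
    (ensembleU N).φ j * (ensembleU N).φ k ∈ (ensembleU N).oneParticle := by
  refine Submodule.subset_span ⟨j + k, ?_⟩
  funext t
  simp [ensembleU, add_mul, Complex.exp_add]

theorem unitary_average {y : ℝ → ℝ} (hper : ∀ t, y (t + 2 * Real.pi) = y t) (hy0 : ∀ t, 0 ≤ y t)
    (hy : (fun t => ((y t ^ 2 : ℝ) : ℂ)) ∈ (ensembleU N).oneParticle) :
    Integrable (fun U : UGroup N => ((anglesU U).map y).prod) (haarProb (UGroup N)) ∧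
      ∫ x in cube N 0 (2 * Real.pi), (∏ l, y (x l)) * weightU N x =
        (∫ x in cube N 0 (2 * Real.pi), weightU N x) *
          ∫ U : UGroup N, ((anglesU U).map y).prod ∂(haarProb (UGroup N)) := by
  choose θ hθ hpθ hpr using exists_angles_unitary (N := N)
  simp only [hpr _ y hper]
  exact (ensembleU N).integral_prod_eq_of_loop one_mem_oneParticle_ensembleU
    mul_mem_oneParticle_ensembleU continuous_unitaryTrace unitary_loop hθ hpθ hy0 hy

end UnitaryGroup

end BoseGas
end

noncomputable section
namespace BoseGas

/-! ### Groups of unitary matrices preserving a bilinear form -/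

/-- A group with a representation by unitary matrices of determinant one which preserve the bilinear
form with matrix `S`, where `Sᵀ = η S`, with the one-parameter groups generated by the projections
of the matrices `skewUnit a` to its Lie algebra. -/
structure FormGroup (G n : Type*) [Group G] [TopologicalSpace G] [Fintype n] [DecidableEq n] where
  M : G →* Matrix n n ℂ
  continuous_M : Continuous M
  S : Matrix n n ℂ
  Sinv : Matrix n n ℂ
  η : ℂ
  mul_inv : S * Sinv = 1
  transpose_S : Sᵀ = η • S
  η_sq : η * η = 1
  form : ∀ g, S * (M g)ᵀ * Sinv = M g⁻¹
  unitary : ∀ g, M g ∈ Matrix.unitaryGroup n ℂ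
  det_eq_one : ∀ g, (M g).det = 1
  flow : Bool × n × n → ℝ → G
  flow_add : ∀ a s t, flow a (s + t) = flow a s * flow a t
  flow_eq : ∀ a t, M (flow a t) =
    NormedSpace.exp (t • (skewUnit a - S * (skewUnit a)ᵀ * Sinv))

namespace FormGroup

open MvPolynomial

variable {G n : Type*} [Group G] [TopologicalSpace G] [Fintype n] [DecidableEq n]
  (R : FormGroup G n)

theorem inv_mul : R.Sinv * R.S = 1 := mul_eq_one_comm.1 R.mul_inv

theorem transpose_Sinv : R.Sinvᵀ = R.η • R.Sinv := by
  have h : R.Sinvᵀ * R.Sᵀ = 1 := by rw [← Matrix.transpose_mul, R.mul_inv, Matrix.transpose_one]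
  rw [R.transpose_S, Matrix.mul_smul] at h
  calc R.Sinvᵀ = R.Sinvᵀ * (R.S * R.Sinv) := by rw [R.mul_inv, mul_one]
    _ = (R.η * R.η) • (R.Sinvᵀ * R.S * R.Sinv) := by rw [R.η_sq, one_smul, mul_assoc]
    _ = R.η • ((R.η • (R.Sinvᵀ * R.S)) * R.Sinv) := by rw [Matrix.smul_mul, smul_smul]
    _ = R.η • R.Sinv := by rw [h, one_mul]

/-- The projection of `skewUnit a` to the Lie algebra. -/
def gen (a : Bool × n × n) : Matrix n n ℂ := skewUnit a - R.S * (skewUnit a)ᵀ * R.Sinv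

/-- `X ↦ S Xᵀ S⁻¹` is self-adjoint for the trace form: transposing under the trace produces two
factors `η`, which cancel. -/
theorem trace_form_mul (X A : Matrix n n ℂ) :
    (R.S * Xᵀ * R.Sinv * A).trace = (X * (R.S * Aᵀ * R.Sinv)).trace := by
  rw [← Matrix.trace_transpose]
  simp only [Matrix.transpose_mul, Matrix.transpose_transpose, R.transpose_S, R.transpose_Sinv,
    Matrix.mul_smul, Matrix.smul_mul, smul_smul, R.η_sq, one_smul]
  rw [← mul_assoc, ← mul_assoc, Matrix.trace_mul_comm, Matrix.trace_mul_comm X]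
  simp only [mul_assoc]

theorem trace_gen_mul (a : Bool × n × n) (A : Matrix n n ℂ) :
    (R.gen a * A).trace = (skewUnit a * (A - R.S * Aᵀ * R.Sinv)).trace := by
  rw [gen, sub_mul, mul_sub, Matrix.trace_sub, Matrix.trace_sub, trace_form_mul]

/-- The power traces of a group element. -/
def tr (g : G) (k : ℤ) : ℂ := (R.M (g ^ k)).trace

theorem tr_natCast (g : G) (k : ℕ) : R.tr g k = (R.M g ^ k).trace := by simp [tr]

/-- `M g⁻¹` is similar to the transpose of `M g`. Power traces are therefore even in the exponent,
and natural indices suffice. -/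
theorem tr_neg (g : G) (k : ℤ) : R.tr g (-k) = R.tr g k := by
  rw [tr, _root_.zpow_neg, ← R.form, Matrix.trace_mul_comm, ← mul_assoc, R.inv_mul, one_mul,
    Matrix.trace_transpose]
  rfl

theorem tr_natAbs (g : G) (k : ℤ) : R.tr g k.natAbs = R.tr g k := by
  rcases Int.natAbs_eq k with h | h
  · rw [← h]
  · conv_rhs => rw [h, tr_neg]

theorem continuous_M_pow (k : ℕ) : Continuous fun g => R.M g ^ k := R.continuous_M.pow k

theorem continuous_tr (k : ℕ) : Continuous fun g => R.tr g k := by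
  simp only [tr_natCast]
  exact (R.continuous_M_pow k).matrix_trace

/-- Self-adjointness moves the projection from the generator to the power, which becomes `M (g ^ k)
- M (g ^ (-k))`. The merging identity then gives four traces, equal in pairs by `tr_neg`, whence `8`
in place of `4`. -/
theorem sum_trace_gen (g : G) (j k : ℕ) :
    ∑ a, (R.gen a * R.M g ^ j).trace * (R.gen a * R.M g ^ k).trace =
      -8 * (R.tr g (j + k : ℕ) - R.tr g (j - k : ℤ).natAbs) := by
  have h : ∀ k : ℕ, R.M g ^ k - R.S * (R.M g ^ k)ᵀ * R.Sinv =
      R.M (g ^ (k : ℤ)) - R.M (g ^ (-k : ℤ)) := by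
    intro k
    rw [← map_pow, R.form, _root_.zpow_neg, zpow_natCast]
  simp only [trace_gen_mul, h]
  rw [sum_trace_skewUnit_mul_trace]
  simp only [sub_mul, mul_sub, ← map_mul, ← _root_.zpow_add, Matrix.trace_sub]
  have h2 : ∀ k, (R.M (g ^ k)).trace = R.tr g k := fun k => rfl
  simp only [h2, tr_natAbs]
  have h3 : R.tr g (-(j : ℤ) + -(k : ℤ)) = R.tr g (j + k) := by
    rw [← tr_neg]
    congr 1
    ring
  have h4 : R.tr g (-(j : ℤ) + k) = R.tr g (j - k) := by
    rw [← tr_neg]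
    congr 1
    ring
  rw [h3, h4, ← sub_eq_add_neg]
  push_cast
  ring

/-- Each generator is a skew unit minus its image under `X ↦ S Xᵀ S⁻¹`. Of the four products, two
split the trace and the two mixed ones give the transposed identity, where `Sᵀ = η S` brings in `η`.
-/
theorem sum_trace_gen_mul_gen (A B : Matrix n n ℂ) :
    ∑ a, (R.gen a * A * R.gen a * B).trace = -8 * (A.trace * B.trace) +
      4 * R.η * ((R.S * Aᵀ * R.Sinv * B).trace + (R.S * Bᵀ * R.Sinv * A).trace) := by
  have h : ∀ a, (R.gen a * A * R.gen a * B).trace =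
      (skewUnit a * A * skewUnit a * B).trace
      - (skewUnit a * (A * R.S) * (skewUnit a)ᵀ * (R.Sinv * B)).trace
      - (skewUnit a * (B * R.S) * (skewUnit a)ᵀ * (R.Sinv * A)).trace
      + (skewUnit a * (R.Sinv * A * R.S)ᵀ * skewUnit a * (R.Sinv * B * R.S)ᵀ).trace := by
    intro a
    have e1 : (skewUnit a * (B * R.S) * (skewUnit a)ᵀ * (R.Sinv * A)).trace =
        (R.S * (skewUnit a)ᵀ * R.Sinv * A * skewUnit a * B).trace := by
      rw [← mul_assoc (skewUnit a) B, mul_assoc (skewUnit a * B), mul_assoc (skewUnit a * B),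
        Matrix.trace_mul_comm]
      simp only [mul_assoc]
    have e2 : (skewUnit a * (R.Sinv * A * R.S)ᵀ * skewUnit a * (R.Sinv * B * R.S)ᵀ).trace =
        (R.S * (skewUnit a)ᵀ * R.Sinv * A * (R.S * (skewUnit a)ᵀ * R.Sinv) * B).trace := by
      rw [← Matrix.trace_transpose]
      simp only [Matrix.transpose_mul _ (skewUnit a), Matrix.transpose_mul (skewUnit a),
        Matrix.transpose_mul _ ((R.Sinv * B * R.S)ᵀ), Matrix.transpose_transpose]
      rw [mul_assoc R.Sinv, mul_assoc R.Sinv, Matrix.trace_mul_comm R.Sinv] 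
      rw [mul_assoc, mul_assoc, Matrix.trace_mul_comm]
      simp only [mul_assoc]
    rw [e1, e2]
    simp only [gen, sub_mul, mul_sub, Matrix.trace_sub, mul_assoc]
    ring
  have h2 : ∀ A B : Matrix n n ℂ, ((A * R.S)ᵀ * (R.Sinv * B)).trace =
      R.η * (R.S * Aᵀ * R.Sinv * B).trace := by
    intro A B
    rw [Matrix.transpose_mul, R.transpose_S]
    simp only [Matrix.smul_mul, Matrix.trace_smul, smul_eq_mul, mul_assoc]
  have h3 : ∀ A : Matrix n n ℂ, (R.Sinv * A * R.S).trace = A.trace := by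
    intro A
    rw [Matrix.trace_mul_comm, ← mul_assoc, R.mul_inv, one_mul]
  simp only [h, Finset.sum_add_distrib, Finset.sum_sub_distrib,
    sum_trace_skewUnit_mul_skewUnit_mul, sum_trace_skewUnit_mul_transpose_mul, h2,
    Matrix.trace_transpose, h3]
  ring

theorem hasMatrixDerivAt_flow (a : Bool × n × n) (g : G) :
    HasMatrixDerivAt (fun t => R.M (R.flow a t * g)) (R.gen a * R.M g) 0 := by
  simp only [map_mul, R.flow_eq]
  exact hasMatrixDerivAt_exp _ _

theorem flow_zero_mul (a : Bool × n × n) (g : G) : R.M (R.flow a 0 * g) = R.M g := by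
  simp [R.flow_eq]

/-- The field is `∑ (k/8) tr (X_a M^k) X_a` with the projected generators. In the mixed terms `S (M
g ^ r)ᵀ S⁻¹` is an inverse power, so they become `η` times the trace of index `2r - k`; this matches
`ensembleJ` for `η = 1 - 2s`. -/
theorem loop [IsTopologicalGroup G] [CompactSpace G] [MeasurableSpace G] [BorelSpace G]
    {N s : ℕ} (hs : R.η = 1 - 2 * s) (k : ℕ) (F : MvPolynomial ℕ ℂ) :
    ∫ g, eval (fun j : ℕ => R.tr g j) ((ensembleJ N s).c k * F +
      mkDerivation ℂ ((ensembleJ N s).Γ k) F) ∂(haarProb G) = 0 := by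
  have hgen : ∀ a (j : ℕ), Continuous fun g => (R.gen a * R.M g ^ j).trace := fun a j =>
    (continuous_const.matrix_mul (R.continuous_M_pow j)).matrix_trace
  refine haar_loop (p := fun g (j : ℕ) => R.tr g j) R.continuous_tr R.flow_add
    (p' := fun a j g => j * (R.gen a * R.M g ^ j).trace)
    (fun a j => continuous_const.mul (hgen a j)) (fun a j g => ?_)
    (f := fun a g => k / 8 * (R.gen a * R.M g ^ k).trace)
    (f' := fun a g => k / 8 * ∑ r ∈ Finset.range k,
      (R.gen a * R.M g ^ r * R.gen a * R.M g ^ (k - r)).trace)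
    (fun a => continuous_const.mul (hgen a k))
    (fun a => continuous_const.mul (continuous_finsetSum _ fun r _ =>
      (((continuous_const.matrix_mul (R.continuous_M_pow r)).matrix_mul
        continuous_const).matrix_mul (R.continuous_M_pow (k - r))).matrix_trace))
    (fun a g => ?_) (fun g => ?_) (fun j g => ?_) F
  · simp only [tr_natCast]
    exact hasDerivAt_trace_pow (R.hasMatrixDerivAt_flow a g) (R.flow_zero_mul a g) j
  · exact (hasDerivAt_trace_mul_pow (R.hasMatrixDerivAt_flow a g)
      (R.flow_zero_mul a g) k).const_mul _
  · rw [← Finset.mul_sum, Finset.sum_comm]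
    have h : ∀ r ∈ Finset.range k, ∑ a, (R.gen a * R.M g ^ r * R.gen a * R.M g ^ (k - r)).trace =
        -8 * (R.tr g r * R.tr g (k - r : ℕ) - (1 - 2 * s) * R.tr g (2 * r - k : ℤ).natAbs) := by
      intro r hr
      have hr' := (Finset.mem_range.1 hr).le
      rw [sum_trace_gen_mul_gen, ← map_pow, ← map_pow, R.form, R.form, ← map_mul, ← map_mul, ← hs]
      have h1 : (g ^ r)⁻¹ * g ^ (k - r) = g ^ (-(2 * r - k : ℤ)) := by
        rw [← zpow_natCast, ← zpow_natCast, ← _root_.zpow_neg, ← _root_.zpow_add]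
        congr 1
        push_cast [Nat.cast_sub hr']
        ring
      have h2 : (g ^ (k - r))⁻¹ * g ^ r = g ^ (2 * r - k : ℤ) := by
        rw [← zpow_natCast, ← zpow_natCast, ← _root_.zpow_neg, ← _root_.zpow_add]
        congr 1
        push_cast [Nat.cast_sub hr']
        ring
      have h3 : ∀ k, (R.M (g ^ k)).trace = R.tr g k := fun k => rfl
      have h4 : ∀ k : ℕ, (R.M (g ^ k)).trace = R.tr g k := fun k => by
        rw [← h3, zpow_natCast]
      rw [h1, h2, h3, h3, h4, h4, tr_neg, tr_natAbs]
      ring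
    rw [Finset.sum_congr rfl h, ← Finset.mul_sum]
    simp only [ensembleJ, map_mul, map_neg, map_sum, map_sub, eval_C, eval_X]
    ring
  · have : ∀ a, (k : ℂ) / 8 * (R.gen a * R.M g ^ k).trace * (j * (R.gen a * R.M g ^ j).trace) =
        k * j / 8 * ((R.gen a * R.M g ^ k).trace * (R.gen a * R.M g ^ j).trace) := fun a => by ring
    simp only [this]
    rw [← Finset.mul_sum, sum_trace_gen]
    simp only [ensembleJ, map_mul, map_sub, eval_C, eval_X]
    ring

/-- `M g⁻¹` has the characteristic polynomial of `M g`, being similar to its transpose. It also has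
the conjugate polynomial, being the adjoint of `M g`. -/
theorem roots_map_conj (g : G) : (R.M g).charpoly.roots.map (starRingEnd ℂ) =
    (R.M g).charpoly.roots := by
  have h1 : (R.M g⁻¹).charpoly = (R.M g).charpoly := by
    rw [← R.form]
    have := Matrix.charpoly_units_conj (⟨R.S, R.Sinv, R.mul_inv, R.inv_mul⟩ : (Matrix n n ℂ)ˣ)
      (R.M g)ᵀ
    rwa [Matrix.charpoly_transpose, Matrix.inv_eq_right_inv R.mul_inv] at this
  have h2 : R.M g⁻¹ = (R.M g)ᴴ := by
    have h3 := Matrix.mem_unitaryGroup_iff.1 (R.unitary g)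
    have h4 : R.M g⁻¹ * R.M g = 1 := by rw [← map_mul, inv_mul_cancel, map_one]
    exact left_inv_eq_right_inv h4 h3
  have h5 : (R.M g)ᴴ.charpoly = (R.M g).charpoly.map (starRingEnd ℂ) := by
    rw [← Matrix.charpoly_map, ← Matrix.charpoly_transpose]
    rfl
  have h6 : (R.M g).charpoly = (R.M g).charpoly.map (starRingEnd ℂ) := by rw [← h5, ← h2, h1]
  conv_rhs => rw [h6]
  exact Polynomial.roots_map_of_injective_of_card_eq_natDegree (starRingEnd ℂ).injective
    (by rw [card_roots_charpoly, Matrix.charpoly_natDegree_eq_dim])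

end FormGroup

end BoseGas
end

noncomputable section
namespace BoseGas

/-! ### Eigenvalues in conjugate pairs -/

theorem eq_one_or_neg_one_of_im_eq_zero {u : ℂ} (hu : ‖u‖ = 1) (h : u.im = 0) :
    u = 1 ∨ u = -1 := by
  have h1 := Complex.normSq_eq_norm_sq u
  rw [hu, Complex.normSq_apply, h] at h1
  have h2 : u.re = 1 ∨ u.re = -1 := mul_self_eq_one_iff.1 (by simpa using h1)
  rcases h2 with h2 | h2
  · exact Or.inl (Complex.ext h2 h)
  · exact Or.inr (Complex.ext h2 (by simp [h]))

theorem exp_arg_mul_I {u : ℂ} (hu : ‖u‖ = 1) : Complex.exp (u.arg * Complex.I) = u := by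
  have := Complex.norm_mul_exp_arg_mul_I u
  rwa [hu, Complex.ofReal_one, one_mul] at this

/-- The pair angles of a multiset of complex numbers. -/
def anglesOfRoots (R : Multiset ℂ) : Multiset ℝ :=
  (R.filter fun z => 0 < z.im).map Complex.arg + Multiset.replicate (R.count 1 / 2) 0 +
    Multiset.replicate (R.count (-1) / 2) Real.pi

theorem anglesOfRoots_mem {R : Multiset ℂ} {θ : ℝ} (h : θ ∈ anglesOfRoots R) :
    θ ∈ Set.Icc 0 Real.pi := by
  simp only [anglesOfRoots, Multiset.mem_add, Multiset.mem_map, Multiset.mem_filter] at h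
  rcases h with (⟨u, ⟨_, hu⟩, rfl⟩ | h) | h
  · exact ⟨Complex.arg_nonneg_iff.2 hu.le, Complex.arg_le_pi u⟩
  · rw [Multiset.eq_of_mem_replicate h]
    exact ⟨le_rfl, Real.pi_pos.le⟩
  · rw [Multiset.eq_of_mem_replicate h]
    exact ⟨Real.pi_pos.le, le_rfl⟩

theorem roots_eq_of_conj {R : Multiset ℂ} (h1 : ∀ u ∈ R, ‖u‖ = 1)
    (hc : R.map (starRingEnd ℂ) = R) : R = (R.filter fun z => 0 < z.im) +
      (R.filter fun z => 0 < z.im).map (starRingEnd ℂ) + Multiset.replicate (R.count 1) 1 +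
        Multiset.replicate (R.count (-1)) (-1) := by
  have e1 : (R.filter fun z => 0 < z.im).map (starRingEnd ℂ) = R.filter fun z => z.im < 0 := by
    conv_rhs => rw [← hc, Multiset.filter_map]
    congr 1
    refine Multiset.filter_congr fun z _ => ?_
    simp
  have e2 : R.filter (fun z => z.im = 0) =
      Multiset.replicate (R.count 1) 1 + Multiset.replicate (R.count (-1)) (-1) := by
    rw [← Multiset.filter_eq', ← Multiset.filter_eq', Multiset.filter_add_filter]
    have e3 : R.filter (fun z => z = 1 ∧ z = -1) = 0 := by
      rw [Multiset.filter_eq_nil]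
      rintro z _ ⟨h2, h3⟩
      rw [h2] at h3
      norm_num [Complex.ext_iff] at h3
    rw [e3, add_zero]
    refine Multiset.filter_congr fun z hz => ⟨eq_one_or_neg_one_of_im_eq_zero (h1 z hz), ?_⟩
    rintro (rfl | rfl) <;> simp
  have e4 : R.filter (fun z => ¬ 0 < z.im) =
      (R.filter fun z => z.im < 0) + R.filter (fun z => z.im = 0) := by
    rw [Multiset.filter_add_filter]
    have e3 : R.filter (fun z => z.im < 0 ∧ z.im = 0) = 0 := by
      rw [Multiset.filter_eq_nil]
      rintro z _ ⟨h2, h3⟩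
      exact h2.ne h3
    rw [e3, add_zero]
    refine Multiset.filter_congr fun z _ => ?_
    rw [not_lt, le_iff_lt_or_eq]
  conv_lhs => rw [← Multiset.filter_add_not (fun z : ℂ => 0 < z.im) R]
  rw [e4, e2, ← e1, add_assoc, add_assoc]

/-- Non-real roots multiply to one in conjugate pairs, so the total product is `-1` to the
multiplicity of `-1`. -/
theorem even_count_of_prod_eq_one {R : Multiset ℂ} (h1 : ∀ u ∈ R, ‖u‖ = 1)
    (hc : R.map (starRingEnd ℂ) = R) (hp : R.prod = 1) : Even (R.count (-1)) := by
  have h := congrArg Multiset.prod (roots_eq_of_conj h1 hc)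
  have h2 : ((R.filter fun z => 0 < z.im).map (starRingEnd ℂ)).prod *
      (R.filter fun z => 0 < z.im).prod = 1 := by
    rw [← Multiset.map_id (R.filter fun z => 0 < z.im), Multiset.map_map, ← Multiset.prod_map_mul]
    refine Multiset.prod_eq_one fun x hx => ?_
    obtain ⟨u, hu, rfl⟩ := Multiset.mem_map.1 hx
    simp only [Function.comp_apply, id]
    rw [mul_comm, Complex.mul_conj, Complex.normSq_eq_norm_sq, h1 u (Multiset.mem_filter.1 hu).1]
    simp
  rw [Multiset.prod_add, Multiset.prod_add, Multiset.prod_add, hp, mul_comm (Multiset.prod _), h2,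
    Multiset.prod_replicate, Multiset.prod_replicate, one_pow, one_mul, one_mul] at h
  by_contra hodd
  rw [(Nat.not_even_iff_odd.1 hodd).neg_one_pow] at h
  norm_num [Complex.ext_iff] at h

theorem even_count_one {R : Multiset ℂ} (h1 : ∀ u ∈ R, ‖u‖ = 1)
    (hc : R.map (starRingEnd ℂ) = R) (hp : R.prod = 1) (hR : Even R.card) :
    Even (R.count 1) := by
  have h := congrArg Multiset.card (roots_eq_of_conj h1 hc)
  have h3 := even_count_of_prod_eq_one h1 hc hp
  simp only [Multiset.card_add, Multiset.card_map, Multiset.card_replicate] at h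
  rw [h] at hR
  generalize R.count 1 = a at *
  generalize R.count (-1) = b at *
  rw [Nat.even_iff] at *
  omega

/-- Product one and even cardinality make the multiplicities of `1` and `-1` even, so halving them
in `anglesOfRoots` loses nothing. -/
theorem roots_eq_angles {R : Multiset ℂ} (h1 : ∀ u ∈ R, ‖u‖ = 1)
    (hc : R.map (starRingEnd ℂ) = R) (hp : R.prod = 1) (hR : Even R.card) :
    R = (anglesOfRoots R).map (fun θ : ℝ => Complex.exp (θ * Complex.I)) +
      (anglesOfRoots R).map (fun θ : ℝ => (starRingEnd ℂ) (Complex.exp (θ * Complex.I))) := by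
  have e0 : ((R.filter fun z => 0 < z.im).map Complex.arg).map
      (fun θ : ℝ => Complex.exp (θ * Complex.I)) = R.filter fun z => 0 < z.im := by
    rw [Multiset.map_map]
    conv_rhs => rw [← Multiset.map_id (R.filter fun z => 0 < z.im)]
    exact Multiset.map_congr rfl fun u hu => exp_arg_mul_I (h1 u (Multiset.mem_filter.1 hu).1)
  have e1 : (anglesOfRoots R).map (fun θ : ℝ => Complex.exp (θ * Complex.I)) =
      (R.filter fun z => 0 < z.im) + Multiset.replicate (R.count 1 / 2) 1 +
        Multiset.replicate (R.count (-1) / 2) (-1) := by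
    rw [anglesOfRoots, Multiset.map_add, Multiset.map_add, e0, Multiset.map_replicate,
      Multiset.map_replicate, Complex.exp_pi_mul_I]
    simp
  have e2 : (anglesOfRoots R).map (fun θ : ℝ => (starRingEnd ℂ) (Complex.exp (θ * Complex.I))) =
      (R.filter fun z => 0 < z.im).map (starRingEnd ℂ) + Multiset.replicate (R.count 1 / 2) 1 +
        Multiset.replicate (R.count (-1) / 2) (-1) := by
    have e3 := Multiset.map_map (starRingEnd ℂ) (fun θ : ℝ => Complex.exp (θ * Complex.I))
      (anglesOfRoots R)
    rw [e1] at e3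
    refine e3.symm.trans ?_
    simp
  have e3 : ∀ (k : ℕ) (z : ℂ), Even k →
      Multiset.replicate k z = Multiset.replicate (k / 2) z + Multiset.replicate (k / 2) z := by
    rintro k z ⟨m, rfl⟩
    rw [← Multiset.replicate_add]
    congr 1
    omega
  rw [e1, e2]
  conv_lhs => rw [roots_eq_of_conj h1 hc, e3 _ _ (even_count_of_prod_eq_one h1 hc hp),
    e3 _ _ (even_count_one h1 hc hp hR)]
  abel

/-! ### Averages over groups preserving a form -/

theorem one_mem_oneParticle_ensembleJ (N s : ℕ) :
    (1 : ℝ → ℂ) ∈ (ensembleJ N s).oneParticle := by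
  have : (1 : ℝ → ℂ) = (1 / 2 : ℂ) • (ensembleJ N s).φ 0 := by
    funext t
    simp [ensembleJ]
  rw [this]
  exact Submodule.smul_mem _ _ (Submodule.subset_span ⟨0, rfl⟩)

theorem mul_mem_oneParticle_ensembleJ (N s j k : ℕ) :
    (ensembleJ N s).φ j * (ensembleJ N s).φ k ∈ (ensembleJ N s).oneParticle := by
  have : (ensembleJ N s).φ j * (ensembleJ N s).φ k =
      (ensembleJ N s).φ (j + k) + (ensembleJ N s).φ (j - k : ℤ).natAbs := by
    funext t
    change ((2 * Real.cos (j * t) : ℝ) : ℂ) * ((2 * Real.cos (k * t) : ℝ) : ℂ) =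
      ((2 * Real.cos ((j + k : ℕ) * t) : ℝ) : ℂ) +
        ((2 * Real.cos ((j - k : ℤ).natAbs * t) : ℝ) : ℂ)
    rw [two_cos_natAbs, ← Complex.ofReal_mul, ← Complex.ofReal_add, two_cos_mul_two_cos]
    congr 1
    push_cast
    ring_nf
  rw [this]
  exact Submodule.add_mem _ (Submodule.subset_span ⟨_, rfl⟩) (Submodule.subset_span ⟨_, rfl⟩)

namespace FormGroup

open MvPolynomial

variable {G n : Type*} [Group G] [TopologicalSpace G] [Fintype n] [DecidableEq n]
  (R : FormGroup G n)

theorem exists_angles {N : ℕ} (hN : Fintype.card n = 2 * N) (s : ℕ) (g : G) : ∃ θ : Fin N → ℝ,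
    θ ∈ cube N 0 Real.pi ∧ ((fun j : ℕ => R.tr g j) = (ensembleJ N s).stat θ) ∧
      pairAngles (R.M g) = Finset.univ.val.map θ := by
  set r := (R.M g).charpoly.roots with hr
  have h1 : ∀ u ∈ r, ‖u‖ = 1 := fun u hu => norm_eq_one_of_mem_roots (R.unitary g) hu
  have hc : r.map (starRingEnd ℂ) = r := R.roots_map_conj g
  have hp : r.prod = 1 := by rw [hr, ← Matrix.det_eq_prod_roots_charpoly, R.det_eq_one]
  have hcard : r.card = 2 * N := by rw [hr, card_roots_charpoly, hN]
  have hroots := roots_eq_angles h1 hc hp (hcard ▸ even_two_mul N)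
  have hpair : pairAngles (R.M g) = anglesOfRoots r := by
    rw [pairAngles, anglesOfRoots, hr]
  have hcN : (anglesOfRoots r).card = N := by
    have := congrArg Multiset.card hroots
    rw [hcard, Multiset.card_add, Multiset.card_map, Multiset.card_map] at this
    omega
  obtain ⟨θ, hθ⟩ := exists_eq_univ_map hcN
  refine ⟨θ, fun l _ => anglesOfRoots_mem (R := r) ?_, ?_, hpair.trans hθ⟩
  · rw [hθ]
    exact Multiset.mem_map_of_mem _ (Finset.mem_univ l)
  · funext j
    change _ = ∑ l, ((2 * Real.cos (j * θ l) : ℝ) : ℂ)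
    rw [tr_natCast, trace_pow_eq_sum_roots, ← hr, hroots, hθ, Multiset.map_map, Multiset.map_map,
      Multiset.map_add, Multiset.map_map, Multiset.map_map, Multiset.sum_add,
      ← Multiset.sum_map_add]
    change ∑ l, _ = _
    refine Finset.sum_congr rfl fun l _ => ?_
    simp only [Function.comp_apply]
    rw [← map_pow, ← Complex.exp_nat_mul, Complex.add_conj, ← mul_assoc, ← Complex.ofReal_natCast,
      ← Complex.ofReal_mul, Complex.exp_ofReal_mul_I_re]

theorem average [IsTopologicalGroup G] [CompactSpace G] [MeasurableSpace G] [BorelSpace G]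
    {N s : ℕ} (hN : Fintype.card n = 2 * N) (hs : R.η = 1 - 2 * s)
    {y : ℝ → ℝ} (hy0 : ∀ t, 0 ≤ y t)
    (hy : (fun t => ((y t ^ 2 : ℝ) : ℂ)) ∈ (ensembleJ N s).oneParticle) :
    Integrable (fun g => ((pairAngles (R.M g)).map y).prod) (haarProb G) ∧
      ∫ x in cube N 0 Real.pi, (∏ l, y (x l)) * weightJ N s x =
        (∫ x in cube N 0 Real.pi, weightJ N s x) *
          ∫ g, ((pairAngles (R.M g)).map y).prod ∂(haarProb G) := by
  choose θ hθ hpθ hpr using R.exists_angles hN s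
  have h : ∀ g, ((pairAngles (R.M g)).map y).prod = ∏ l, y (θ g l) := by
    intro g
    rw [hpr, Multiset.map_map]
    rfl
  simp only [h]
  exact (ensembleJ N s).integral_prod_eq_of_loop (one_mem_oneParticle_ensembleJ N s)
    (mul_mem_oneParticle_ensembleJ N s) (p := fun g (j : ℕ) => R.tr g j) R.continuous_tr
    (R.loop hs) hθ hpθ hy0 hy

end FormGroup

end BoseGas
end

noncomputable section
namespace BoseGas

/-! ### The symplectic and the orthogonal group -/

section Instances

theorem symplectic_mul_J {N : ℕ} (S : SpGroup N) :
    Matrix.J (Fin N) ℂ * (S.1.1)ᵀ * -Matrix.J (Fin N) ℂ = (S⁻¹).1.1 := by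
  have h1 : S.1.1 * Matrix.J (Fin N) ℂ * (S.1.1)ᵀ = Matrix.J (Fin N) ℂ :=
    SymplecticGroup.mem_iff.1 S.2
  have h2 : S.1.1 * (Matrix.J (Fin N) ℂ * (S.1.1)ᵀ * -Matrix.J (Fin N) ℂ) = 1 := by
    rw [← mul_assoc, ← mul_assoc, h1, mul_neg, Matrix.J_squared, neg_neg]
  have h3 : (S⁻¹).1.1 * S.1.1 = 1 := Matrix.UnitaryGroup.star_mul_self S.1
  exact (left_inv_eq_right_inv h3 h2).symm

theorem conjTranspose_J (N : ℕ) : (Matrix.J (Fin N) ℂ)ᴴ = -Matrix.J (Fin N) ℂ := by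
  rw [← Matrix.J_transpose]
  ext i j
  rcases i with i | i <;> rcases j with j | j <;>
    simp [Matrix.J, Matrix.conjTranspose_apply, Matrix.one_apply, apply_ite]

/-- The generators of the symplectic group. -/
def spGen {N : ℕ} (a : Bool × (Fin N ⊕ Fin N) × (Fin N ⊕ Fin N)) :
    Matrix (Fin N ⊕ Fin N) (Fin N ⊕ Fin N) ℂ :=
  skewUnit a - Matrix.J (Fin N) ℂ * (skewUnit a)ᵀ * -Matrix.J (Fin N) ℂ

theorem conjTranspose_spGen {N : ℕ} (a : Bool × (Fin N ⊕ Fin N) × (Fin N ⊕ Fin N)) :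
    (spGen a)ᴴ = -spGen a := by
  have h : ((skewUnit a)ᵀ)ᴴ = -(skewUnit a)ᵀ := by
    rw [← Matrix.transpose_neg, ← conjTranspose_skewUnit]
    rfl
  rw [spGen, Matrix.conjTranspose_sub, Matrix.conjTranspose_mul, Matrix.conjTranspose_mul,
    Matrix.conjTranspose_neg, conjTranspose_J, h, conjTranspose_skewUnit]
  simp only [neg_mul, mul_neg, neg_neg, mul_assoc]
  abel

theorem J_mul_transpose_spGen {N : ℕ} (a : Bool × (Fin N ⊕ Fin N) × (Fin N ⊕ Fin N)) :
    Matrix.J (Fin N) ℂ * (spGen a)ᵀ = -spGen a * Matrix.J (Fin N) ℂ := by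
  have hJ := Matrix.J_squared (Fin N) ℂ
  rw [spGen, Matrix.transpose_sub, Matrix.transpose_mul, Matrix.transpose_mul,
    Matrix.transpose_neg, Matrix.J_transpose, Matrix.transpose_transpose]
  simp only [neg_mul, mul_neg, neg_neg, mul_sub, sub_mul, neg_sub]
  simp only [mul_assoc, hJ]
  simp only [← mul_assoc, hJ, neg_mul, mul_neg, neg_neg, one_mul, mul_one]

/-- Conjugation by `J` sends the transposed generator to its negative, and the exponential commutes
with conjugation and transposition. -/
theorem spGen_exp_mem {N : ℕ} (a : Bool × (Fin N ⊕ Fin N) × (Fin N ⊕ Fin N)) (t : ℝ) :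
    NormedSpace.exp (t • spGen a) ∈ Matrix.symplecticGroup (Fin N) ℂ := by
  rw [SymplecticGroup.mem_iff, mul_assoc, ← Matrix.exp_transpose]
  have hJ := Matrix.J_squared (Fin N) ℂ
  have hu : IsUnit (Matrix.J (Fin N) ℂ) := (Matrix.isUnit_iff_isUnit_det _).2 (Matrix.isUnit_det_J _ _)
  have h := Matrix.exp_conj (Matrix.J (Fin N) ℂ) (t • spGen a)ᵀ hu
  rw [Matrix.J_inv, Matrix.transpose_smul, mul_smul_comm, J_mul_transpose_spGen, smul_mul_assoc,
    mul_assoc (-spGen a), mul_neg, hJ, neg_neg, mul_one, smul_neg] at h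
  have h2 : Matrix.J (Fin N) ℂ * NormedSpace.exp (t • (spGen a)ᵀ) =
      NormedSpace.exp (-(t • spGen a)) * Matrix.J (Fin N) ℂ := by
    rw [h, mul_assoc, neg_mul, hJ, neg_neg, mul_one]
  rw [Matrix.transpose_smul, h2, ← mul_assoc, exp_smul_mul_exp_neg, one_mul]

/-- The symplectic group with its defining representation. -/
def spFormGroup (N : ℕ) : FormGroup (SpGroup N) (Fin N ⊕ Fin N) where
  M := (Matrix.unitaryGroup (Fin N ⊕ Fin N) ℂ).subtype.comp (spSubgroup N).subtype
  continuous_M := continuous_subtype_val.comp continuous_subtype_val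
  S := Matrix.J (Fin N) ℂ
  Sinv := -Matrix.J (Fin N) ℂ
  η := -1
  mul_inv := by rw [mul_neg, Matrix.J_squared, neg_neg]
  transpose_S := by rw [Matrix.J_transpose, neg_smul, one_smul]
  η_sq := by norm_num
  form := symplectic_mul_J
  unitary S := S.1.2
  det_eq_one S := SymplecticGroup.det_eq_one S.2
  flow a t := ⟨⟨_, exp_smul_mem_unitaryGroup (conjTranspose_spGen a) t⟩, spGen_exp_mem a t⟩
  flow_add a s t := Subtype.ext (Subtype.ext (exp_smul_add _ s t))
  flow_eq _ _ := rfl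

/-! ### The special orthogonal group -/

/-- The generators of the orthogonal group. -/
def soGen {n : Type*} [DecidableEq n] (a : Bool × n × n) : Matrix n n ℝ :=
  if a.1 then 0 else Matrix.single a.2.1 a.2.2 2 - Matrix.single a.2.2 a.2.1 2

variable {n : Type*} [Fintype n] [DecidableEq n]

theorem transpose_soGen (a : Bool × n × n) : (soGen a)ᵀ = -soGen a := by
  unfold soGen
  split_ifs
  · simp
  · simp [Matrix.transpose_sub]

/-- Subtracting the transpose annihilates the symmetric units (`z = i`) and doubles the
antisymmetric ones (`z = 1`), so the complex projected generators come from real matrices. -/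
theorem map_soGen (a : Bool × n × n) :
    (soGen a).map Complex.ofReal = skewUnit a - (1 : Matrix n n ℂ) * (skewUnit a)ᵀ * 1 := by
  have h : ∀ (i j : n) (x : ℝ), (Matrix.single i j x).map Complex.ofReal = Matrix.single i j (x : ℂ) := by
    intro i j x
    ext k l
    simp only [Matrix.map_apply, Matrix.single_apply]
    split_ifs <;> simp
  obtain ⟨b, i, j⟩ := a
  rw [one_mul, mul_one]
  cases b
  · have : (soGen (false, i, j)) = Matrix.single i j (2 : ℝ) - Matrix.single j i 2 := by
      simp [soGen]
    rw [this, Matrix.map_sub _ (by simp), h, h]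
    simp only [skewUnit, Matrix.transpose_sub, Matrix.transpose_single]
    ext k l
    simp [Matrix.single_apply]
    split_ifs <;> norm_num
  · have : (soGen (true, i, j)) = 0 := by simp [soGen]
    rw [this]
    simp only [skewUnit, Matrix.transpose_sub, Matrix.transpose_single]
    ext k l
    simp [Matrix.single_apply]
    split_ifs <;> simp

theorem real_exp_smul_add (X : Matrix n n ℝ) (s t : ℝ) :
    NormedSpace.exp ((s + t) • X) = NormedSpace.exp (s • X) * NormedSpace.exp (t • X) := by
  rw [add_smul, Matrix.exp_add_of_commute]
  exact (Commute.refl X).smul_left s |>.smul_right t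

theorem real_exp_smul_mem {X : Matrix n n ℝ} (hX : Xᵀ = -X) (t : ℝ) :
    NormedSpace.exp (t • X) ∈ Matrix.unitaryGroup n ℝ := by
  rw [Matrix.mem_unitaryGroup_iff, Matrix.star_eq_conjTranspose, Matrix.conjTranspose_eq_transpose_of_trivial,
    ← Matrix.exp_transpose, Matrix.transpose_smul, hX, smul_neg, ← neg_smul, ← real_exp_smul_add]
  simp

/-- The exponential is the square of the orthogonal matrix at half the time, so its determinant is
the square of `±1`. -/
theorem det_real_exp_smul {X : Matrix n n ℝ} (hX : Xᵀ = -X) (t : ℝ) :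
    (NormedSpace.exp (t • X)).det = 1 := by
  have h1 : NormedSpace.exp (t • X) = NormedSpace.exp ((t / 2) • X) * NormedSpace.exp ((t / 2) • X) := by
    rw [← real_exp_smul_add, add_halves]
  have h2 := Matrix.mem_unitaryGroup_iff.1 (real_exp_smul_mem hX (t / 2))
  have h3 := congrArg Matrix.det h2
  rw [Matrix.det_mul, Matrix.star_eq_conjTranspose, Matrix.conjTranspose_eq_transpose_of_trivial,
    Matrix.det_transpose, Matrix.det_one] at h3
  rw [h1, Matrix.det_mul, h3]

theorem map_real_exp (X : Matrix n n ℝ) :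
    (NormedSpace.exp X).map Complex.ofReal = NormedSpace.exp (X.map Complex.ofReal) := by
  open scoped Matrix.Norms.Operator in
  have hc : Continuous (Complex.ofRealHom.mapMatrix : Matrix n n ℝ →+* Matrix n n ℂ) :=
    Continuous.matrix_map continuous_id Complex.continuous_ofReal
  exact NormedSpace.map_exp (Complex.ofRealHom.mapMatrix : Matrix n n ℝ →+* Matrix n n ℂ) hc X

/-- The special orthogonal group acting on `ℂ^{2N}`. -/
def soFormGroup (N : ℕ) : FormGroup (OPlusGroup N) (Fin (2 * N)) where
  M := ((Complex.ofRealHom.mapMatrix : Matrix (Fin (2 * N)) (Fin (2 * N)) ℝ →+* _) :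
    Matrix (Fin (2 * N)) (Fin (2 * N)) ℝ →* Matrix (Fin (2 * N)) (Fin (2 * N)) ℂ).comp
      ((Matrix.unitaryGroup (Fin (2 * N)) ℝ).subtype.comp (soSubgroup N).subtype)
  continuous_M := (continuous_subtype_val.comp continuous_subtype_val).matrix_map
    Complex.continuous_ofReal
  S := 1
  Sinv := 1
  η := 1
  mul_inv := one_mul 1
  transpose_S := by simp
  η_sq := one_mul 1
  form R := by
    rw [one_mul, mul_one]
    rfl
  unitary R := by
    rw [Matrix.mem_unitaryGroup_iff]
    have h1 := Matrix.mem_unitaryGroup_iff.1 R.1.2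
    have h2 := congrArg (Complex.ofRealHom.mapMatrix) h1
    rw [map_mul, map_one] at h2
    refine Eq.trans (congrArg _ ?_) h2
    ext i j
    simp [Matrix.star_eq_conjTranspose]
  det_eq_one R := by
    have h : R.1.1.det = 1 := R.2
    have h2 := RingHom.map_det Complex.ofRealHom R.1.1
    rw [h, map_one] at h2
    exact h2.symm
  flow a t := ⟨⟨_, real_exp_smul_mem (transpose_soGen a) t⟩, det_real_exp_smul (transpose_soGen a) t⟩
  flow_add a s t := Subtype.ext (Subtype.ext (real_exp_smul_add _ s t))
  flow_eq a t := by
    rw [← map_soGen]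
    refine (map_real_exp (t • soGen a)).trans (congrArg _ ?_)
    ext i j
    simp

variable {N : ℕ}

theorem symplectic_average {y : ℝ → ℝ} (hy0 : ∀ t, 0 ≤ y t)
    (hy : (fun t => ((y t ^ 2 : ℝ) : ℂ)) ∈ (ensembleJ N 1).oneParticle) :
    Integrable (fun S : SpGroup N => ((anglesSp S).map y).prod) (haarProb (SpGroup N)) ∧
      ∫ x in cube N 0 Real.pi, (∏ l, y (x l)) * weightJ N 1 x =
        (∫ x in cube N 0 Real.pi, weightJ N 1 x) *
          ∫ S : SpGroup N, ((anglesSp S).map y).prod ∂(haarProb (SpGroup N)) :=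
  (spFormGroup N).average (by simp [two_mul]) (by simp [spFormGroup]; norm_num) hy0 hy

theorem orthogonal_average {y : ℝ → ℝ} (hy0 : ∀ t, 0 ≤ y t)
    (hy : (fun t => ((y t ^ 2 : ℝ) : ℂ)) ∈ (ensembleJ N 0).oneParticle) :
    Integrable (fun R : OPlusGroup N => ((anglesO R).map y).prod) (haarProb (OPlusGroup N)) ∧
      ∫ x in cube N 0 Real.pi, (∏ l, y (x l)) * weightJ N 0 x =
        (∫ x in cube N 0 Real.pi, weightJ N 0 x) *
          ∫ R : OPlusGroup N, ((anglesO R).map y).prod ∂(haarProb (OPlusGroup N)) :=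
  (soFormGroup N).average (by simp) (by simp [soFormGroup]) hy0 hy

end Instances

end BoseGas
end

noncomputable section
namespace BoseGas

/-! ### Slater determinants -/

section Slater

variable {𝕜 : Type*} [RCLike 𝕜]

open scoped ComplexConjugate in
/-- The squared norm of a Slater determinant of orthonormal functions. -/
theorem integral_norm_det_sq {N : ℕ} {μ : Measure ℝ} [SigmaFinite μ] {χ : Fin N → ℝ → 𝕜}
    (hint : ∀ j k, Integrable (fun x => conj (χ j x) * χ k x) μ)
    (horth : ∀ j k, ∫ x, conj (χ j x) * χ k x ∂μ = if j = k then 1 else 0) :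
    ∫ x, ‖(Matrix.of fun j k => χ k (x j)).det‖ ^ 2 ∂(Measure.pi fun _ : Fin N => μ) =
      (N.factorial : ℝ) := by
  have hd : ∀ x : Fin N → ℝ, (((‖(Matrix.of fun j k => χ k (x j)).det‖ ^ 2 : ℝ)) : 𝕜) =
      ∑ σ : Equiv.Perm (Fin N), ∑ τ : Equiv.Perm (Fin N),
        ((Equiv.Perm.sign σ : ℤ) : 𝕜) * ((Equiv.Perm.sign τ : ℤ) : 𝕜) *
          ∏ i, (conj (χ (σ i) (x i)) * χ (τ i) (x i)) := by
    intro x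
    have h := RCLike.conj_mul (Matrix.of fun j k => χ k (x j)).det
    push_cast
    rw [← h, ← Matrix.det_transpose, Matrix.det_apply', map_sum, Finset.sum_mul_sum]
    refine Finset.sum_congr rfl fun σ _ => Finset.sum_congr rfl fun τ _ => ?_
    simp only [map_mul, map_prod, Matrix.transpose_apply, Matrix.of_apply, map_intCast,
      Finset.prod_mul_distrib]
    ring
  have hI : ∀ σ τ : Equiv.Perm (Fin N), Integrable (fun x : Fin N → ℝ =>
      ((Equiv.Perm.sign σ : ℤ) : 𝕜) * ((Equiv.Perm.sign τ : ℤ) : 𝕜) *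
        ∏ i, (conj (χ (σ i) (x i)) * χ (τ i) (x i))) (Measure.pi fun _ : Fin N => μ) := fun σ τ =>
    (Integrable.fintype_prod (f := fun i t => conj (χ (σ i) t) * χ (τ i) t)
      fun i => hint _ _).const_mul _
  have hJ : ∀ σ τ : Equiv.Perm (Fin N), ∫ x : Fin N → ℝ,
      ((Equiv.Perm.sign σ : ℤ) : 𝕜) * ((Equiv.Perm.sign τ : ℤ) : 𝕜) *
        ∏ i, (conj (χ (σ i) (x i)) * χ (τ i) (x i)) ∂(Measure.pi fun _ : Fin N => μ) =
      if σ = τ then 1 else 0 := by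
    intro σ τ
    rw [integral_const_mul, integral_fintype_prod_eq_prod
      (f := fun i t => conj (χ (σ i) t) * χ (τ i) t)]
    simp only [horth]
    split_ifs with h
    · subst h
      simp only [if_true, Finset.prod_const_one, mul_one, ← Int.cast_mul]
      rw [← Units.val_mul, Int.units_mul_self]
      simp
    · obtain ⟨i, hi⟩ : ∃ i, σ i ≠ τ i := by
        by_contra! h2
        exact h (Equiv.ext h2)
      rw [Finset.prod_eq_zero (Finset.mem_univ i) (if_neg hi), mul_zero]
  have key : ((∫ x, ‖(Matrix.of fun j k => χ k (x j)).det‖ ^ 2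
      ∂(Measure.pi fun _ : Fin N => μ) : ℝ) : 𝕜) = (N.factorial : 𝕜) := by
    rw [← integral_ofReal]
    simp only [hd]
    rw [integral_finsetSum _ fun σ _ => integrable_finsetSum _ fun τ _ => hI σ τ]
    simp only [fun σ => integral_finsetSum Finset.univ fun τ (_ : τ ∈ Finset.univ) => hI σ τ, hJ]
    simp [Fintype.card_perm]
  exact_mod_cast key

/-- Slater determinants of polynomials in one function are Vandermonde determinants. -/
theorem norm_det_eq_prod {n : ℕ} {P : ℕ → Polynomial 𝕜} (hdeg : ∀ k, (P k).natDegree = k)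
    (hmonic : ∀ k, (P k).Monic) (a : ℝ → 𝕜) (b : ℕ → 𝕜) (z : ℝ → 𝕜) (x : Fin n → ℝ) :
    ‖(Matrix.of fun j k : Fin n => a (x j) * (b k * (P k).eval (z (x j)))).det‖ =
      (∏ j, ‖a (x j)‖) * ((∏ k : Fin n, ‖b k‖) *
        ∏ i, ∏ j ∈ Finset.Ioi i, ‖z (x j) - z (x i)‖) := by
  have h1 := Matrix.det_mul_column (fun j => a (x j))
    (Matrix.of fun j k : Fin n => b k * (P k).eval (z (x j)))
  have h2 := Matrix.det_mul_row (fun k : Fin n => b k)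
    (Matrix.of fun j k : Fin n => (P k).eval (z (x j)))
  simp only [Matrix.of_apply] at h1 h2
  rw [h1, h2, ← Matrix.det_eval_matrixOfPolynomials_eq_det_vandermonde (fun j => z (x j))
    (fun k : Fin n => P k) (fun k => hdeg k) (fun k => hmonic k), Matrix.det_vandermonde]
  simp only [norm_mul, norm_prod]

open scoped ComplexConjugate in
/-- The density matrix for one-particle states `a * b k * P k (z)` with monic polynomials `P k` of
degree `k`, in terms of an average with respect to the `N`-particle weight. -/
theorem densityMatrix_eq_average {N : ℕ} {Ω : Set ℝ} {φ : Fin (N + 1) → ℝ → 𝕜} {χ : Fin N → ℝ → 𝕜}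
    {P : ℕ → Polynomial 𝕜} (hdeg : ∀ k, (P k).natDegree = k) (hmonic : ∀ k, (P k).Monic)
    {a a' : ℝ → 𝕜} {b : ℕ → 𝕜} {z : ℝ → 𝕜} (ha : ∀ x, ‖a' x‖ = ‖a x‖)
    (hφ : ∀ k x, φ k x = a x * (b k * (P k).eval (z x)))
    (hχ : ∀ k x, χ k x = a' x * (b k * (P k).eval (z x)))
    (hint : ∀ j k, IntegrableOn (fun x => conj (χ j x) * χ k x) Ω)
    (horth : ∀ j k, ∫ x in Ω, conj (χ j x) * χ k x = if j = k then 1 else 0)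
    {W : (Fin N → ℝ) → ℝ} (hW : ∀ t, W t =
      (∏ l, ‖a (t l)‖ ^ 2) * ∏ i, ∏ j ∈ Finset.Ioi i, ‖z (t j) - z (t i)‖ ^ 2)
    {x y A : ℝ} (hA : ∫ t in Set.pi Set.univ fun _ : Fin N => Ω,
        (∏ l, (‖z x - z (t l)‖ * ‖z y - z (t l)‖)) * W t =
      (∫ t in Set.pi Set.univ fun _ : Fin N => Ω, W t) * A) :
    densityMatrix Ω (slaterState φ) x y = ‖b N‖ ^ 2 * ‖a x‖ * ‖a y‖ * A := by
  set B : ℝ := ∏ k : Fin N, ‖b k‖ with hB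
  -- Orthonormality evaluates the normalisation integral of `W`. The `N`-particle states `χ` are
  -- separate from `φ` because on the circle the wave numbers depend on the particle number; only a
  -- factor of the same modulus changes.
  have hnorm : B ^ 2 * ∫ t in Set.pi Set.univ fun _ : Fin N => Ω, W t = (N.factorial : ℝ) := by
    have h := integral_norm_det_sq hint horth
    rw [← Measure.restrict_pi_pi, ← integral_const_mul] at *
    rw [← h]
    refine integral_congr_ae (Filter.Eventually.of_forall fun t => ?_)
    simp only [hχ, norm_det_eq_prod hdeg hmonic a' b z, hW, ha]
    simp only [Finset.prod_pow]
    ring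
  -- The Vandermonde product of `x, t_1, …, t_N` separates into the factors containing `x` and the
  -- `N`-point product.
  have hdet : ∀ x t, ‖(Matrix.of fun j k : Fin (N + 1) =>
      φ k ((Fin.cons x t : Fin (N + 1) → ℝ) j)).det‖ = ‖a x‖ * ‖b N‖ * (∏ l, ‖z x - z (t l)‖) *
        (B * ((∏ l, ‖a (t l)‖) * ∏ i, ∏ j ∈ Finset.Ioi i, ‖z (t j) - z (t i)‖)) := by
    intro x t
    simp only [hφ, norm_det_eq_prod hdeg hmonic a b z]
    rw [Fin.prod_univ_succ, Fin.prod_univ_castSucc, Fin.prod_univ_succ (n := N), Fin.prod_Ioi_zero]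
    simp only [Fin.prod_Ioi_succ, Fin.cons_zero, Fin.cons_succ, Fin.val_castSucc, Fin.val_last, hB]
    have : ∀ l, ‖z (t l) - z x‖ = ‖z x - z (t l)‖ := fun l => norm_sub_rev _ _
    simp only [this]
    ring
  have hI : ∀ t, slaterState φ (Fin.cons x t) * slaterState φ (Fin.cons y t) =
      (‖b N‖ ^ 2 * ‖a x‖ * ‖a y‖ * B ^ 2 / ((N + 1).factorial : ℝ)) *
        ((∏ l, (‖z x - z (t l)‖ * ‖z y - z (t l)‖)) * W t) := by
    intro t
    rw [slaterState, slaterState, hdet, hdet, hW, div_mul_div_comm,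
      Real.mul_self_sqrt (Nat.cast_nonneg _)]
    simp only [Finset.prod_pow, Finset.prod_mul_distrib]
    ring
  rw [densityMatrix]
  simp only [hI]
  rw [integral_const_mul, hA]
  have hf : ((N + 1).factorial : ℝ) = ((N + 1 : ℕ) : ℝ) * N.factorial := by
    rw [Nat.factorial_succ]
    push_cast
    ring
  have h1 : ((N + 1 : ℕ) : ℝ) ≠ 0 := by positivity
  have h2 : (N.factorial : ℝ) ≠ 0 := by positivity
  calc _ = ‖b N‖ ^ 2 * ‖a x‖ * ‖a y‖ * A * (((N + 1 : ℕ) : ℝ) *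
        (B ^ 2 * ∫ t in Set.pi Set.univ fun _ : Fin N => Ω, W t) / ((N + 1).factorial : ℝ)) := by
        ring
    _ = _ := by
        rw [hnorm, hf, div_self (by positivity), mul_one]

open scoped Pointwise in
/-- Rescaling of integrals over cubes. -/
theorem integral_cube_comp_mul {N : ℕ} {L b : ℝ} (hL : 0 < L) (hb : 0 < b)
    (f : (Fin N → ℝ) → ℝ) : ∫ t in Set.pi Set.univ fun _ : Fin N => Set.Icc 0 L,
      f (fun l => b / L * t l) = (L / b) ^ N * ∫ t in cube N 0 b, f t := by
  have h := Measure.setIntegral_comp_smul_of_pos (volume : Measure (Fin N → ℝ)) f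
    (Set.pi Set.univ fun _ : Fin N => Set.Icc 0 L) (div_pos hb hL)
  have h2 : (b / L) • (Set.pi Set.univ fun _ : Fin N => Set.Icc 0 L) = cube N 0 b := by
    have hc : 0 < b / L := div_pos hb hL
    ext t
    rw [Set.mem_smul_set_iff_inv_smul_mem₀ hc.ne']
    simp only [cube, Set.mem_univ_pi, Pi.smul_apply, smul_eq_mul, Set.mem_Icc]
    refine forall_congr' fun l => ?_
    rw [inv_mul_eq_div, div_le_iff₀ hc, le_div_iff₀ hc, zero_mul, mul_div_cancel₀ _ hL.ne']
  rw [h2] at h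
  simp only [Module.finrank_fintype_fun_eq_card, Fintype.card_fin, smul_eq_mul] at h
  rw [← inv_div b L, inv_pow]
  exact h

end Slater

end BoseGas
end

noncomputable section
namespace BoseGas

/-! ### The circle -/

section Circle

open scoped ComplexConjugate

theorem norm_exp_sub_exp (s t : ℝ) : ‖Complex.exp (s * Complex.I) - Complex.exp (t * Complex.I)‖ =
    |2 * Real.sin ((s - t) / 2)| := by
  have h : Complex.exp (s * Complex.I) - Complex.exp (t * Complex.I) =
      Complex.exp (t * Complex.I) * (Complex.exp (Complex.I * (s - t : ℝ)) - 1) := by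
    rw [mul_sub, ← Complex.exp_add, mul_one]
    congr 2
    push_cast
    ring
  rw [h, norm_mul, Complex.norm_exp_ofReal_mul_I, one_mul, Complex.norm_exp_I_mul_ofReal_sub_one,
    Real.norm_eq_abs]

theorem chordSq_eq_sq_abs (s t : ℝ) : chordSq s t = |2 * Real.sin ((s - t) / 2)| ^ 2 := by
  rw [sq_abs, chordSq, show s - t = 2 * ((s - t) / 2) by ring, Real.cos_two_mul', Real.cos_sq']
  ring_nf

theorem chordSq_mem_oneParticle (N : ℕ) (α : ℝ) :
    (fun t => ((chordSq α t : ℝ) : ℂ)) ∈ (ensembleU N).oneParticle := by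
  have : (fun t => ((chordSq α t : ℝ) : ℂ)) = (2 : ℂ) • (ensembleU N).φ 0 -
      Complex.exp (α * Complex.I) • (ensembleU N).φ (-1) -
      Complex.exp (-(α * Complex.I)) • (ensembleU N).φ 1 := by
    funext t
    simp only [chordSq, ensembleU, Pi.sub_apply, Pi.smul_apply, smul_eq_mul]
    push_cast
    rw [Complex.cos, ← Complex.exp_add, ← Complex.exp_add]
    simp only [zero_mul, Complex.exp_zero, neg_one_mul, one_mul]
    rw [show ((α : ℂ) - t) * Complex.I = α * Complex.I + -t * Complex.I by ring,
      show -((α : ℂ) - t) * Complex.I = -(α * Complex.I) + t * Complex.I by ring]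
    ring
  rw [this]
  exact sub_mem (sub_mem (Submodule.smul_mem _ _ (Submodule.subset_span ⟨_, rfl⟩))
    (Submodule.smul_mem _ _ (Submodule.subset_span ⟨_, rfl⟩)))
      (Submodule.smul_mem _ _ (Submodule.subset_span ⟨_, rfl⟩))

theorem integral_exp_Icc {L : ℝ} (hL : 0 < L) (m : ℤ) :
    ∫ x in Set.Icc 0 L, Complex.exp (2 * Real.pi * Complex.I * m * x / L) =
      if m = 0 then (L : ℂ) else 0 := by
  rw [integral_Icc_eq_integral_Ioc, ← intervalIntegral.integral_of_le hL.le]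
  have hL' : (L : ℂ) ≠ 0 := by exact_mod_cast hL.ne'
  split_ifs with h
  · simp [h]
  · have hc : 2 * Real.pi * Complex.I * m / L ≠ 0 := by
      simp [h, Real.pi_ne_zero, hL.ne', Complex.I_ne_zero]
    have h1 : ∀ x : ℝ, 2 * Real.pi * Complex.I * m * x / L =
        (2 * Real.pi * Complex.I * m / L) * x := fun x => by ring
    simp only [h1]
    rw [integral_exp_mul_complex hc, div_mul_cancel₀ _ hL',
      show 2 * Real.pi * Complex.I * (m : ℂ) = m * (2 * Real.pi * Complex.I) by ring,
      Complex.exp_int_mul_two_pi_mul_I]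
    simp

theorem conj_phiC_mul {L : ℝ} (hL : 0 < L) (n : ℕ) (j k : Fin n) (x : ℝ) :
    conj (phiC L n j x) * phiC L n k x = (1 / L : ℂ) *
      Complex.exp (2 * Real.pi * Complex.I * ((k : ℕ) - (j : ℕ) : ℤ) * x / L) := by
  have hs : ((1 / √L : ℝ) : ℂ) * ((1 / √L : ℝ) : ℂ) = 1 / L := by
    rw [← Complex.ofReal_mul, div_mul_div_comm, Real.mul_self_sqrt hL.le]
    push_cast
    ring
  rw [phiC, phiC, map_mul, Complex.conj_ofReal, ← Complex.exp_conj, mul_mul_mul_comm, hs,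
    ← Complex.exp_add]
  congr 2
  simp only [map_mul, map_div₀, map_sub, map_natCast, Complex.conj_I, Complex.conj_ofReal, map_one,
    map_ofNat]
  push_cast
  ring

theorem periodic_observableU (L x : ℝ) (t : ℝ) :
    |2 * Real.sin (Real.pi * x / L - (t + 2 * Real.pi) / 2)| *
      |2 * Real.sin ((t + 2 * Real.pi) / 2)| =
    |2 * Real.sin (Real.pi * x / L - t / 2)| * |2 * Real.sin (t / 2)| := by
  rw [show Real.pi * x / L - (t + 2 * Real.pi) / 2 = (Real.pi * x / L - t / 2) - Real.pi by ring,
    show (t + 2 * Real.pi) / 2 = t / 2 + Real.pi by ring, Real.sin_sub_pi, Real.sin_add_pi]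
  simp only [mul_neg, abs_neg]

/-- In the variable `z = e^{2πit/L}` the plane waves are powers of `z` up to a phase, and the scaled
`N`-particle weight is the circular ensemble. -/
theorem circle_average {L : ℝ} (hL : 0 < L) (N : ℕ) (x : ℝ) :
    Integrable (fun U : UGroup N => ((anglesU U).map fun θ =>
      |2 * Real.sin (Real.pi * x / L - θ / 2)| * |2 * Real.sin (θ / 2)|).prod)
      (haarProb (UGroup N)) ∧
    rhoC L N x 0 = 1 / L * ∫ U : UGroup N, ((anglesU U).map fun θ =>
      |2 * Real.sin (Real.pi * x / L - θ / 2)| * |2 * Real.sin (θ / 2)|).prod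
        ∂(haarProb (UGroup N)) := by
  obtain ⟨hI, hA⟩ := unitary_average (N := N)
    (y := fun θ => |2 * Real.sin (Real.pi * x / L - θ / 2)| * |2 * Real.sin (θ / 2)|)
    (periodic_observableU L x) (fun t => by positivity) (by
      -- The squared observable is `|e^{2πix/L} - e^{iθ}|² |1 - e^{iθ}|²`, a trigonometric
      -- polynomial in `θ`.
      have h := (ensembleU N).mul_mem_oneParticle mul_mem_oneParticle_ensembleU
        (chordSq_mem_oneParticle N (2 * Real.pi * x / L)) (chordSq_mem_oneParticle N 0)
      convert h using 1
      funext t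
      simp only [Pi.mul_apply]
      rw [← Complex.ofReal_mul, chordSq_eq_sq_abs, chordSq_eq_sq_abs, ← mul_pow]
      congr 3
      · congr 3
        ring
      · rw [zero_sub, neg_div, Real.sin_neg, mul_neg, abs_neg])
  refine ⟨hI, ?_⟩
  have hL' : (L : ℂ) ≠ 0 := by exact_mod_cast hL.ne'
  have harg : ∀ c : ℝ, ∀ t : ℝ, ‖Complex.exp (((c * t : ℝ) : ℂ) * Complex.I)‖ = 1 := fun c t =>
    Complex.norm_exp_ofReal_mul_I _
  set z : ℝ → ℂ := fun t => Complex.exp (((2 * Real.pi / L * t : ℝ) : ℂ) * Complex.I) with hz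
  have hzn : ∀ s t, ‖z s - z t‖ = |2 * Real.sin ((2 * Real.pi / L * s - 2 * Real.pi / L * t) / 2)| :=
    fun s t => norm_exp_sub_exp _ _
  -- The shift by `(n - 1)/2` of the wave numbers is a phase independent of `k`, so it drops out of
  -- absolute values.
  have hφ : ∀ (n : ℕ) (k : Fin n) (t : ℝ), phiC L n k t =
      Complex.exp (((-(Real.pi * (n - 1) / L) * t : ℝ) : ℂ) * Complex.I) *
        (((1 / √L : ℝ) : ℂ) * (Polynomial.X ^ (k : ℕ) : Polynomial ℂ).eval (z t)) := by
    intro n k t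
    rw [Polynomial.eval_pow, Polynomial.eval_X, hz, ← Complex.exp_nat_mul, mul_left_comm,
      ← Complex.exp_add, phiC]
    congr 2
    push_cast
    field_simp
    ring
  have hcube : ∀ f : (Fin N → ℝ) → ℝ, ∫ t in Set.pi Set.univ fun _ : Fin N => Set.Icc 0 L,
      f (fun l => 2 * Real.pi / L * t l) = (L / (2 * Real.pi)) ^ N *
        ∫ t in cube N 0 (2 * Real.pi), f t :=
    fun f => integral_cube_comp_mul hL Real.two_pi_pos f
  have h := densityMatrix_eq_average (𝕜 := ℂ) (N := N) (Ω := Set.Icc 0 L) (φ := phiC L (N + 1))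
    (χ := phiC L N) (P := fun k => Polynomial.X ^ k) (fun k => Polynomial.natDegree_X_pow k)
    (fun k => Polynomial.monic_X_pow k)
    (a := fun t => Complex.exp (((-(Real.pi * ((N + 1 : ℕ) - 1) / L) * t : ℝ) : ℂ) * Complex.I))
    (a' := fun t => Complex.exp (((-(Real.pi * (N - 1) / L) * t : ℝ) : ℂ) * Complex.I))
    (b := fun _ => ((1 / √L : ℝ) : ℂ)) (z := z) (fun t => by rw [harg, harg])
    (fun k t => hφ (N + 1) k t) (fun k t => hφ N k t)
    (fun j k => by
      simp only [conj_phiC_mul hL]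
      exact (Continuous.integrableOn_Icc (by fun_prop)))
    (fun j k => by
      simp only [conj_phiC_mul hL]
      rw [integral_const_mul, integral_exp_Icc hL]
      have : ((k : ℕ) - (j : ℕ) : ℤ) = 0 ↔ j = k := by
        rw [sub_eq_zero, Nat.cast_inj, Fin.val_inj, eq_comm]
      simp only [this]
      split_ifs
      · rw [one_div, inv_mul_cancel₀ hL']
      · rw [mul_zero])
    (W := fun t => weightU N fun l => 2 * Real.pi / L * t l)
    (fun t => by
      simp only [harg, one_pow, Finset.prod_const_one, one_mul, weightU, chordSq_eq_sq_abs, hzn]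
      refine Finset.prod_congr rfl fun i _ => Finset.prod_congr rfl fun j _ => ?_
      rw [← abs_neg, ← mul_neg, ← Real.sin_neg, ← neg_div, neg_sub])
    (x := x) (y := 0) (A := ∫ U : UGroup N, ((anglesU U).map fun θ =>
      |2 * Real.sin (Real.pi * x / L - θ / 2)| * |2 * Real.sin (θ / 2)|).prod
        ∂(haarProb (UGroup N)))
    (by
      have e : ∀ s : ℝ, ‖z x - z s‖ * ‖z 0 - z s‖ =
          |2 * Real.sin (Real.pi * x / L - 2 * Real.pi / L * s / 2)| *
            |2 * Real.sin (2 * Real.pi / L * s / 2)| := by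
        intro s
        rw [hzn, hzn]
        congr 1
        · congr 3
          ring
        · rw [mul_zero, zero_sub, neg_div, Real.sin_neg, mul_neg, abs_neg]
      simp only [e]
      rw [hcube (fun t => (∏ l, (|2 * Real.sin (Real.pi * x / L - t l / 2)| *
        |2 * Real.sin (t l / 2)|)) * weightU N t), hcube (weightU N), hA]
      ring)
  rw [rhoC, psiC, h, harg, harg, Complex.norm_real, Real.norm_eq_abs, sq_abs, div_pow, one_pow,
    Real.sq_sqrt hL.le, mul_one, mul_one]

end Circle

end BoseGas
end

noncomputable section
namespace BoseGas

/-! ### Dirichlet and Neumann boundary conditions -/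

section Interval

open scoped ComplexConjugate

/-- Serves the three families used below: both kinds of Chebyshev polynomials in `2 cos θ` and the
rescaled Hermite polynomials. The coefficient may depend on the index, which the last two require.
-/
theorem monic_of_rec {R : Type*} [CommRing R] [Nontrivial R] {P : ℕ → Polynomial R} (h0 : P 0 = 1)
    (h1 : P 1 = Polynomial.X) (c : ℕ → R)
    (h : ∀ k, P (k + 2) = Polynomial.X * P (k + 1) - Polynomial.C (c k) * P k) (k : ℕ) :
    (P k).natDegree = k ∧ (P k).Monic := by
  induction k using Nat.strong_induction_on with
  | _ k ih =>
    match k, ih with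
    | 0, _ => rw [h0]; exact ⟨Polynomial.natDegree_one, Polynomial.monic_one⟩
    | 1, _ => rw [h1]; exact ⟨Polynomial.natDegree_X, Polynomial.monic_X⟩
    | k + 2, ih =>
      obtain ⟨d1, m1⟩ := ih (k + 1) (by omega)
      obtain ⟨d0, m0⟩ := ih k (by omega)
      have m2 : (Polynomial.X * P (k + 1)).Monic := Polynomial.monic_X.mul m1
      have d2 : (Polynomial.X * P (k + 1)).natDegree = k + 2 := by
        rw [Polynomial.natDegree_X_mul m1.ne_zero, d1]
      have d3 : (Polynomial.C (c k) * P k).natDegree < (Polynomial.X * P (k + 1)).natDegree := by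
        rw [d2]
        exact (Polynomial.natDegree_C_mul_le _ _).trans_lt (by omega)
      rw [h]
      refine ⟨by rw [Polynomial.natDegree_sub_eq_left_of_natDegree_lt d3, d2], ?_⟩
      exact m2.sub_of_left (Polynomial.degree_lt_degree d3)

theorem cos_sub_mem_oneParticle (N s : ℕ) (α : ℝ) :
    (fun t => (((2 * |Real.cos α - Real.cos t|) ^ 2 : ℝ) : ℂ)) ∈ (ensembleJ N s).oneParticle := by
  have h1 : (fun t => ((2 * Real.cos α - 2 * Real.cos t : ℝ) : ℂ)) ∈
      (ensembleJ N s).oneParticle := by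
    have : (fun t => ((2 * Real.cos α - 2 * Real.cos t : ℝ) : ℂ)) =
        ((2 * Real.cos α : ℝ) : ℂ) • (1 : ℝ → ℂ) - (ensembleJ N s).φ 1 := by
      funext t
      simp [ensembleJ]
    rw [this]
    exact sub_mem (Submodule.smul_mem _ _ (one_mem_oneParticle_ensembleJ N s))
      (Submodule.subset_span ⟨_, rfl⟩)
  have h2 := (ensembleJ N s).mul_mem_oneParticle (mul_mem_oneParticle_ensembleJ N s) h1 h1
  convert h2 using 1
  funext t
  simp only [Pi.mul_apply]
  rw [← Complex.ofReal_mul, mul_pow, sq_abs]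
  congr 1
  ring

theorem observableJ_mem_oneParticle (N s : ℕ) (α β : ℝ) :
    (fun t => (((2 * |Real.cos α - Real.cos t|) * (2 * |Real.cos β - Real.cos t|)) ^ 2 : ℝ) : ℝ → ℂ) ∈
      (ensembleJ N s).oneParticle := by
  have h := (ensembleJ N s).mul_mem_oneParticle (mul_mem_oneParticle_ensembleJ N s)
    (cos_sub_mem_oneParticle N s α) (cos_sub_mem_oneParticle N s β)
  convert h using 1
  funext t
  simp only [Pi.mul_apply]
  rw [← Complex.ofReal_mul, mul_pow]

theorem integral_cos_Icc {L : ℝ} (hL : 0 < L) (m : ℤ) :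
    ∫ x in Set.Icc 0 L, Real.cos (m * (Real.pi / L * x)) = if m = 0 then L else 0 := by
  rw [integral_Icc_eq_integral_Ioc, ← intervalIntegral.integral_of_le hL.le]
  split_ifs with h
  · simp [h]
  · have hc : (m : ℝ) * (Real.pi / L) ≠ 0 := by
      have : (m : ℝ) ≠ 0 := by exact_mod_cast h
      have := Real.pi_ne_zero
      positivity
    simp only [← mul_assoc]
    rw [intervalIntegral.integral_comp_mul_left _ hc, integral_cos, mul_zero, Real.sin_zero,
      sub_zero, mul_assoc, div_mul_cancel₀ _ hL.ne', Real.sin_int_mul_pi, smul_zero]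

theorem integrableOn_cos {L : ℝ} (m : ℤ) :
    IntegrableOn (fun x => Real.cos (m * (Real.pi / L * x))) (Set.Icc 0 L) :=
  Continuous.integrableOn_Icc (by fun_prop)

theorem norm_two_cos_sub (s t : ℝ) :
    ‖2 * Real.cos s - 2 * Real.cos t‖ = 2 * |Real.cos s - Real.cos t| := by
  rw [← mul_sub, norm_mul, Real.norm_eq_abs, Real.norm_eq_abs, abs_two]

theorem norm_two_cos_sub_sq (s t : ℝ) :
    ‖2 * Real.cos t - 2 * Real.cos s‖ ^ 2 = (2 * Real.cos s - 2 * Real.cos t) ^ 2 := by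
  rw [Real.norm_eq_abs, sq_abs]
  ring

/-- The average for states on `[0, L]` that are polynomials in `2 cos (π x / L)`. -/
theorem densityMatrix_interval {L : ℝ} (hL : 0 < L) {N s : ℕ} {φ : ℕ → ℝ → ℝ}
    {P : ℕ → Polynomial ℝ} (hP : ∀ k, (P k).natDegree = k ∧ (P k).Monic) {a : ℝ → ℝ} {b : ℕ → ℝ}
    (hφ : ∀ k x, φ k x = a x * (b k * (P k).eval (2 * Real.cos (Real.pi / L * x))))
    (hφc : ∀ k, Continuous (φ k))
    (horth : ∀ j k, ∫ x in Set.Icc 0 L, φ j x * φ k x = if j = k then 1 else 0) {c : ℝ}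
    (ha : ∀ x, a x ^ 2 = c * ∏ _ : Fin s, (2 * Real.sin (Real.pi / L * x)) ^ 2)
    {x y A : ℝ} (hA : ∫ t in cube N 0 Real.pi,
      (∏ l, ((2 * |Real.cos (Real.pi * x / L) - Real.cos (t l)|) *
        (2 * |Real.cos (Real.pi * y / L) - Real.cos (t l)|))) * weightJ N s t =
      (∫ t in cube N 0 Real.pi, weightJ N s t) * A) :
    densityMatrix (Set.Icc 0 L) (slaterState fun k : Fin (N + 1) => φ k) x y =
      b N ^ 2 * |a x| * |a y| * A := by
  have hcube : ∀ f : (Fin N → ℝ) → ℝ, ∫ t in Set.pi Set.univ fun _ : Fin N => Set.Icc 0 L,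
      f (fun l => Real.pi / L * t l) = (L / Real.pi) ^ N * ∫ t in cube N 0 Real.pi, f t :=
    fun f => integral_cube_comp_mul hL Real.pi_pos f
  have h := densityMatrix_eq_average (𝕜 := ℝ) (N := N) (Ω := Set.Icc 0 L)
    (φ := fun k : Fin (N + 1) => φ k) (χ := fun k : Fin N => φ k) (P := P) (fun k => (hP k).1)
    (fun k => (hP k).2) (a := a) (a' := a) (b := b)
    (z := fun x => 2 * Real.cos (Real.pi / L * x)) (fun _ => rfl) (fun k t => hφ k t)
    (fun k t => hφ k t)
    (fun j k => by
      simp only [conj_trivial]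
      exact ((hφc j).mul (hφc k)).integrableOn_Icc)
    (fun j k => by
      simp only [conj_trivial, horth, Fin.val_inj])
    -- The constant `c` need not be normalised away: the identity `hA` is homogeneous in the weight.
    (W := fun t => c ^ N * weightJ N s fun l => Real.pi / L * t l)
    (fun t => by
      simp only [norm_two_cos_sub_sq, weightJ]
      simp only [Real.norm_eq_abs, sq_abs, ha]
      rw [Finset.prod_mul_distrib, Finset.prod_const, Finset.card_univ, Fintype.card_fin]
      ring)
    (x := x) (y := y) (A := A) (by
      have e : ∀ x s : ℝ, ‖2 * Real.cos (Real.pi / L * x) - 2 * Real.cos (Real.pi / L * s)‖ =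
          2 * |Real.cos (Real.pi * x / L) - Real.cos (Real.pi / L * s)| := by
        intro x s
        rw [norm_two_cos_sub, div_mul_eq_mul_div]
      simp only [e]
      rw [hcube (fun t => (∏ l, ((2 * |Real.cos (Real.pi * x / L) - Real.cos (t l)|) *
        (2 * |Real.cos (Real.pi * y / L) - Real.cos (t l)|))) * (c ^ N * weightJ N s t)),
        hcube (fun t => c ^ N * weightJ N s t)]
      simp only [mul_left_comm _ (c ^ N)]
      rw [integral_const_mul, integral_const_mul, hA]
      ring)
  rw [h, Real.norm_eq_abs, Real.norm_eq_abs, Real.norm_eq_abs, sq_abs]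

/-! ### Chebyshev polynomials and orthonormality on the interval -/

theorem chebyshevS_monic (k : ℕ) : (Polynomial.Chebyshev.S ℝ k).natDegree = k ∧
    (Polynomial.Chebyshev.S ℝ k).Monic := by
  refine monic_of_rec (P := fun k : ℕ => Polynomial.Chebyshev.S ℝ k) (by simp) (by simp)
    (fun _ => 1) (fun k => ?_) k
  push_cast
  rw [Polynomial.Chebyshev.S_add_two, Polynomial.C_1, one_mul]

/-- The polynomials `P` with `P 0 = 1` and `P k (2 cos θ) = 2 cos (k θ)` for `k ≥ 1`. -/
def chebyshevC (k : ℕ) : Polynomial ℝ := if k = 0 then 1 else Polynomial.Chebyshev.C ℝ k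

theorem chebyshevC_monic (k : ℕ) : (chebyshevC k).natDegree = k ∧ (chebyshevC k).Monic := by
  refine monic_of_rec (P := chebyshevC) (by simp [chebyshevC]) (by simp [chebyshevC])
    -- The recursion would start from the Chebyshev value `2` at index zero. Since `1` is put in its
    -- place to be monic, the first coefficient is `2`.
    (fun k => if k = 0 then 2 else 1) (fun k => ?_) k
  rcases Nat.eq_zero_or_pos k with rfl | hk
  · simp [chebyshevC, Polynomial.Chebyshev.C_two, sq]
    rfl
  · simp only [chebyshevC, hk.ne', Nat.add_eq_zero_iff, and_false, if_false, one_ne_zero,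
      OfNat.ofNat_ne_zero]
    push_cast
    rw [Polynomial.Chebyshev.C_add_two, Polynomial.C_1, one_mul]

theorem integral_phiD {L : ℝ} (hL : 0 < L) (j k : ℕ) :
    ∫ x in Set.Icc 0 L, phiD L j x * phiD L k x = if j = k then 1 else 0 := by
  have h : ∀ x, phiD L j x * phiD L k x = (1 / L) *
      (Real.cos ((j - k : ℤ) * (Real.pi / L * x)) -
        Real.cos ((j + k + 2 : ℤ) * (Real.pi / L * x))) := by
    intro x
    have h1 : √(2 / L) * √(2 / L) = 2 / L := Real.mul_self_sqrt (by positivity)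
    rw [phiD, phiD, mul_mul_mul_comm, h1,
      show Real.pi * ((j : ℝ) + 1) * x / L = (j + 1) * (Real.pi / L * x) by ring,
      show Real.pi * ((k : ℝ) + 1) * x / L = (k + 1) * (Real.pi / L * x) by ring]
    push_cast
    rw [show ((j : ℝ) - k) * (Real.pi / L * x) =
      (j + 1) * (Real.pi / L * x) - (k + 1) * (Real.pi / L * x) by ring,
      show ((j : ℝ) + k + 2) * (Real.pi / L * x) =
      (j + 1) * (Real.pi / L * x) + (k + 1) * (Real.pi / L * x) by ring, Real.cos_sub, Real.cos_add]
    ring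
  simp only [h]
  rw [integral_const_mul, integral_sub (integrableOn_cos _) (integrableOn_cos _),
    integral_cos_Icc hL, integral_cos_Icc hL, if_neg (by omega : ¬ (j + k + 2 : ℤ) = 0), sub_zero]
  simp only [sub_eq_zero, Nat.cast_inj]
  split_ifs
  · rw [one_div, inv_mul_cancel₀ hL.ne']
  · rw [mul_zero]

theorem integral_phiN {L : ℝ} (hL : 0 < L) (j k : ℕ) :
    ∫ x in Set.Icc 0 L, phiN L j x * phiN L k x = if j = k then 1 else 0 := by
  have hs : ∀ k x, phiN L k x = (if k = 0 then √(1 / L) else √(2 / L)) *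
      Real.cos (k * (Real.pi / L * x)) := by
    intro k x
    rw [phiN]
    split_ifs with hk
    · simp [hk]
    · congr 2
      ring
  have h : ∀ x, phiN L j x * phiN L k x =
      ((if j = 0 then √(1 / L) else √(2 / L)) * (if k = 0 then √(1 / L) else √(2 / L)) / 2) *
      (Real.cos ((j - k : ℤ) * (Real.pi / L * x)) +
        Real.cos ((j + k : ℤ) * (Real.pi / L * x))) := by
    intro x
    rw [hs, hs]
    push_cast
    rw [sub_mul, add_mul, Real.cos_sub, Real.cos_add]
    ring
  simp only [h]
  rw [integral_const_mul, integral_add (integrableOn_cos _) (integrableOn_cos _),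
    integral_cos_Icc hL, integral_cos_Icc hL]
  have h1 : √(2 / L) * √(2 / L) = 2 / L := Real.mul_self_sqrt (by positivity)
  have h2 : √(1 / L) * √(1 / L) = 1 / L := Real.mul_self_sqrt (by positivity)
  by_cases hjk : j = k
  · subst hjk
    simp only [sub_self, if_true]
    by_cases hj : j = 0
    · simp only [hj, if_true, h2]
      simp
      field_simp
      norm_num
    · rw [if_neg hj, h1, if_neg (by omega)]
      field_simp
      ring
  · rw [if_neg (show ¬ (j - k : ℤ) = 0 by omega), if_neg (show ¬ (j + k : ℤ) = 0 by omega),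
      if_neg hjk]
    simp

theorem dirichlet_average {L : ℝ} (hL : 0 < L) (N : ℕ) {x y : ℝ} (hx : x ∈ Set.Icc 0 L)
    (hy : y ∈ Set.Icc 0 L) :
    Integrable (fun S : SpGroup N => ((anglesSp S).map fun θ =>
      (2 * |Real.cos (Real.pi * x / L) - Real.cos θ|) *
        (2 * |Real.cos (Real.pi * y / L) - Real.cos θ|)).prod) (haarProb (SpGroup N)) ∧
    rhoD L N x y = 2 / L * Real.sin (Real.pi * x / L) * Real.sin (Real.pi * y / L) *
      ∫ S : SpGroup N, ((anglesSp S).map fun θ =>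
        (2 * |Real.cos (Real.pi * x / L) - Real.cos θ|) *
          (2 * |Real.cos (Real.pi * y / L) - Real.cos θ|)).prod ∂(haarProb (SpGroup N)) := by
  obtain ⟨hI, hA⟩ := symplectic_average (N := N) (fun t => by positivity)
    (observableJ_mem_oneParticle N 1 (Real.pi * x / L) (Real.pi * y / L))
  refine ⟨hI, ?_⟩
  have h := densityMatrix_interval hL (N := N) (s := 1) (φ := phiD L) chebyshevS_monic
    (a := fun x => √(2 / L) * Real.sin (Real.pi / L * x)) (b := fun _ => 1)
    (fun k t => by
      rw [one_mul, phiD, mul_assoc (√(2 / L)), mul_comm (Real.sin (Real.pi / L * t)),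
        Polynomial.Chebyshev.S_two_mul_real_cos]
      congr 2
      push_cast
      ring)
    -- `c = 1/(2L)` because `(2/L) sin² = (1/(2L)) (2 sin)²`.
    (fun k => by unfold phiD; fun_prop) (integral_phiD hL) (c := 1 / (2 * L))
    (fun t => by
      rw [mul_pow, Real.sq_sqrt (by positivity)]
      simp
      field_simp)
    hA
  -- On `[0, L]` the sine is non-negative, which removes the absolute values in the prefactor. This
  -- is the only use of the range of `x` and `y`.
  have hsin : ∀ x ∈ Set.Icc 0 L, |√(2 / L) * Real.sin (Real.pi / L * x)| =
      √(2 / L) * Real.sin (Real.pi * x / L) := by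
    intro x hx
    rw [div_mul_eq_mul_div]
    refine abs_of_nonneg (mul_nonneg (Real.sqrt_nonneg _) (Real.sin_nonneg_of_nonneg_of_le_pi ?_ ?_))
    · exact div_nonneg (mul_nonneg Real.pi_pos.le hx.1) hL.le
    · rw [div_le_iff₀ hL]
      exact mul_le_mul_of_nonneg_left hx.2 Real.pi_pos.le
  rw [rhoD, psiD, h, hsin x hx, hsin y hy]
  have h1 : √(2 / L) * √(2 / L) = 2 / L := Real.mul_self_sqrt (by positivity)
  rw [one_pow, one_mul, mul_mul_mul_comm, h1]
  ring

theorem neumann_average {L : ℝ} (hL : 0 < L) {N : ℕ} (hN : 1 ≤ N) (x y : ℝ) :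
    Integrable (fun R : OPlusGroup N => ((anglesO R).map fun θ =>
      (2 * |Real.cos (Real.pi * x / L) - Real.cos θ|) *
        (2 * |Real.cos (Real.pi * y / L) - Real.cos θ|)).prod) (haarProb (OPlusGroup N)) ∧
    rhoN L N x y = 1 / (2 * L) * ∫ R : OPlusGroup N, ((anglesO R).map fun θ =>
      (2 * |Real.cos (Real.pi * x / L) - Real.cos θ|) *
        (2 * |Real.cos (Real.pi * y / L) - Real.cos θ|)).prod ∂(haarProb (OPlusGroup N)) := by
  obtain ⟨hI, hA⟩ := orthogonal_average (N := N) (fun t => by positivity)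
    (observableJ_mem_oneParticle N 0 (Real.pi * x / L) (Real.pi * y / L))
  refine ⟨hI, ?_⟩
  have h := densityMatrix_interval hL (N := N) (s := 0) (φ := phiN L) chebyshevC_monic
    -- For `k ≥ 1` the monic polynomial takes the value `2 cos (kθ)`, hence the half. The prefactor
    -- is `b N ^ 2`, equal to `1/(2L)` for `N ≥ 1` but `1/L` for `N = 0`.
    (a := fun _ => 1) (b := fun k => if k = 0 then √(1 / L) else √(2 / L) / 2)
    (fun k t => by
      rw [one_mul, phiN, chebyshevC]
      split_ifs with hk
      · simp
      · rw [Polynomial.Chebyshev.C_two_mul_real_cos]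
        push_cast
        rw [show Real.pi * (k : ℝ) * t / L = k * (Real.pi / L * t) by ring]
        ring)
    (fun k => by unfold phiN; split_ifs <;> fun_prop) (integral_phiN hL) (c := 1)
    (fun t => by simp) hA
  rw [rhoN, psiN, h, if_neg (by omega), div_pow, Real.sq_sqrt (by positivity), abs_one, mul_one,
    mul_one]
  congr 1
  field_simp

end Interval

end BoseGas
end

noncomputable section
namespace BoseGas

/-! ### Gaussian weights -/

section Gaussian

variable {E : Type*} [NormedAddCommGroup E]

/-- Continuous functions of at most polynomial growth. -/
def PolyBounded (f : E → ℂ) : Prop :=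
  Continuous f ∧ ∃ (C : ℝ) (k : ℕ), 0 ≤ C ∧ ∀ x, ‖f x‖ ≤ C * (1 + ‖x‖) ^ k

namespace PolyBounded

theorem const (z : ℂ) : PolyBounded fun _ : E => z :=
  ⟨continuous_const, ‖z‖, 0, norm_nonneg z, fun x => by simp⟩

theorem add {f g : E → ℂ} (hf : PolyBounded f) (hg : PolyBounded g) :
    PolyBounded fun x => f x + g x := by
  obtain ⟨hfc, C, k, hC, hf⟩ := hf
  obtain ⟨hgc, D, l, hD, hg⟩ := hg
  refine ⟨hfc.add hgc, C + D, k + l, by positivity, fun x => (norm_add_le _ _).trans ?_⟩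
  have h1 : (1 : ℝ) ≤ 1 + ‖x‖ := by linarith [norm_nonneg x]
  rw [add_mul]
  refine add_le_add ((hf x).trans ?_) ((hg x).trans ?_)
  · exact mul_le_mul_of_nonneg_left (pow_le_pow_right₀ h1 (by omega)) hC
  · exact mul_le_mul_of_nonneg_left (pow_le_pow_right₀ h1 (by omega)) hD

theorem mul {f g : E → ℂ} (hf : PolyBounded f) (hg : PolyBounded g) :
    PolyBounded fun x => f x * g x := by
  obtain ⟨hfc, C, k, hC, hf⟩ := hf
  obtain ⟨hgc, D, l, hD, hg⟩ := hg
  refine ⟨hfc.mul hgc, C * D, k + l, by positivity, fun x => ?_⟩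
  rw [norm_mul]
  calc ‖f x‖ * ‖g x‖ ≤ (C * (1 + ‖x‖) ^ k) * (D * (1 + ‖x‖) ^ l) :=
        mul_le_mul (hf x) (hg x) (norm_nonneg _) (by positivity)
    _ = _ := by ring

theorem pow {f : E → ℂ} (hf : PolyBounded f) (m : ℕ) : PolyBounded fun x => f x ^ m := by
  induction m with
  | zero => simpa using const (1 : ℂ)
  | succ m ih => simpa only [pow_succ] using ih.mul hf

theorem sub {f g : E → ℂ} (hf : PolyBounded f) (hg : PolyBounded g) :
    PolyBounded fun x => f x - g x := by
  have h := hf.add ((const (-1)).mul hg)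
  simpa [sub_eq_add_neg] using h

theorem sum {α : Type*} {s : Finset α} {f : α → E → ℂ} (hf : ∀ a ∈ s, PolyBounded (f a)) :
    PolyBounded fun x => ∑ a ∈ s, f a x := by
  classical
  induction s using Finset.induction_on with
  | empty => simpa using const (0 : ℂ)
  | insert a s ha ih =>
    simp only [Finset.sum_insert ha]
    exact (hf a (Finset.mem_insert_self a s)).add
      (ih fun b hb => hf b (Finset.mem_insert_of_mem hb))

theorem linear [NormedSpace ℝ E] (ℓ : E →L[ℝ] ℂ) : PolyBounded ℓ := by
  refine ⟨ℓ.continuous, ‖ℓ‖, 1, norm_nonneg ℓ, fun x => (ℓ.le_opNorm x).trans ?_⟩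
  rw [pow_one]
  exact mul_le_mul_of_nonneg_left (by linarith) (norm_nonneg ℓ)

theorem eval {ι : Type*} {p : E → ι → ℂ} (hp : ∀ j, PolyBounded fun x => p x j)
    (f : MvPolynomial ι ℂ) : PolyBounded fun x => MvPolynomial.eval (p x) f := by
  induction f using MvPolynomial.induction_on with
  | C z => simpa using const z
  | add f g hf hg => simpa only [map_add] using hf.add hg
  | mul_X f k hf => simpa only [map_mul, MvPolynomial.eval_X] using hf.mul (hp k)

end PolyBounded

/-- `(1 + r)^k ≤ k! e^{1+r}` by the exponential series, and completing the square bounds `r - δ r²`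
by `1/(4δ)`. -/
theorem pow_mul_exp_neg_le {δ : ℝ} (hδ : 0 < δ) (k : ℕ) {r : ℝ} (hr : 0 ≤ r) :
    (1 + r) ^ k * Real.exp (-(δ * r ^ 2)) ≤ k.factorial * Real.exp (1 + 1 / (4 * δ)) := by
  have h1 := Real.pow_div_factorial_le_exp (1 + r) (by linarith) k
  rw [div_le_iff₀ (by positivity)] at h1
  have h2 : 1 + r - δ * r ^ 2 ≤ 1 + 1 / (4 * δ) := by
    have : 1 / (4 * δ) - r + δ * r ^ 2 = δ * (r - 1 / (2 * δ)) ^ 2 := by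
      field_simp
      ring
    nlinarith [mul_nonneg hδ.le (sq_nonneg (r - 1 / (2 * δ)))]
  calc _ ≤ (Real.exp (1 + r) * k.factorial) * Real.exp (-(δ * r ^ 2)) := by gcongr
    _ = k.factorial * Real.exp (1 + r - δ * r ^ 2) := by
      rw [sub_eq_add_neg, Real.exp_add (1 + r)]
      ring
    _ ≤ _ := by gcongr

theorem PolyBounded.exists_bound {f : E → ℂ} (hf : PolyBounded f) {q : E → ℝ} {δ : ℝ} (hδ : 0 < δ)
    (hq : ∀ x, δ * ‖x‖ ^ 2 ≤ q x) : ∃ M, ∀ x, ‖f x‖ * Real.exp (-q x) ≤ M := by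
  obtain ⟨hfc, C, k, hC, hf⟩ := hf
  refine ⟨C * (k.factorial * Real.exp (1 + 1 / (4 * δ))), fun x => ?_⟩
  calc _ ≤ (C * (1 + ‖x‖) ^ k) * Real.exp (-(δ * ‖x‖ ^ 2)) := by
        gcongr
        exacts [hf x, hq x]
    _ = C * ((1 + ‖x‖) ^ k * Real.exp (-(δ * ‖x‖ ^ 2))) := by ring
    _ ≤ _ := mul_le_mul_of_nonneg_left (pow_mul_exp_neg_le hδ k (norm_nonneg x)) hC

variable [NormedSpace ℝ E] [FiniteDimensional ℝ E] [MeasurableSpace E] [BorelSpace E] {μ : Measure E}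
  [μ.IsAddHaarMeasure]

/-- The Gaussian factor absorbs both the polynomial growth and a further power `dim E + 1`, so that
the integrable function `(1 + ‖x‖)^{-(dim E + 1)}` dominates. -/
theorem PolyBounded.integrable_mul_exp {f : E → ℂ} (hf : PolyBounded f) {q : E → ℝ}
    (hqc : Continuous q) {δ : ℝ} (hδ : 0 < δ) (hq : ∀ x, δ * ‖x‖ ^ 2 ≤ q x) :
    Integrable (fun x => f x * (Real.exp (-q x) : ℂ)) μ := by
  have hc : Continuous fun x => f x * (Real.exp (-q x) : ℂ) :=
    hf.1.mul (Complex.continuous_ofReal.comp (by fun_prop))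
  obtain ⟨hfc, C, k, hC, hf⟩ := hf
  set d : ℕ := Module.finrank ℝ E + 1 with hd
  have h1 : Integrable (fun x : E => (1 + ‖x‖) ^ (-(d : ℝ))) μ :=
    integrable_one_add_norm (by rw [hd]; push_cast; linarith)
  refine (h1.const_mul (C * ((k + d).factorial * Real.exp (1 + 1 / (4 * δ))))).mono'
    hc.aestronglyMeasurable (Filter.Eventually.of_forall fun x => ?_)
  have hx : 0 < 1 + ‖x‖ := by positivity
  rw [norm_mul, Complex.norm_real, Real.norm_eq_abs, abs_of_pos (Real.exp_pos _),
    Real.rpow_neg hx.le, Real.rpow_natCast]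
  rw [← div_eq_mul_inv, le_div_iff₀ (by positivity)]
  calc _ ≤ (C * (1 + ‖x‖) ^ k) * Real.exp (-(δ * ‖x‖ ^ 2)) * (1 + ‖x‖) ^ d := by
        gcongr
        exacts [hf x, hq x]
    _ = C * ((1 + ‖x‖) ^ (k + d) * Real.exp (-(δ * ‖x‖ ^ 2))) := by ring
    _ ≤ _ := mul_le_mul_of_nonneg_left (pow_mul_exp_neg_le hδ (k + d) (norm_nonneg x)) hC

open MvPolynomial in
/-- Loop equations for Gaussian weights, by partial integration in the directions `v a`. -/
theorem gaussian_loop {ι α : Type*} [Fintype α] {p : E → ι → ℂ}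
    (hp : ∀ j, PolyBounded fun x => p x j) {v : α → E} {p' : α → ι → E → ℂ}
    (hp' : ∀ a j, PolyBounded (p' a j))
    (hpd : ∀ a j x, HasDerivAt (fun t : ℝ => p (x + t • v a) j) (p' a j x) 0)
    {g g' : α → E → ℂ} (hg : ∀ a, PolyBounded (g a)) (hg' : ∀ a, PolyBounded (g' a))
    (hgd : ∀ a x, HasDerivAt (fun t : ℝ => g a (x + t • v a)) (g' a x) 0)
    {q : E → ℝ} (hqc : Continuous q) {δ : ℝ} (hδ : 0 < δ) (hq : ∀ x, δ * ‖x‖ ^ 2 ≤ q x)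
    {q' : α → E → ℝ} (hq' : ∀ a, PolyBounded fun x => (q' a x : ℂ))
    (hqd : ∀ a x, HasDerivAt (fun t : ℝ => q (x + t • v a)) (q' a x) 0)
    {V : E → ℂ} {c : MvPolynomial ι ℂ} {Γ : ι → MvPolynomial ι ℂ}
    (hc : ∀ x, ∑ a, (g' a x - g a x * q' a x) = eval (p x) c * V x)
    (hΓ : ∀ j x, ∑ a, g a x * p' a j x = eval (p x) (Γ j) * V x) (F : MvPolynomial ι ℂ) :
    ∫ x, eval (p x) (c * F + mkDerivation ℂ Γ F) * V x * (Real.exp (-q x) : ℂ) ∂μ = 0 := by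
  let D : α → E → ℂ := fun a x => ∑ j ∈ F.vars, eval (p x) (pderiv j F) * p' a j x
  have hD : ∀ a, PolyBounded (D a) := fun a =>
    PolyBounded.sum fun j _ => (PolyBounded.eval hp _).mul (hp' a j)
  have hF : PolyBounded fun x => eval (p x) F := PolyBounded.eval hp F
  let H : α → E → ℂ := fun a x => g a x * eval (p x) F
  let H' : α → E → ℂ := fun a x =>
    (g' a x - g a x * q' a x) * eval (p x) F + g a x * D a x
  have hH : ∀ a, PolyBounded (H a) := fun a => (hg a).mul hF
  have hH' : ∀ a, PolyBounded (H' a) := fun a =>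
    (((hg' a).sub ((hg a).mul (hq' a))).mul hF).add ((hg a).mul (hD a))
  have hder : ∀ a x, HasLineDerivAt ℝ (fun x => H a x * (Real.exp (-q x) : ℂ))
      (H' a x * (Real.exp (-q x) : ℂ)) x (v a) := by
    intro a x
    have h1 := hasDerivAt_eval_of_vars_subset (p := fun t : ℝ => p (x + t • v a)) (t := 0)
      (fun j => hpd a j x) F.vars (F := F) le_rfl
    have h2 := (((hqd a x).fun_neg).exp).ofReal_comp
    have h3 := ((hgd a x).fun_mul h1).fun_mul h2
    refine h3.congr_deriv ?_
    simp only [zero_smul, add_zero, H', D]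
    push_cast
    ring
  have hI : ∀ a, ∫ x, H' a x * (Real.exp (-q x) : ℂ) ∂μ = 0 := by
    intro a
    -- Partial integration against the constant `1`: the integral of a line derivative is zero.
    have h := integral_bilinear_hasLineDerivAt_right_eq_neg_left_of_integrable (μ := μ)
      (f := fun _ : E => (1 : ℂ)) (f' := fun _ => 0) (g := fun x => H a x * (Real.exp (-q x) : ℂ))
      (g' := fun x => H' a x * (Real.exp (-q x) : ℂ)) (v := v a) (B := ContinuousLinearMap.mul ℝ ℂ)
      (by simp) (by simpa using (hH' a).integrable_mul_exp hqc hδ hq)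
      (by simpa using (hH a).integrable_mul_exp hqc hδ hq)
      (fun x _ => hasDerivAt_const _ _) (fun x _ => hder a x)
    simpa using h
  -- `hc` and `hΓ` carry the density `V` as a factor. Hence `g` may already contain it, and no
  -- division by `V` is needed where it vanishes.
  have h3 : ∀ x, eval (p x) (c * F + mkDerivation ℂ Γ F) * V x = ∑ a, H' a x := by
    intro x
    rw [map_add, map_mul, add_mul, mul_right_comm, ← hc,
      mkDerivation_eq_sum_of_vars_subset Γ F.vars le_rfl, map_sum, Finset.sum_add_distrib,
      Finset.sum_mul, Finset.sum_mul]
    congr 1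
    simp only [D, Finset.mul_sum, map_mul]
    rw [Finset.sum_comm]
    refine Finset.sum_congr rfl fun j _ => ?_
    rw [mul_assoc, ← hΓ, Finset.mul_sum]
    exact Finset.sum_congr rfl fun a _ => by ring
  simp_rw [h3, Finset.sum_mul]
  rw [integral_finsetSum _ fun a _ => (hH' a).integrable_mul_exp hqc hδ hq]
  exact Finset.sum_eq_zero fun a _ => hI a

end Gaussian

/-! ### Uniqueness for the Gaussian loop equations -/

section GaussianUniqueness

open MvPolynomial

/-- The inhomogeneous term of the loop equations for the Gaussian weight. -/
def gaussC (k : ℕ) : MvPolynomial ℕ ℂ := ∑ r ∈ Finset.range k, X r * X (k - 1 - r) - 2 * X (k + 1)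

/-- The derivation of the loop equations for the Gaussian weight. -/
def gaussΓ (k j : ℕ) : MvPolynomial ℕ ℂ := C (j : ℂ) * X (k + j - 1)

/-- The loop equation of index `k`, applied to a monomial `g`, expresses `2 T (X (k+1) * g)` by
polynomials of weight at most that of `g` plus `k - 1`, which is two less. Induction on the weight
reduces everything to `T 1`. -/
theorem eq_zero_of_gaussian_loop {N : ℂ} {T : MvPolynomial ℕ ℂ →ₗ[ℂ] ℂ} (h1 : T 1 = 0)
    (h0 : ∀ f, T (X 0 * f) = N * T f)
    (hloop : ∀ k f, T (gaussC k * f + mkDerivation ℂ (gaussΓ k) f) = 0)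
    (f : MvPolynomial ℕ ℂ) : T f = 0 := by
  have key : ∀ d : ℕ, ∀ f ∈ weightLE (id : ℕ → ℕ) d, T f = 0 := by
    intro d
    induction d using Nat.strong_induction_on with
    | _ d ih =>
      have ih' : ∀ e : ℤ, e < d → ∀ f ∈ weightLE (id : ℕ → ℕ) e, T f = 0 := by
        intro e he f hf
        rcases lt_or_ge e 0 with h | h
        · rw [weightLE_of_neg _ h, Submodule.mem_bot] at hf
          rw [hf, map_zero]
        · obtain ⟨m, rfl⟩ := Int.eq_ofNat_of_zero_le h
          exact ih m (by exact_mod_cast he) f hf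
      intro f hf
      refine Submodule.span_induction (p := fun f _ => T f = 0) ?_ (map_zero T) ?_ ?_ hf
      · rintro _ ⟨s, hs, rfl⟩
        induction s using Multiset.induction_on with
        | empty => simpa using h1
        | cons a s ihs =>
          rw [Multiset.map_cons, Multiset.prod_cons]
          rcases a with _ | k
          -- `X 0` has weight zero, so the induction on the weight does not help. It is removed by
          -- `h0` and the induction on the monomial.
          · rw [h0, ihs (by simpa using hs), mul_zero]
          · have hw : ((k + 1 : ℕ) : ℤ) + (s.map id).sum ≤ d := by simpa using hs
            set g : MvPolynomial ℕ ℂ := (s.map X).prod with hg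
            have hgm : g ∈ weightLE (id : ℕ → ℕ) (s.map id).sum := prod_X_mem_weightLE id s
            have e1 : T ((∑ r ∈ Finset.range k, X r * X (k - 1 - r)) * g) = 0 := by
              refine ih' (k - 1 + (s.map id).sum) (by push_cast at hw ⊢; omega) _
                (mul_mem_weightLE _ (Submodule.sum_mem _ fun r hr => ?_) hgm)
              have hr' := Finset.mem_range.1 hr
              refine weightLE_mono _ ?_ (mul_mem_weightLE _ (X_mem_weightLE (id : ℕ → ℕ) r)
                (X_mem_weightLE (id : ℕ → ℕ) (k - 1 - r)))
              simp only [id]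
              omega
            have e2 : T (mkDerivation ℂ (gaussΓ k) g) = 0 := by
              refine ih' ((s.map id).sum + (k - 1)) (by push_cast at hw ⊢; omega) _
                (derivation_mem_weightLE _ _ (fun j => ?_) hgm)
              rw [mkDerivation_X, gaussΓ, ← smul_eq_C_mul]
              -- For `j = k = 0` the truncated index `k + j - 1` would be too large for the weight
              -- bound, but there the coefficient `j` vanishes.
              rcases Nat.eq_zero_or_pos j with rfl | hj
              · simp
              · refine Submodule.smul_mem _ _ (weightLE_mono _ ?_ (X_mem_weightLE (id : ℕ → ℕ) _))
                simp only [id]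
                omega
            have h := hloop k g
            rw [gaussC, sub_mul, map_add, map_sub, e1, e2, zero_sub, add_zero, neg_eq_zero,
              mul_assoc, two_mul, map_add] at h
            linear_combination h / 2
      · intro x y _ _ hx hy
        rw [map_add, hx, hy, add_zero]
      · intro a x _ hx
        rw [map_smul, hx, smul_zero]
  obtain ⟨d, hd⟩ := exists_mem_weightLE (id : ℕ → ℕ) f
  exact key d.toNat f (weightLE_mono _ (Int.self_le_toNat d) hd)

end GaussianUniqueness

end BoseGas
end

noncomputable section
namespace BoseGas

/-! ### The eigenvalue density of the Gaussian unitary ensemble -/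

section GaussianEigenvalues

open MvPolynomial

variable {N : ℕ}

/-- The evaluation of polynomials at real points. -/
def evalReal (f : MvPolynomial (Fin N) ℂ) (t : Fin N → ℝ) : ℂ := eval (fun l => (t l : ℂ)) f

theorem polyBounded_evalReal (f : MvPolynomial (Fin N) ℂ) : PolyBounded (evalReal f) :=
  PolyBounded.eval (p := fun (t : Fin N → ℝ) l => (t l : ℂ)) (fun l => PolyBounded.linear
    (Complex.ofRealCLM.comp (ContinuousLinearMap.proj l : (Fin N → ℝ) →L[ℝ] ℝ))) f

theorem hasDerivAt_evalReal (f : MvPolynomial (Fin N) ℂ) (l : Fin N) (t : Fin N → ℝ) :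
    HasDerivAt (fun s : ℝ => evalReal f (t + s • Pi.single l 1)) (evalReal (pderiv l f) t) 0 := by
  have h := hasDerivAt_eval_of_vars_subset (F := f) (t := (0 : ℝ))
    (p := fun (s : ℝ) (m : Fin N) => (((t + s • (Pi.single l 1 : Fin N → ℝ)) m : ℝ) : ℂ))
    (p' := fun m => (((Pi.single l 1 : Fin N → ℝ) m : ℝ) : ℂ)) (fun m => by
      refine HasDerivAt.ofReal_comp ?_
      simp only [Pi.add_apply, Pi.smul_apply, smul_eq_mul]
      simpa using ((hasDerivAt_id (0 : ℝ)).mul_const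
        ((Pi.single l 1 : Fin N → ℝ) m)).const_add (t m)) Finset.univ (Finset.subset_univ _)
  refine h.congr_deriv ?_
  rw [Finset.sum_eq_single l]
  · simp [evalReal]
  · intro m _ hm
    simp [hm]
  · simp

/-- The squared Vandermonde determinant. -/
def vandermondeSq (N : ℕ) : MvPolynomial (Fin N) ℂ :=
  ∏ i, ∏ j ∈ Finset.Ioi i, (X j - X i) ^ 2

theorem derivation_prod_eq {R A ι : Type*} [CommRing R] [CommRing A] [Algebra R A]
    (D : Derivation R A A) (s : Finset ι) {w a : ι → A} (h : ∀ i ∈ s, D (w i) = a i * w i) :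
    D (∏ i ∈ s, w i) = (∑ i ∈ s, a i) * ∏ i ∈ s, w i := by
  classical
  induction s using Finset.induction_on with
  | empty => simp
  | insert b s hb ih =>
    rw [Finset.prod_insert hb, Finset.sum_insert hb, D.leibniz,
      ih fun i hi => h i (Finset.mem_insert_of_mem hi), h b (Finset.mem_insert_self b s)]
    simp only [smul_eq_mul]
    ring

/-- Along `∑ x_l^k ∂_l` the factor `(x_j - x_i)²` has logarithmic derivative `2 (x_j^k - x_i^k) /
(x_j - x_i)`, a geometric sum. -/
theorem sum_pow_mul_pderiv_vandermondeSq (k : ℕ) :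
    ∑ l, X l ^ k * pderiv l (vandermondeSq N) =
      (∑ i, ∑ j ∈ Finset.Ioi i, 2 * ∑ r ∈ Finset.range k, X j ^ r * X i ^ (k - 1 - r)) *
        vandermondeSq N := by
  have h1 : ∀ f : MvPolynomial (Fin N) ℂ, ∑ l, X l ^ k * pderiv l f =
      mkDerivation ℂ (fun l => (X l : MvPolynomial (Fin N) ℂ) ^ k) f := by
    intro f
    have h2 : mkDerivation ℂ (fun l => (X l : MvPolynomial (Fin N) ℂ) ^ k) =
        ∑ l, (X l : MvPolynomial (Fin N) ℂ) ^ k • pderiv l := by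
      refine MvPolynomial.derivation_ext fun m => ?_
      rw [mkDerivation_X, derivation_sum_apply, Finset.sum_eq_single m]
      · simp
      · intro l _ hl
        simp [pderiv_X_of_ne hl.symm]
      · simp
    rw [h2, derivation_sum_apply]
    simp
  rw [h1, vandermondeSq]
  refine derivation_prod_eq _ _ fun i _ => derivation_prod_eq _ _ fun j _ => ?_
  rw [Derivation.leibniz_pow, map_sub, mkDerivation_X, mkDerivation_X,
    ← (Commute.all (X j : MvPolynomial (Fin N) ℂ) (X i)).geom_sum₂_mul]
  simp only [smul_eq_mul, nsmul_eq_mul]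
  push_cast
  ring

/-- The divergence `k x_l^{k-1}` of the field supplies the diagonal missing from the sum over pairs,
which completes it to products of power sums. -/
theorem sum_pderiv_pow_mul_vandermondeSq (k : ℕ) :
    ∑ l, pderiv l (X l ^ k * vandermondeSq N) =
      (∑ r ∈ Finset.range k, (∑ l, X l ^ r) * ∑ l, X l ^ (k - 1 - r)) * vandermondeSq N := by
  have h1 : ∀ l : Fin N, pderiv l (X l ^ k * vandermondeSq N) =
      X l ^ k * pderiv l (vandermondeSq N) +
        ((k : MvPolynomial (Fin N) ℂ) * X l ^ (k - 1)) * vandermondeSq N := by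
    intro l
    rw [Derivation.leibniz, Derivation.leibniz_pow, pderiv_X_self]
    simp only [smul_eq_mul, nsmul_eq_mul]
    ring
  simp only [h1]
  rw [Finset.sum_add_distrib, sum_pow_mul_pderiv_vandermondeSq, ← Finset.sum_mul, ← add_mul]
  congr 1
  set h : Fin N → Fin N → MvPolynomial (Fin N) ℂ := fun i j =>
    ∑ r ∈ Finset.range k, X j ^ r * X i ^ (k - 1 - r) with hh
  have hsymm : ∀ i j, h i j = h j i := by
    intro i j
    simp only [hh]
    rw [← Finset.sum_range_reflect]
    refine Finset.sum_congr rfl fun r hr => ?_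
    have := Finset.mem_range.1 hr
    rw [show k - 1 - (k - 1 - r) = r by omega, mul_comm]
  have hdiag : ∀ l : Fin N, (k : MvPolynomial (Fin N) ℂ) * X l ^ (k - 1) = h l l := by
    intro l
    simp only [hh]
    rw [Finset.sum_congr rfl (g := fun _ => (X l : MvPolynomial (Fin N) ℂ) ^ (k - 1))]
    · simp
    · intro r hr
      have := Finset.mem_range.1 hr
      rw [← pow_add]
      congr 1
      omega
  have hfull : (∑ r ∈ Finset.range k, (∑ l : Fin N, (X l : MvPolynomial (Fin N) ℂ) ^ r) *
      ∑ l, X l ^ (k - 1 - r)) = ∑ i, ∑ j, h j i := by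
    simp only [hh, Finset.sum_mul_sum]
    rw [Finset.sum_comm]
    refine Finset.sum_congr rfl fun i _ => ?_
    rw [Finset.sum_comm]
  have hoff := Finset.sum_sum_Ioi_add_eq_sum_sum_off_diag h
  rw [hfull]
  calc _ = (∑ i, ∑ j ∈ Finset.Ioi i, (h j i + h i j)) + ∑ l, h l l := by
        congr 1
        · refine Finset.sum_congr rfl fun i _ => Finset.sum_congr rfl fun j _ => ?_
          rw [hsymm j i, two_mul]
        · exact Finset.sum_congr rfl fun l _ => hdiag l
    _ = ∑ i, ∑ j, h j i := by
        rw [hoff, ← Finset.sum_add_distrib]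
        refine Finset.sum_congr rfl fun i _ => ?_
        rw [← Finset.sum_compl_add_sum {i}]
        simp

/-- The power sums of a real configuration. -/
def powerSum (t : Fin N → ℝ) (k : ℕ) : ℂ := ∑ l, (t l : ℂ) ^ k

theorem powerSum_eq (t : Fin N → ℝ) (k : ℕ) :
    powerSum t k = evalReal (∑ l, X l ^ k) t := by
  simp [powerSum, evalReal]

theorem polyBounded_powerSum (k : ℕ) : PolyBounded fun t : Fin N → ℝ => powerSum t k := by
  simp only [powerSum_eq]
  exact polyBounded_evalReal _

/-- The sum of the squares. -/
def sumSq (t : Fin N → ℝ) : ℝ := ∑ l, t l ^ 2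

theorem continuous_sumSq : Continuous (sumSq (N := N)) := by
  unfold sumSq
  fun_prop

theorem norm_sq_le_sumSq (t : Fin N → ℝ) : ‖t‖ ^ 2 ≤ sumSq t := by
  have h0 : 0 ≤ sumSq t := Finset.sum_nonneg fun l _ => sq_nonneg _
  have h : ‖t‖ ≤ √(sumSq t) := by
    refine (pi_norm_le_iff_of_nonneg (Real.sqrt_nonneg _)).2 fun l => ?_
    rw [Real.norm_eq_abs, ← Real.sqrt_sq_eq_abs]
    exact Real.sqrt_le_sqrt (Finset.single_le_sum (f := fun l => t l ^ 2)
      (fun l _ => sq_nonneg _) (Finset.mem_univ l))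
  calc ‖t‖ ^ 2 ≤ √(sumSq t) ^ 2 := by gcongr
    _ = _ := Real.sq_sqrt h0

/-- Partial integration along `∑ x_l^k ∂_l` for the density `Δ² e^{-∑ x²}`, with `Δ²` kept inside
the coefficient functions. The Gaussian contributes `-2` times the power sum of index `k + 1`. -/
theorem eigenvalue_loop (k : ℕ) (F : MvPolynomial ℕ ℂ) :
    ∫ t : Fin N → ℝ, eval (powerSum t) (gaussC k * F + mkDerivation ℂ (gaussΓ k) F) *
      evalReal (vandermondeSq N) t * (Real.exp (-sumSq t) : ℂ) = 0 := by
  refine gaussian_loop (p := powerSum) polyBounded_powerSum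
    (v := fun l : Fin N => Pi.single l 1) (p' := fun l j => evalReal (pderiv l (∑ m, X m ^ j)))
    (fun l j => polyBounded_evalReal _) (fun l j t => ?_)
    (g := fun l => evalReal (X l ^ k * vandermondeSq N))
    (g' := fun l => evalReal (pderiv l (X l ^ k * vandermondeSq N)))
    (fun l => polyBounded_evalReal _) (fun l => polyBounded_evalReal _)
    (fun l t => hasDerivAt_evalReal _ l t) continuous_sumSq one_pos
    (fun t => by rw [one_mul]; exact norm_sq_le_sumSq t) (q' := fun l t => 2 * t l) (fun l => ?_)
    (fun l t => ?_) (fun t => ?_) (fun j t => ?_) F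
  · simp only [powerSum_eq]
    exact hasDerivAt_evalReal _ l t
  · have h := polyBounded_evalReal (2 * X l : MvPolynomial (Fin N) ℂ)
    convert h using 1
    funext t
    simp [evalReal]
  · have h : ∀ m : Fin N, HasDerivAt (fun s : ℝ => (t + s • (Pi.single l 1 : Fin N → ℝ)) m ^ 2)
        (2 * t m * (Pi.single l 1 : Fin N → ℝ) m) 0 := by
      intro m
      have h1 : HasDerivAt (fun s : ℝ => (t + s • (Pi.single l 1 : Fin N → ℝ)) m)
          ((Pi.single l 1 : Fin N → ℝ) m) 0 := by
        simp only [Pi.add_apply, Pi.smul_apply, smul_eq_mul]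
        simpa using ((hasDerivAt_id (0 : ℝ)).mul_const
          ((Pi.single l 1 : Fin N → ℝ) m)).const_add (t m)
      refine (h1.fun_pow 2).congr_deriv ?_
      simp
    refine (HasDerivAt.fun_sum fun m _ => h m).congr_deriv ?_
    rw [Finset.sum_eq_single l]
    · simp
    · intro m _ hm
      simp [hm]
    · simp
  · have h1 := congrArg (fun f => evalReal f t) (sum_pderiv_pow_mul_vandermondeSq (N := N) k)
    simp only [evalReal, map_sum, map_mul, map_pow, eval_X] at h1
    rw [Finset.sum_sub_distrib]
    simp only [evalReal, map_mul, map_pow, eval_X] 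
    rw [h1, gaussC, map_sub, map_sum, sub_mul]
    simp only [map_mul, eval_X, powerSum, map_ofNat]
    congr 1
    rw [Finset.mul_sum, Finset.sum_mul]
    refine Finset.sum_congr rfl fun l _ => ?_
    push_cast
    ring
  · have h2 : ∀ l : Fin N, evalReal (pderiv l (∑ m, X m ^ j)) t = j * (t l : ℂ) ^ (j - 1) := by
      intro l
      rw [map_sum, Finset.sum_eq_single l]
      · simp [evalReal, Derivation.leibniz_pow]
      · intro m _ hm
        simp [Derivation.leibniz_pow, pderiv_X_of_ne hm]
      · simp
    simp only [h2]
    simp only [gaussΓ, map_mul, eval_X, eval_C, powerSum, evalReal, map_pow]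
    rw [Finset.mul_sum, Finset.sum_mul]
    refine Finset.sum_congr rfl fun l _ => ?_
    rcases Nat.eq_zero_or_pos j with rfl | hj
    · simp
    · rw [Nat.add_sub_assoc hj, pow_add]
      ring

end GaussianEigenvalues

end BoseGas
end

noncomputable section
namespace BoseGas

/-! ### Gaussian Hermitian matrices -/

section GaussianMatrices

open MvPolynomial

variable {N : ℕ}

/-- The coordinate directions of the space of Hermitian matrices. -/
def gueUnit (a : Fin N × Fin N) (k l : Fin N) : ℝ := if k = a.1 ∧ l = a.2 then 1 else 0

theorem gueMatrix_add_smul (g h : Fin N → Fin N → ℝ) (t : ℝ) :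
    gueMatrix (g + t • h) = gueMatrix g + (t : ℂ) • gueMatrix h := by
  ext k l
  simp only [gueMatrix, Matrix.of_apply, Matrix.add_apply, Matrix.smul_apply, Pi.add_apply,
    Pi.smul_apply, smul_eq_mul]
  split_ifs <;> push_cast <;> ring

theorem gueMatrix_gueUnit_diag (i : Fin N) :
    gueMatrix (gueUnit (i, i)) = Matrix.single i i 1 := by
  ext k l
  simp only [gueMatrix, gueUnit, Matrix.of_apply, Matrix.single_apply, Fin.ext_iff, Fin.lt_def]
  split_ifs <;> first | omega | simp

theorem gueMatrix_gueUnit_lt {i j : Fin N} (h : i < j) :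
    gueMatrix (gueUnit (i, j)) = Matrix.single i j 1 + Matrix.single j i 1 := by
  ext k l
  rw [Fin.lt_def] at h
  simp only [gueMatrix, gueUnit, Matrix.of_apply, Matrix.single_apply, Matrix.add_apply,
    Fin.ext_iff, Fin.lt_def]
  split_ifs <;> first | omega | simp

theorem gueMatrix_gueUnit_gt {i j : Fin N} (h : j < i) :
    gueMatrix (gueUnit (i, j)) = Matrix.single j i Complex.I - Matrix.single i j Complex.I := by
  ext k l
  rw [Fin.lt_def] at h
  simp only [gueMatrix, gueUnit, Matrix.of_apply, Matrix.single_apply, Matrix.sub_apply,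
    Fin.ext_iff, Fin.lt_def]
  split_ifs <;> first | omega | simp

/-- The Fierz identities below fail term by term: the directions `(i, j)` and `(j, i)`, real and
imaginary part of one entry, have to be taken together. -/
theorem sum_eq_sum_of_symm {S T : Fin N → Fin N → ℂ}
    (h : ∀ i j, S i j + S j i = T i j + T j i) : ∑ i, ∑ j, S i j = ∑ i, ∑ j, T i j := by
  have h1 : ∀ S : Fin N → Fin N → ℂ, ∑ i, ∑ j, (S i j + S j i) = 2 * ∑ i, ∑ j, S i j := by
    intro S
    simp only [Finset.sum_add_distrib]
    rw [Finset.sum_comm (f := fun i j => S j i), two_mul]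
  have h2 := h1 S
  simp only [h] at h2
  rw [h1] at h2
  exact (mul_left_cancel₀ two_ne_zero h2).symm

/-- The inverse of the norm of the coordinate directions. -/
def gueCoeff (a : Fin N × Fin N) : ℂ := if a.1 = a.2 then 1 else 1 / 2

/-- The coordinate directions are orthogonal for the trace form, with squared norm `1` on the
diagonal and `2` off it. Weighted by `gueCoeff` they give the completeness relation of Hermitian
matrices. -/
theorem sum_trace_gueUnit_mul_trace (A B : Matrix (Fin N) (Fin N) ℂ) :
    ∑ a, gueCoeff a * ((gueMatrix (gueUnit a) * A).trace * (gueMatrix (gueUnit a) * B).trace) =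
      (A * B).trace := by
  have h1 : (A * B).trace = ∑ i, ∑ j, A i j * B j i := by
    simp [Matrix.trace, Matrix.mul_apply]
  have hlt : ∀ i j : Fin N, i < j →
      gueCoeff (i, j) * ((gueMatrix (gueUnit (i, j)) * A).trace *
        (gueMatrix (gueUnit (i, j)) * B).trace) +
      gueCoeff (j, i) * ((gueMatrix (gueUnit (j, i)) * A).trace *
        (gueMatrix (gueUnit (j, i)) * B).trace) = A i j * B j i + A j i * B i j := by
    intro i j h
    simp only [gueCoeff, h.ne, h.ne', if_false, gueMatrix_gueUnit_lt h, gueMatrix_gueUnit_gt h,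
      add_mul, sub_mul, Matrix.trace_add, Matrix.trace_sub, Matrix.trace_single_mul]
    linear_combination (1 / 2 * (A j i - A i j) * (B j i - B i j)) * Complex.I_sq
  rw [Fintype.sum_prod_type, h1]
  refine sum_eq_sum_of_symm fun i j => ?_
  rcases lt_trichotomy i j with h | h | h
  · exact hlt i j h
  · subst h
    simp [gueCoeff, gueMatrix_gueUnit_diag, Matrix.trace_single_mul]
  · rw [add_comm, hlt j i h, add_comm]

theorem sum_trace_gueUnit_mul_gueUnit_mul (A B : Matrix (Fin N) (Fin N) ℂ) :
    ∑ a, gueCoeff a * (gueMatrix (gueUnit a) * A * gueMatrix (gueUnit a) * B).trace =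
      A.trace * B.trace := by
  have h0 : ∀ (i j k l : Fin N) (z w : ℂ),
      (Matrix.single i j z * A * Matrix.single k l w * B).trace = z * w * (A j k * B l i) := by
    intro i j k l z w
    rw [Matrix.single_mul_mul_single, Matrix.trace_single_mul]
    simp
    ring
  have h1 : A.trace * B.trace = ∑ i, ∑ j, A i i * B j j := by
    simp [Matrix.trace, Finset.sum_mul_sum]
  have hlt : ∀ i j : Fin N, i < j →
      gueCoeff (i, j) * (gueMatrix (gueUnit (i, j)) * A * gueMatrix (gueUnit (i, j)) * B).trace +
      gueCoeff (j, i) * (gueMatrix (gueUnit (j, i)) * A * gueMatrix (gueUnit (j, i)) * B).trace =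
        A i i * B j j + A j j * B i i := by
    intro i j h
    simp only [gueCoeff, h.ne, h.ne', if_false, gueMatrix_gueUnit_lt h, gueMatrix_gueUnit_gt h,
      add_mul, sub_mul, mul_add, mul_sub, Matrix.trace_add, Matrix.trace_sub, h0,
      Complex.I_mul_I]
    ring
  rw [Fintype.sum_prod_type, h1]
  refine sum_eq_sum_of_symm fun i j => ?_
  rcases lt_trichotomy i j with h | h | h
  · exact hlt i j h
  · subst h
    simp only [gueCoeff, gueMatrix_gueUnit_diag, h0]
    simp
  · rw [add_comm, hlt j i h, add_comm]

/-- The quadratic form `Tr X²` in the coordinates of `X`. -/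
def traceSq (g : Fin N → Fin N → ℝ) : ℝ := ∑ i, ∑ j, (if i = j then 1 else 2) * g i j ^ 2

theorem continuous_traceSq : Continuous (traceSq (N := N)) := by
  unfold traceSq
  fun_prop

theorem norm_sq_le_traceSq (g : Fin N → Fin N → ℝ) : ‖g‖ ^ 2 ≤ traceSq g := by
  have hc : ∀ i j : Fin N, g i j ^ 2 ≤ (if i = j then 1 else 2) * g i j ^ 2 := by
    intro i j
    split_ifs <;> nlinarith [sq_nonneg (g i j)]
  have hn : ∀ i j : Fin N, 0 ≤ (if i = j then (1 : ℝ) else 2) * g i j ^ 2 := fun i j =>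
    (sq_nonneg _).trans (hc i j)
  have h0 : 0 ≤ traceSq g := Finset.sum_nonneg fun i _ => Finset.sum_nonneg fun j _ => hn i j
  have h : ‖g‖ ≤ √(traceSq g) := by
    refine (pi_norm_le_iff_of_nonneg (Real.sqrt_nonneg _)).2 fun i => ?_
    refine (pi_norm_le_iff_of_nonneg (Real.sqrt_nonneg _)).2 fun j => ?_
    rw [Real.norm_eq_abs, ← Real.sqrt_sq_eq_abs]
    refine Real.sqrt_le_sqrt ((hc i j).trans ?_)
    exact (Finset.single_le_sum (f := fun j => (if i = j then (1 : ℝ) else 2) * g i j ^ 2)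
      (fun j _ => hn i j) (Finset.mem_univ j)).trans
      (Finset.single_le_sum (f := fun i => ∑ j, (if i = j then (1 : ℝ) else 2) * g i j ^ 2)
      (fun i _ => Finset.sum_nonneg fun j _ => hn i j) (Finset.mem_univ i))
  calc ‖g‖ ^ 2 ≤ √(traceSq g) ^ 2 := by gcongr
    _ = _ := Real.sq_sqrt h0

/-- Half the derivative of `Tr X²` in a coordinate direction; it identifies the Gaussian term of the
loop equation as a trace. -/
theorem trace_gueUnit_mul_gueMatrix (a : Fin N × Fin N) (g : Fin N → Fin N → ℝ) :
    (gueMatrix (gueUnit a) * gueMatrix g).trace =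
      ((if a.1 = a.2 then 1 else 2) * g a.1 a.2 : ℝ) := by
  obtain ⟨i, j⟩ := a
  rcases lt_trichotomy i j with h | h | h
  · rw [gueMatrix_gueUnit_lt h]
    simp [add_mul, Matrix.trace_add, Matrix.trace_single_mul, gueMatrix, h.ne, h.ne', h, h.not_gt]
    ring
  · subst h
    rw [gueMatrix_gueUnit_diag]
    simp [Matrix.trace_single_mul, gueMatrix]
  · rw [gueMatrix_gueUnit_gt h]
    simp [sub_mul, Matrix.trace_sub, Matrix.trace_single_mul, gueMatrix, h.ne, h.ne', h, h.not_gt]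
    linear_combination (-2 * (g i j : ℂ)) * Complex.I_sq

theorem hasMatrixDerivAt_gueMatrix (a : Fin N × Fin N) (g : Fin N → Fin N → ℝ) :
    HasMatrixDerivAt (fun t : ℝ => gueMatrix (g + t • gueUnit a)) (gueMatrix (gueUnit a)) 0 := by
  intro i j
  simp only [gueMatrix_add_smul, Matrix.add_apply, Matrix.smul_apply, smul_eq_mul]
  simpa using ((Complex.ofRealCLM.hasDerivAt (x := (0 : ℝ))).mul_const
    (gueMatrix (gueUnit a) i j)).const_add (gueMatrix g i j)

theorem hasDerivAt_trace_mul_gueMatrix_pow (a : Fin N × Fin N) (g : Fin N → Fin N → ℝ)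
    (A : Matrix (Fin N) (Fin N) ℂ) (k : ℕ) :
    HasDerivAt (fun t : ℝ => (A * gueMatrix (g + t • gueUnit a) ^ k).trace)
      (∑ r ∈ Finset.range k,
        (A * gueMatrix g ^ r * gueMatrix (gueUnit a) * gueMatrix g ^ (k - 1 - r)).trace) 0 := by
  have h := ((hasMatrixDerivAt_const A 0).mul ((hasMatrixDerivAt_gueMatrix a g).pow k)).trace
  refine h.congr_deriv ?_
  rw [zero_mul, zero_add, zero_smul, add_zero, Finset.mul_sum, Matrix.trace_sum]
  simp only [mul_assoc]

theorem hasDerivAt_trace_gueMatrix_pow (a : Fin N × Fin N) (g : Fin N → Fin N → ℝ) (k : ℕ) :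
    HasDerivAt (fun t : ℝ => (gueMatrix (g + t • gueUnit a) ^ k).trace)
      (k * (gueMatrix (gueUnit a) * gueMatrix g ^ (k - 1)).trace) 0 := by
  have h := hasDerivAt_trace_mul_gueMatrix_pow a g 1 k
  simp only [one_mul] at h
  refine h.congr_deriv ?_
  rw [Finset.sum_congr rfl (g := fun _ => (gueMatrix (gueUnit a) * gueMatrix g ^ (k - 1)).trace)]
  · simp
  · intro r hr
    have := Finset.mem_range.1 hr
    rw [Matrix.trace_mul_cycle, ← pow_add, Matrix.trace_mul_comm]
    congr 3
    omega

theorem polyBounded_gueMatrix (i j : Fin N) :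
    PolyBounded fun g : Fin N → Fin N → ℝ => gueMatrix g i j := by
  have h : ∀ i j : Fin N, PolyBounded fun g : Fin N → Fin N → ℝ => (g i j : ℂ) := fun i j =>
    PolyBounded.linear (Complex.ofRealCLM.comp
      ((ContinuousLinearMap.proj j : (Fin N → ℝ) →L[ℝ] ℝ).comp
        (ContinuousLinearMap.proj i : (Fin N → Fin N → ℝ) →L[ℝ] (Fin N → ℝ))))
  simp only [gueMatrix, Matrix.of_apply]
  split_ifs
  · exact h i i
  · exact (h i j).add ((PolyBounded.const _).mul (h j i))
  · exact (h j i).sub ((PolyBounded.const _).mul (h i j))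

theorem polyBounded_matrix_mul {E : Type*} [NormedAddCommGroup E] [NormedSpace ℝ E]
    {A B : E → Matrix (Fin N) (Fin N) ℂ} (hA : ∀ i j, PolyBounded fun x => A x i j)
    (hB : ∀ i j, PolyBounded fun x => B x i j) (i j : Fin N) :
    PolyBounded fun x => (A x * B x) i j := by
  simp only [Matrix.mul_apply]
  exact PolyBounded.sum fun k _ => (hA i k).mul (hB k j)

theorem polyBounded_gueMatrix_pow (k : ℕ) (i j : Fin N) :
    PolyBounded fun g : Fin N → Fin N → ℝ => (gueMatrix g ^ k) i j := by
  induction k generalizing i j with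
  | zero => simpa using PolyBounded.const _
  | succ k ih =>
    simp only [pow_succ]
    exact polyBounded_matrix_mul ih polyBounded_gueMatrix i j

theorem polyBounded_trace {E : Type*} [NormedAddCommGroup E] [NormedSpace ℝ E]
    {A : E → Matrix (Fin N) (Fin N) ℂ} (hA : ∀ i j, PolyBounded fun x => A x i j) :
    PolyBounded fun x => (A x).trace := by
  simp only [Matrix.trace, Matrix.diag]
  exact PolyBounded.sum fun i _ => hA i i

/-- The power traces of a Hermitian matrix. -/
def gueTrace (g : Fin N → Fin N → ℝ) (k : ℕ) : ℂ := (gueMatrix g ^ k).trace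

theorem polyBounded_gueTrace (k : ℕ) :
    PolyBounded fun g : Fin N → Fin N → ℝ => gueTrace g k :=
  polyBounded_trace (polyBounded_gueMatrix_pow k)

/-- Partial integration along the field `X ↦ X^k`, written in coordinates with coefficients
`gueCoeff a * tr (X_a X^k)`. Its divergence is `∑ tr X^r tr X^{k-1-r}`, and it differentiates `Tr
X²` to `2 tr X^{k+1}`. -/
theorem gue_loop (k : ℕ) (F : MvPolynomial ℕ ℂ) :
    ∫ g : Fin N → Fin N → ℝ, eval (gueTrace g) (gaussC k * F + mkDerivation ℂ (gaussΓ k) F) *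
      1 * (Real.exp (-traceSq g) : ℂ) = 0 := by
  have hB : ∀ (a : Fin N × Fin N) (i j : Fin N), PolyBounded fun _ : Fin N → Fin N → ℝ =>
      gueMatrix (gueUnit a) i j := fun a i j => PolyBounded.const _
  have hBX : ∀ (a : Fin N × Fin N) (k : ℕ), PolyBounded fun g : Fin N → Fin N → ℝ =>
      (gueMatrix (gueUnit a) * gueMatrix g ^ k).trace := fun a k =>
    polyBounded_trace (polyBounded_matrix_mul (hB a) (polyBounded_gueMatrix_pow k))
  refine gaussian_loop (p := gueTrace) polyBounded_gueTrace (v := gueUnit)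
    (p' := fun a j g => j * (gueMatrix (gueUnit a) * gueMatrix g ^ (j - 1)).trace)
    (fun a j => (PolyBounded.const _).mul (hBX a (j - 1)))
    (fun a j g => hasDerivAt_trace_gueMatrix_pow a g j)
    (g := fun a g => gueCoeff a * (gueMatrix (gueUnit a) * gueMatrix g ^ k).trace)
    (g' := fun a g => gueCoeff a * ∑ r ∈ Finset.range k, (gueMatrix (gueUnit a) *
      gueMatrix g ^ r * gueMatrix (gueUnit a) * gueMatrix g ^ (k - 1 - r)).trace)
    (fun a => (PolyBounded.const _).mul (hBX a k))
    (fun a => (PolyBounded.const _).mul (PolyBounded.sum fun r _ => polyBounded_trace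
      (polyBounded_matrix_mul (polyBounded_matrix_mul (polyBounded_matrix_mul (hB a)
        (polyBounded_gueMatrix_pow r)) (hB a)) (polyBounded_gueMatrix_pow (k - 1 - r)))))
    (fun a g => (hasDerivAt_trace_mul_gueMatrix_pow a g _ k).const_mul _) continuous_traceSq
    one_pos (fun g => by rw [one_mul]; exact norm_sq_le_traceSq g)
    (q' := fun a g => 2 * ((if a.1 = a.2 then 1 else 2) * g a.1 a.2)) (fun a => ?_)
    (fun a g => ?_) (fun g => ?_) (fun j g => ?_) F
  · have h := (PolyBounded.const (E := Fin N → Fin N → ℝ) 2).mul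
      (polyBounded_trace (polyBounded_matrix_mul (hB a) polyBounded_gueMatrix))
    simp only [trace_gueUnit_mul_gueMatrix] at h
    push_cast at h ⊢
    exact h
  · have h : ∀ i j : Fin N, HasDerivAt
        (fun t : ℝ => (if i = j then (1 : ℝ) else 2) * (g + t • gueUnit a) i j ^ 2)
        ((if i = j then 1 else 2) * (2 * g i j * gueUnit a i j)) 0 := by
      intro i j
      have h1 : HasDerivAt (fun t : ℝ => (g + t • gueUnit a) i j) (gueUnit a i j) 0 := by
        simp only [Pi.add_apply, Pi.smul_apply, smul_eq_mul]
        simpa using ((hasDerivAt_id (0 : ℝ)).mul_const (gueUnit a i j)).const_add (g i j)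
      refine ((h1.fun_pow 2).const_mul _).congr_deriv ?_
      simp
    refine (HasDerivAt.fun_sum fun i _ => HasDerivAt.fun_sum fun j _ => h i j).congr_deriv ?_
    rw [Finset.sum_eq_single a.1, Finset.sum_eq_single a.2]
    · simp [gueUnit]
    · intro j _ hj
      simp [gueUnit, hj]
    · simp
    · intro i _ hi
      simp [gueUnit, hi]
    · simp
  · have h1 : ∀ a : Fin N × Fin N, gueCoeff a * (gueMatrix (gueUnit a) * gueMatrix g ^ k).trace *
        ((2 * ((if a.1 = a.2 then 1 else 2) * g a.1 a.2) : ℝ) : ℂ) =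
        2 * (gueCoeff a * ((gueMatrix (gueUnit a) * gueMatrix g ^ k).trace *
          (gueMatrix (gueUnit a) * gueMatrix g).trace)) := by
      intro a
      rw [trace_gueUnit_mul_gueMatrix]
      push_cast
      ring
    rw [Finset.sum_sub_distrib]
    simp only [h1, Finset.mul_sum (Finset.range k)]
    rw [← Finset.mul_sum, sum_trace_gueUnit_mul_trace, Finset.sum_comm, ← pow_succ, mul_one,
      gaussC, map_sub, map_sum]
    simp only [sum_trace_gueUnit_mul_gueUnit_mul, map_mul, eval_X, map_ofNat]
    rfl
  · have h1 : ∀ a : Fin N × Fin N, gueCoeff a * (gueMatrix (gueUnit a) * gueMatrix g ^ k).trace *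
        (j * (gueMatrix (gueUnit a) * gueMatrix g ^ (j - 1)).trace) =
        j * (gueCoeff a * ((gueMatrix (gueUnit a) * gueMatrix g ^ k).trace *
          (gueMatrix (gueUnit a) * gueMatrix g ^ (j - 1)).trace)) := fun a => by ring
    simp only [h1]
    rw [← Finset.mul_sum, sum_trace_gueUnit_mul_trace, ← pow_add, mul_one]
    simp only [gaussΓ, map_mul, eval_X, eval_C, gueTrace]
    rcases Nat.eq_zero_or_pos j with rfl | hj
    · simp
    · rw [Nat.add_sub_assoc hj]

theorem gueTrace_eq_powerSum (g : Fin N → Fin N → ℝ) :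
    gueTrace g = powerSum (gueEigenvalues g) := by
  funext k
  rw [gueTrace, trace_pow_eq_sum_roots,
    (gueMatrix_isHermitian g).roots_charpoly_eq_eigenvalues, Multiset.map_map]
  rfl

end GaussianMatrices

end BoseGas
end

noncomputable section
namespace BoseGas

/-! ### The density of the Gaussian unitary ensemble -/

theorem pi_withDensity_ofReal {ι E : Type*} [Fintype ι] [MeasurableSpace E] {μ : ι → Measure E}
    [∀ i, SigmaFinite (μ i)] {p : ι → E → ℝ} (hp : ∀ i, Integrable (p i) (μ i))
    (h0 : ∀ i x, 0 ≤ p i x) :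
    Measure.pi (fun i => (μ i).withDensity fun x => ENNReal.ofReal (p i x)) =
      (Measure.pi μ).withDensity fun x => ENNReal.ofReal (∏ i, p i (x i)) := by
  have : ∀ i, IsFiniteMeasure ((μ i).withDensity fun x => ENNReal.ofReal (p i x)) := fun i =>
    isFiniteMeasure_withDensity_ofReal (hp i).2
  refine Measure.pi_eq fun s hs => ?_
  rw [withDensity_apply _ (MeasurableSet.univ_pi hs), Measure.restrict_pi_pi,
    ← ofReal_integral_eq_lintegral_ofReal (Integrable.fintype_prod fun i => (hp i).restrict)
      (Filter.Eventually.of_forall fun x => Finset.prod_nonneg fun i _ => h0 i (x i)),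
    integral_fintype_prod_eq_prod, ENNReal.ofReal_prod_of_nonneg fun i _ =>
      integral_nonneg (h0 i)]
  refine Finset.prod_congr rfl fun i _ => ?_
  rw [withDensity_apply _ (hs i), ofReal_integral_eq_lintegral_ofReal (hp i).restrict
    (Filter.Eventually.of_forall (h0 i))]

/-- A Gaussian of variance `v` has exponent `-g²/(2v)`: this is `-g²` for `v = 1/2` and `-2g²` for
`v = 1/4`, the terms of `traceSq`. -/
theorem exists_gueMeasure_eq (N : ℕ) : ∃ C : ℝ, 0 < C ∧ gueMeasure N =
    (volume : Measure (Fin N → Fin N → ℝ)).withDensity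
      fun g => ENNReal.ofReal (C * Real.exp (-traceSq g)) := by
  set v : Fin N → Fin N → NNReal := fun i j => if i = j then 1 / 2 else 1 / 4 with hv
  have hv0 : ∀ i j, v i j ≠ 0 := by
    intro i j
    simp only [hv]
    split_ifs <;> norm_num
  have h1 : ∀ i, (Measure.pi fun j => gaussianReal 0 (v i j)) =
      (volume : Measure (Fin N → ℝ)).withDensity
        fun x => ENNReal.ofReal (∏ j, gaussianPDFReal 0 (v i j) (x j)) := by
    intro i
    rw [volume_pi, ← pi_withDensity_ofReal (fun j => integrable_gaussianPDFReal _ _)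
      fun j => gaussianPDFReal_nonneg _ _]
    congr 1
    funext j
    rw [gaussianReal_of_var_ne_zero _ (hv0 i j), gaussianPDF_def]
  refine ⟨∏ i, ∏ j, (√(2 * Real.pi * v i j))⁻¹, Finset.prod_pos fun i _ => Finset.prod_pos
    fun j _ => inv_pos.2 (Real.sqrt_pos.2 (by have := pos_iff_ne_zero.2 (hv0 i j); positivity)),
    ?_⟩
  have h2 : gueMeasure N = Measure.pi fun i => Measure.pi fun j => gaussianReal 0 (v i j) := by
    simp only [gueMeasure, hv]
  rw [h2]
  simp only [h1]
  refine (pi_withDensity_ofReal (μ := fun _ : Fin N => (volume : Measure (Fin N → ℝ)))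
    (p := fun i (x : Fin N → ℝ) => ∏ j, gaussianPDFReal 0 (v i j) (x j))
    (fun i => Integrable.fintype_prod fun j => integrable_gaussianPDFReal _ _)
    (fun i x => Finset.prod_nonneg fun j _ => gaussianPDFReal_nonneg _ _ _)).trans ?_
  rw [← volume_pi]
  congr 1
  funext g
  simp only [gaussianPDFReal_def, Finset.prod_mul_distrib, ← Real.exp_sum]
  congr 3
  rw [traceSq, ← Finset.sum_neg_distrib]
  refine Finset.sum_congr rfl fun i _ => ?_
  rw [← Finset.sum_neg_distrib]
  refine Finset.sum_congr rfl fun j _ => ?_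
  simp only [hv]
  split_ifs
  · push_cast
    ring
  · push_cast
    ring

theorem PolyBounded.integrable_of_ofReal {E : Type*} [NormedAddCommGroup E] [NormedSpace ℝ E]
    [FiniteDimensional ℝ E] [MeasurableSpace E] [BorelSpace E] {μ : Measure E}
    [μ.IsAddHaarMeasure] {f : E → ℝ} (hf : PolyBounded fun x => (f x : ℂ)) {q : E → ℝ}
    (hqc : Continuous q) {δ : ℝ} (hδ : 0 < δ) (hq : ∀ x, δ * ‖x‖ ^ 2 ≤ q x) :
    Integrable (fun x => f x * Real.exp (-q x)) μ := by
  have h := (hf.integrable_mul_exp (μ := μ) hqc hδ hq).re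
  refine h.congr (Filter.Eventually.of_forall fun x => ?_)
  simp only [← Complex.ofReal_mul]
  rfl

theorem PolyBounded.ofReal_abs {E : Type*} [NormedAddCommGroup E] {f : E → ℝ}
    (hf : PolyBounded fun x => (f x : ℂ)) : PolyBounded fun x => ((|f x| : ℝ) : ℂ) := by
  obtain ⟨hc, C, k, hC, h⟩ := hf
  have hc' : Continuous f := Complex.continuous_re.comp hc
  exact ⟨Complex.continuous_ofReal.comp hc'.abs, C, k, hC, fun x => by simpa using h x⟩

/-- Averages over the Gaussian unitary ensemble as integrals for the density `exp (-Tr X²)`. -/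
theorem integral_gueMeasure {N : ℕ} {f : (Fin N → Fin N → ℝ) → ℝ}
    (hf : PolyBounded fun g => (f g : ℂ)) : Integrable f (gueMeasure N) ∧
      ∫ g, f g * Real.exp (-traceSq g) =
        (∫ g : Fin N → Fin N → ℝ, Real.exp (-traceSq g)) * ∫ g, f g ∂gueMeasure N := by
  obtain ⟨C, hC, hμ⟩ := exists_gueMeasure_eq N
  have hprob : IsProbabilityMeasure (gueMeasure N) := by
    unfold gueMeasure
    infer_instance
  have hm : Measurable fun g : Fin N → Fin N → ℝ => ENNReal.ofReal (C * Real.exp (-traceSq g)) :=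
    ENNReal.measurable_ofReal.comp
      (continuous_const.mul (Real.continuous_exp.comp continuous_traceSq.neg)).measurable
  have hlt : ∀ᵐ g : Fin N → Fin N → ℝ, ENNReal.ofReal (C * Real.exp (-traceSq g)) < ⊤ :=
    Filter.Eventually.of_forall fun g => ENNReal.ofReal_lt_top
  have hr : ∀ g : Fin N → Fin N → ℝ, (ENNReal.ofReal (C * Real.exp (-traceSq g))).toReal =
      C * Real.exp (-traceSq g) := fun g => ENNReal.toReal_ofReal (by positivity)
  have hint : ∀ f : (Fin N → Fin N → ℝ) → ℝ, ∫ g, f g ∂gueMeasure N =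
      C * ∫ g, f g * Real.exp (-traceSq g) := by
    intro f
    rw [hμ, integral_withDensity_eq_integral_toReal_smul hm hlt, ← integral_const_mul]
    simp only [hr, smul_eq_mul]
    refine integral_congr_ae (Filter.Eventually.of_forall fun g => ?_)
    ring
  refine ⟨?_, ?_⟩
  · rw [hμ, integrable_withDensity_iff_integrable_smul' hm hlt]
    simp only [hr, smul_eq_mul]
    refine ((hf.integrable_of_ofReal (μ := volume) continuous_traceSq one_pos
      fun g => by rw [one_mul]; exact norm_sq_le_traceSq g).const_mul C).congr
      (Filter.Eventually.of_forall fun g => ?_)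
    ring
  · have h1 := hint fun _ => 1
    simp only [integral_const, probReal_univ, one_smul, one_mul] at h1
    rw [hint f, mul_left_comm, ← mul_assoc, ← h1, one_mul]

/-! ### Comparison of the two integrals -/

section Comparison

open MvPolynomial

/-- The substitution `X k ↦ R ^ k X k`. -/
def dilate (R : ℂ) : MvPolynomial ℕ ℂ →ₐ[ℂ] MvPolynomial ℕ ℂ := aeval fun k => C (R ^ k) * X k

theorem eval_dilate (p : ℕ → ℂ) (R : ℂ) (F : MvPolynomial ℕ ℂ) :
    eval p (dilate R F) = eval (fun k => R ^ k * p k) F := by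
  induction F using MvPolynomial.induction_on with
  | C z => simp [dilate, algebraMap_eq]
  | add f g hf hg => simp [hf, hg]
  | mul_X f k hf => rw [map_mul, map_mul, map_mul, hf, eval_X, dilate, aeval_X, map_mul, eval_C, eval_X]

/-- The substitution `x ↦ R x`, with all data homogeneous, moves the width of the Gaussian into the
polynomial, where `dilate` records it. -/
theorem integral_eval_mul_exp_sq {E : Type*} [NormedAddCommGroup E] [NormedSpace ℝ E]
    [FiniteDimensional ℝ E] [MeasurableSpace E] [BorelSpace E] {μ : Measure E}
    [μ.IsAddHaarMeasure] {p : E → ℕ → ℂ} {w : E → ℂ} {q : E → ℝ} {e : ℕ} {R : ℝ} (hR : 0 < R)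
    (hp : ∀ x k, p (R • x) k = (R : ℂ) ^ k * p x k) (hw : ∀ x, w (R • x) = (R : ℂ) ^ e * w x)
    (hq : ∀ x, q (R • x) = R ^ 2 * q x) (F : MvPolynomial ℕ ℂ) :
    (R : ℂ) ^ (Module.finrank ℝ E + e) *
        ∫ x, eval (p x) F * w x * (Real.exp (-(R ^ 2 * q x)) : ℂ) ∂μ =
      ∫ x, eval (p x) (dilate (R : ℂ)⁻¹ F) * w x * (Real.exp (-q x) : ℂ) ∂μ := by
  have hR' : (R : ℂ) ≠ 0 := by exact_mod_cast hR.ne'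
  have h := Measure.integral_comp_smul μ
    (fun x => eval (p x) (dilate (R : ℂ)⁻¹ F) * w x * (Real.exp (-q x) : ℂ)) R
  have h1 : ∀ x, eval (p (R • x)) (dilate (R : ℂ)⁻¹ F) * w (R • x) *
      (Real.exp (-q (R • x)) : ℂ) =
      (R : ℂ) ^ e * (eval (p x) F * w x * (Real.exp (-(R ^ 2 * q x)) : ℂ)) := by
    intro x
    rw [eval_dilate, hw, hq]
    simp only [hp]
    have : ∀ k, ((R : ℂ)⁻¹) ^ k * ((R : ℂ) ^ k * p x k) = p x k := by
      intro k
      rw [← mul_assoc, ← mul_pow, inv_mul_cancel₀ hR', one_pow, one_mul]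
    simp only [this]
    ring
  simp only [h1] at h
  rw [integral_const_mul, abs_of_pos (by positivity), Complex.real_smul] at h
  rw [pow_add, mul_assoc, h, ← mul_assoc]
  push_cast
  rw [mul_inv_cancel₀ (pow_ne_zero _ hR'), one_mul]

variable {N : ℕ}

theorem gueTrace_smul (R : ℝ) (g : Fin N → Fin N → ℝ) (k : ℕ) :
    gueTrace (R • g) k = (R : ℂ) ^ k * gueTrace g k := by
  have h : gueMatrix (R • g) = (R : ℂ) • gueMatrix g := by
    ext i j
    simp only [gueMatrix, Matrix.of_apply, Matrix.smul_apply, Pi.smul_apply, smul_eq_mul]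
    split_ifs <;> push_cast <;> ring
  rw [gueTrace, h, smul_pow, Matrix.trace_smul, smul_eq_mul, gueTrace]

theorem traceSq_smul (R : ℝ) (g : Fin N → Fin N → ℝ) : traceSq (R • g) = R ^ 2 * traceSq g := by
  simp only [traceSq, Pi.smul_apply, smul_eq_mul, Finset.mul_sum]
  refine Finset.sum_congr rfl fun i _ => Finset.sum_congr rfl fun j _ => ?_
  ring

theorem powerSum_smul (R : ℝ) (t : Fin N → ℝ) (k : ℕ) :
    powerSum (R • t) k = (R : ℂ) ^ k * powerSum t k := by
  simp only [powerSum, Pi.smul_apply, smul_eq_mul, Finset.mul_sum]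
  refine Finset.sum_congr rfl fun i _ => ?_
  push_cast
  ring

theorem sumSq_smul (R : ℝ) (t : Fin N → ℝ) : sumSq (R • t) = R ^ 2 * sumSq t := by
  simp only [sumSq, Pi.smul_apply, smul_eq_mul, Finset.mul_sum]
  refine Finset.sum_congr rfl fun i _ => ?_
  ring

/-- The dimension `N` of eigenvalue space plus the degree `N (N - 1)` of the squared Vandermonde is
the dimension `N²` of the Hermitian matrices. Thus both integrals scale with the same power. -/
theorem sum_card_Ioi (N : ℕ) : N + 2 * ∑ i : Fin N, (Finset.Ioi i).card = N * N := by
  simp only [Fin.card_Ioi]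
  rw [Fin.sum_univ_eq_sum_range fun i => N - 1 - i, Finset.sum_range_reflect (fun i => i) N,
    mul_comm 2, Finset.sum_range_id_mul_two]
  cases N with
  | zero => rfl
  | succ n => simp; ring

theorem evalReal_vandermondeSq (t : Fin N → ℝ) : evalReal (vandermondeSq N) t =
    ((∏ i, ∏ j ∈ Finset.Ioi i, (t j - t i) ^ 2 : ℝ) : ℂ) := by
  simp [evalReal, vandermondeSq]

theorem evalReal_vandermondeSq_smul (R : ℝ) (t : Fin N → ℝ) :
    evalReal (vandermondeSq N) (R • t) =
      (R : ℂ) ^ (2 * ∑ i : Fin N, (Finset.Ioi i).card) * evalReal (vandermondeSq N) t := by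
  rw [evalReal_vandermondeSq, evalReal_vandermondeSq]
  norm_cast
  simp only [Pi.smul_apply, smul_eq_mul, ← mul_sub, mul_pow, Finset.prod_mul_distrib,
    Finset.prod_const, ← pow_mul]
  rw [Finset.prod_pow_eq_pow_sum, Finset.mul_sum]

/-- The integral over Hermitian matrices of polynomials in the power traces. -/
def gueFunctional (N : ℕ) : MvPolynomial ℕ ℂ →ₗ[ℂ] ℂ where
  toFun F := ∫ g : Fin N → Fin N → ℝ, eval (gueTrace g) F * 1 * (Real.exp (-traceSq g) : ℂ)
  map_add' F G := by
    have h : ∀ F, Integrable fun g : Fin N → Fin N → ℝ =>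
        eval (gueTrace g) F * 1 * (Real.exp (-traceSq g) : ℂ) := fun F =>
      ((PolyBounded.eval polyBounded_gueTrace F).mul (PolyBounded.const 1)).integrable_mul_exp
        continuous_traceSq one_pos fun g => by rw [one_mul]; exact norm_sq_le_traceSq g
    rw [← integral_add (h F) (h G)]
    simp only [map_add, add_mul]
  map_smul' z F := by
    simp only [smul_eval, RingHom.id_apply, smul_eq_mul, mul_assoc]
    rw [integral_const_mul]

/-- The integral for the eigenvalue density of polynomials in the power sums. -/
def eigenvalueFunctional (N : ℕ) : MvPolynomial ℕ ℂ →ₗ[ℂ] ℂ where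
  toFun F := ∫ t : Fin N → ℝ,
    eval (powerSum t) F * evalReal (vandermondeSq N) t * (Real.exp (-sumSq t) : ℂ)
  map_add' F G := by
    have h : ∀ F, Integrable fun t : Fin N → ℝ =>
        eval (powerSum t) F * evalReal (vandermondeSq N) t * (Real.exp (-sumSq t) : ℂ) := fun F =>
      ((PolyBounded.eval polyBounded_powerSum F).mul
        (polyBounded_evalReal _)).integrable_mul_exp continuous_sumSq one_pos
        fun t => by rw [one_mul]; exact norm_sq_le_sumSq t
    rw [← integral_add (h F) (h G)]
    simp only [map_add, add_mul]
  map_smul' z F := by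
    simp only [smul_eval, RingHom.id_apply, smul_eq_mul, mul_assoc]
    rw [integral_const_mul]

/-- Both functionals satisfy the same loop equations, and the cross-multiplied difference vanishes
at `1` without knowing that either normalisation is nonzero. -/
theorem gueFunctional_mul_eigenvalueFunctional (F : MvPolynomial ℕ ℂ) :
    eigenvalueFunctional N 1 * gueFunctional N F = gueFunctional N 1 * eigenvalueFunctional N F := by
  have hX : ∀ t : Fin N → ℝ, powerSum t 0 = N := fun t => by simp [powerSum]
  have h := eq_zero_of_gaussian_loop (N := N)
    (T := eigenvalueFunctional N 1 • gueFunctional N - gueFunctional N 1 • eigenvalueFunctional N)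
    (by simp [mul_comm]) (fun f => ?_) (fun k f => ?_) F
  · simpa [sub_eq_zero] using h
  · have h1 : gueFunctional N (X 0 * f) = N * gueFunctional N f := by
      simp only [gueFunctional, LinearMap.coe_mk, AddHom.coe_mk, map_mul, eval_X]
      rw [← integral_const_mul]
      simp only [gueTrace_eq_powerSum, hX, mul_assoc]
    have h2 : eigenvalueFunctional N (X 0 * f) = N * eigenvalueFunctional N f := by
      simp only [eigenvalueFunctional, LinearMap.coe_mk, AddHom.coe_mk, map_mul, eval_X]
      rw [← integral_const_mul]
      simp only [hX, mul_assoc]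
    simp only [LinearMap.sub_apply, LinearMap.smul_apply, smul_eq_mul, h1, h2]
    ring
  · have h1 : gueFunctional N (gaussC k * f + mkDerivation ℂ (gaussΓ k) f) = 0 := gue_loop k f
    have h2 : eigenvalueFunctional N (gaussC k * f + mkDerivation ℂ (gaussΓ k) f) = 0 :=
      eigenvalue_loop k f
    simp [h1, h2]

/-- Dilation by `√c` reduces to `c = 1`. The same power `(√c) ^ (N * N)` appears on both sides and
cancels. -/
theorem gue_mul_eigenvalue_exp {c : ℝ} (hc : 0 < c) (F : MvPolynomial ℕ ℂ) :
    eigenvalueFunctional N 1 *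
        ∫ g : Fin N → Fin N → ℝ, eval (gueTrace g) F * 1 * (Real.exp (-(c * traceSq g)) : ℂ) =
      gueFunctional N 1 * ∫ t : Fin N → ℝ, eval (powerSum t) F * evalReal (vandermondeSq N) t *
        (Real.exp (-(c * sumSq t)) : ℂ) := by
  have hR : 0 < √c := Real.sqrt_pos.2 hc
  have hR' : ((√c : ℝ) : ℂ) ≠ 0 := by exact_mod_cast hR.ne'
  have h := gueFunctional_mul_eigenvalueFunctional (N := N) (dilate ((√c : ℝ) : ℂ)⁻¹ F)
  have h1 := integral_eval_mul_exp_sq (μ := (volume : Measure (Fin N → Fin N → ℝ)))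
    (p := gueTrace) (w := fun _ => 1) (q := traceSq) (e := 0) hR (fun g k => gueTrace_smul _ g k)
    (fun g => by simp) (fun g => traceSq_smul _ g) F
  have h2 := integral_eval_mul_exp_sq (μ := (volume : Measure (Fin N → ℝ)))
    (p := powerSum) (w := evalReal (vandermondeSq N)) (q := sumSq) hR
    (fun t k => powerSum_smul _ t k) (fun t => evalReal_vandermondeSq_smul _ t)
    (fun t => sumSq_smul _ t) F
  rw [Module.finrank_pi, Fintype.card_fin, sum_card_Ioi] at h2
  have hfin : Module.finrank ℝ (Fin N → Fin N → ℝ) = N * N := by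
    simp [Module.finrank_pi_fintype]
  rw [hfin, add_zero] at h1
  rw [Real.sq_sqrt hc.le] at h1 h2
  change _ = gueFunctional N (dilate ((√c : ℝ) : ℂ)⁻¹ F) at h1
  change _ = eigenvalueFunctional N (dilate ((√c : ℝ) : ℂ)⁻¹ F) at h2
  rw [← h1, ← h2] at h
  refine mul_left_cancel₀ (pow_ne_zero (N * N) hR') ?_
  linear_combination h

theorem exists_eval_powerSum_eq_prod (P : Polynomial ℂ) : ∃ F : MvPolynomial ℕ ℂ,
    ∀ t : Fin N → ℝ, eval (powerSum t) F = ∏ l, P.eval (t l : ℂ) := by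
  refine exists_eval_eq_prod_of_power_sums (y := fun (t : Fin N → ℝ) l => P.eval (t l : ℂ))
    fun m => ⟨∑ k ∈ (P ^ m).support, C ((P ^ m).coeff k) * X k, fun t => ?_⟩
  simp only [← Polynomial.eval_pow]
  simp only [Polynomial.eval_eq_sum, Polynomial.sum, map_sum, map_mul, eval_C, eval_X, powerSum,
    Finset.mul_sum]
  exact Finset.sum_comm

end Comparison

end BoseGas
end

noncomputable section
namespace BoseGas

/-! ### From polynomials to absolute values for Gaussian weights -/

section GaussianComparison

open MvPolynomial

variable {N : ℕ}

/-- The joint density of the eigenvalues, up to the Gaussian factor. -/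
def vandermondeReal (t : Fin N → ℝ) : ℝ := ∏ i, ∏ j ∈ Finset.Ioi i, (t j - t i) ^ 2

theorem vandermondeReal_nonneg (t : Fin N → ℝ) : 0 ≤ vandermondeReal t :=
  Finset.prod_nonneg fun _ _ => Finset.prod_nonneg fun _ _ => sq_nonneg _

theorem polyBounded_vandermondeReal :
    PolyBounded fun t : Fin N → ℝ => (vandermondeReal t : ℂ) := by
  have h := polyBounded_evalReal (vandermondeSq N)
  have h1 : evalReal (vandermondeSq N) = fun t : Fin N → ℝ => (vandermondeReal t : ℂ) :=
    funext evalReal_vandermondeSq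
  rwa [h1] at h

theorem gueFunctional_one :
    gueFunctional N 1 = ((∫ g : Fin N → Fin N → ℝ, Real.exp (-traceSq g) : ℝ) : ℂ) := by
  rw [← integral_complex_ofReal]
  simp only [gueFunctional, LinearMap.coe_mk, AddHom.coe_mk, map_one, one_mul]

theorem eigenvalueFunctional_one : eigenvalueFunctional N 1 =
    ((∫ t : Fin N → ℝ, vandermondeReal t * Real.exp (-sumSq t) : ℝ) : ℂ) := by
  rw [← integral_complex_ofReal]
  simp only [eigenvalueFunctional, LinearMap.coe_mk, AddHom.coe_mk, map_one, one_mul,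
    evalReal_vandermondeSq, Complex.ofReal_mul, vandermondeReal]

/-- A Gaussian average of a real polynomial function is independent of whether it is computed
from the matrix entries or from the eigenvalue density. -/
theorem gue_mul_eigenvalue_exp_real {c : ℝ} (hc : 0 < c) {Q : (Fin N → ℝ) → ℝ}
    {F : MvPolynomial ℕ ℂ} (hF : ∀ t, eval (powerSum t) F = (Q t : ℂ)) :
    (∫ t : Fin N → ℝ, vandermondeReal t * Real.exp (-sumSq t)) *
        ∫ g : Fin N → Fin N → ℝ, Q (gueEigenvalues g) * Real.exp (-(c * traceSq g)) =
      (∫ g : Fin N → Fin N → ℝ, Real.exp (-traceSq g)) *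
        ∫ t : Fin N → ℝ, Q t * vandermondeReal t * Real.exp (-(c * sumSq t)) := by
  have h := gue_mul_eigenvalue_exp (N := N) hc F
  rw [gueFunctional_one, eigenvalueFunctional_one] at h
  simp only [gueTrace_eq_powerSum, hF, evalReal_vandermondeSq, mul_one] at h
  apply Complex.ofReal_injective
  simp only [← integral_complex_ofReal, Complex.ofReal_mul] at h ⊢
  exact h

/-- `Q` is unbounded, so polynomial approximation does not apply to it directly. The Gaussian is
divided in two halves: one makes `Q e^{-q/2}` bounded, the other is the density of a finite measure.
The moments are then Gaussian integrals of `Q^m`, and the bounded variables have equal averages of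
their absolute values. -/
theorem gue_mul_eigenvalue_abs {Q : (Fin N → ℝ) → ℝ} {F : MvPolynomial ℕ ℂ}
    (hF : ∀ t, eval (powerSum t) F = (Q t : ℂ)) :
    (∫ t : Fin N → ℝ, vandermondeReal t * Real.exp (-sumSq t)) *
        ∫ g : Fin N → Fin N → ℝ, |Q (gueEigenvalues g)| * Real.exp (-traceSq g) =
      (∫ g : Fin N → Fin N → ℝ, Real.exp (-traceSq g)) *
        ∫ t : Fin N → ℝ, |Q t| * vandermondeReal t * Real.exp (-sumSq t) := by
  set Z₁ : ℝ := ∫ t : Fin N → ℝ, vandermondeReal t * Real.exp (-sumSq t) with hZ₁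
  set Z₂ : ℝ := ∫ g : Fin N → Fin N → ℝ, Real.exp (-traceSq g) with hZ₂
  have hZ₁0 : 0 ≤ Z₁ := integral_nonneg fun t =>
    mul_nonneg (vandermondeReal_nonneg t) (Real.exp_pos _).le
  have hZ₂0 : 0 ≤ Z₂ := integral_nonneg fun t => (Real.exp_pos _).le
  have hQ₁ : PolyBounded fun g : Fin N → Fin N → ℝ => (Q (gueEigenvalues g) : ℂ) := by
    have h := PolyBounded.eval polyBounded_gueTrace F (E := Fin N → Fin N → ℝ)
    simpa only [gueTrace_eq_powerSum, hF] using h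
  have hQ₂ : PolyBounded fun t : Fin N → ℝ => (Q t : ℂ) := by
    have h := PolyBounded.eval polyBounded_powerSum F (E := Fin N → ℝ)
    simpa only [hF] using h
  have hc₁ : Continuous fun g : Fin N → Fin N → ℝ => Q (gueEigenvalues g) :=
    Complex.continuous_re.comp hQ₁.1
  have hc₂ : Continuous Q := Complex.continuous_re.comp hQ₂.1
  have hq₁ : ∀ g : Fin N → Fin N → ℝ, 1 / 2 * ‖g‖ ^ 2 ≤ traceSq g / 2 := fun g => by
    linarith [norm_sq_le_traceSq g]
  have hq₂ : ∀ t : Fin N → ℝ, 1 / 2 * ‖t‖ ^ 2 ≤ sumSq t / 2 := fun t => by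
    linarith [norm_sq_le_sumSq t]
  have hs₁ : Continuous fun g : Fin N → Fin N → ℝ => traceSq g / 2 :=
    continuous_traceSq.div_const _
  have hs₂ : Continuous fun t : Fin N → ℝ => sumSq t / 2 := continuous_sumSq.div_const _
  obtain ⟨M₁, hM₁⟩ := hQ₁.exists_bound one_half_pos hq₁
  obtain ⟨M₂, hM₂⟩ := hQ₂.exists_bound one_half_pos hq₂
  -- Each density carries the normalisation of the other side, so that the moments agree exactly in
  -- the cross-multiplied form of the previous theorem.
  set w₁ : (Fin N → Fin N → ℝ) → ℝ := fun g => Z₁ * Real.exp (-(traceSq g / 2)) with hw₁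
  set w₂ : (Fin N → ℝ) → ℝ := fun t => Z₂ * (vandermondeReal t * Real.exp (-(sumSq t / 2)))
    with hw₂
  have hw₁0 : ∀ g, 0 ≤ w₁ g := fun g => by positivity
  have hw₂0 : ∀ t, 0 ≤ w₂ t := fun t =>
    mul_nonneg hZ₂0 (mul_nonneg (vandermondeReal_nonneg t) (Real.exp_pos _).le)
  have hw₁i : Integrable w₁ := by
    have h := (PolyBounded.const (E := Fin N → Fin N → ℝ) ((1 : ℝ) : ℂ)).integrable_of_ofReal
      (f := fun _ => 1) (μ := volume) hs₁ one_half_pos hq₁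
    simpa only [one_mul] using h.const_mul Z₁
  have hw₂i : Integrable w₂ := ((polyBounded_vandermondeReal (N := N)).integrable_of_ofReal
    (μ := volume) hs₂ one_half_pos hq₂).const_mul Z₂
  have hw₁c : Continuous w₁ := by
    simp only [hw₁]
    fun_prop
  have hw₂c : Continuous w₂ := by
    have : Continuous (vandermondeReal (N := N)) := by
      unfold vandermondeReal
      fun_prop
    simp only [hw₂]
    fun_prop
  have hint₁ : ∀ f : (Fin N → Fin N → ℝ) → ℝ,
      ∫ g, f g ∂((volume : Measure (Fin N → Fin N → ℝ)).withDensity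
        fun g => ENNReal.ofReal (w₁ g)) = ∫ g, w₁ g * f g := by
    intro f
    have hm : Measurable fun x => ENNReal.ofReal (w₁ x) :=
      ENNReal.measurable_ofReal.comp hw₁c.measurable
    rw [integral_withDensity_eq_integral_toReal_smul hm
      (Filter.Eventually.of_forall fun g => ENNReal.ofReal_lt_top)]
    simp only [ENNReal.toReal_ofReal (hw₁0 _), smul_eq_mul]
  have hint₂ : ∀ f : (Fin N → ℝ) → ℝ,
      ∫ t, f t ∂((volume : Measure (Fin N → ℝ)).withDensity
        fun t => ENNReal.ofReal (w₂ t)) = ∫ t, w₂ t * f t := by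
    intro f
    have hm : Measurable fun x => ENNReal.ofReal (w₂ x) :=
      ENNReal.measurable_ofReal.comp hw₂c.measurable
    rw [integral_withDensity_eq_integral_toReal_smul hm
      (Filter.Eventually.of_forall fun g => ENNReal.ofReal_lt_top)]
    simp only [ENNReal.toReal_ofReal (hw₂0 _), smul_eq_mul]
  have hfin₁ := isFiniteMeasure_withDensity_ofReal hw₁i.2
  have hfin₂ := isFiniteMeasure_withDensity_ofReal hw₂i.2
  -- The `m`-th power of the variable together with the density has width parameter `c = (m + 1)/2`;
  -- this is why all `c > 0` are needed above.
  have hexp : ∀ (a s : ℝ) (m : ℕ), Real.exp (-(s / 2)) * (a * Real.exp (-(s / 2))) ^ m =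
      a ^ m * Real.exp (-(((m + 1 : ℝ) / 2) * s)) := by
    intro a s m
    rw [mul_pow, ← Real.exp_nat_mul, mul_left_comm, ← Real.exp_add]
    congr 2
    ring
  have hexp' : ∀ a s : ℝ, Real.exp (-(s / 2)) * (a * Real.exp (-(s / 2))) =
      a * Real.exp (-s) := by
    intro a s
    rw [mul_left_comm, ← Real.exp_add]
    congr 2
    ring
  have key := integral_comp_eq_of_moments
    (μ := (volume : Measure (Fin N → Fin N → ℝ)).withDensity fun g => ENNReal.ofReal (w₁ g))
    (ν := (volume : Measure (Fin N → ℝ)).withDensity fun t => ENNReal.ofReal (w₂ t))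
    (f := fun g => Q (gueEigenvalues g) * Real.exp (-(traceSq g / 2)))
    (g := fun t => Q t * Real.exp (-(sumSq t / 2))) (M := max M₁ M₂)
    (hc₁.mul (Real.continuous_exp.comp hs₁.neg)).aestronglyMeasurable
    (hc₂.mul (Real.continuous_exp.comp hs₂.neg)).aestronglyMeasurable
    (Filter.Eventually.of_forall fun g => by
      rw [Set.mem_Icc, ← abs_le, abs_mul, Real.abs_exp]
      simpa using (hM₁ g).trans (le_max_left _ _))
    (Filter.Eventually.of_forall fun t => by
      rw [Set.mem_Icc, ← abs_le, abs_mul, Real.abs_exp]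
      simpa using (hM₂ t).trans (le_max_right _ _))
    (fun m => ?_) continuous_abs
  · rw [hint₁, hint₂] at key
    simp only [hw₁, hw₂, abs_mul, Real.abs_exp, mul_assoc, hexp'] at key
    rw [integral_const_mul, integral_const_mul] at key
    rw [key]
    congr 1
    refine integral_congr_ae (Filter.Eventually.of_forall fun t => ?_)
    ring
  · rw [hint₁, hint₂]
    simp only [hw₁, hw₂, mul_assoc, hexp]
    rw [integral_const_mul, integral_const_mul, gue_mul_eigenvalue_exp_real (Q := fun t => Q t ^ m)
      (F := F ^ m) (by positivity) (fun t => by rw [map_pow, hF, Complex.ofReal_pow])]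
    congr 1
    refine integral_congr_ae (Filter.Eventually.of_forall fun t => ?_)
    ring

/-- The averages of `∏ |x - x_l| |y - x_l|` over the Gaussian unitary ensemble and over the
eigenvalue density agree. -/
theorem gue_average_eq (x y : ℝ) :
    Integrable (fun g => ∏ l : Fin N, |x - gueEigenvalues g l| * |y - gueEigenvalues g l|)
      (gueMeasure N) ∧
    ∫ t : Fin N → ℝ, (∏ l, (|x - t l| * |y - t l|)) * (vandermondeReal t * Real.exp (-sumSq t)) =
      (∫ t : Fin N → ℝ, vandermondeReal t * Real.exp (-sumSq t)) *
        ∫ g, ∏ l : Fin N, |x - gueEigenvalues g l| * |y - gueEigenvalues g l| ∂gueMeasure N := by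
  obtain ⟨F, hF⟩ := exists_eval_powerSum_eq_prod (N := N)
    ((Polynomial.C (x : ℂ) - Polynomial.X) * (Polynomial.C (y : ℂ) - Polynomial.X))
  have hF' : ∀ t : Fin N → ℝ, eval (powerSum t) F =
      ((∏ l, (x - t l) * (y - t l) : ℝ) : ℂ) := fun t => by rw [hF]; simp
  have habs : ∀ t : Fin N → ℝ, ∏ l, |x - t l| * |y - t l| = |∏ l, (x - t l) * (y - t l)| := by
    intro t
    simp only [Finset.abs_prod, abs_mul]
  have hQ : PolyBounded fun g : Fin N → Fin N → ℝ =>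
      ((∏ l, (x - gueEigenvalues g l) * (y - gueEigenvalues g l) : ℝ) : ℂ) := by
    have h := PolyBounded.eval polyBounded_gueTrace F (E := Fin N → Fin N → ℝ)
    simpa only [gueTrace_eq_powerSum, hF'] using h
  obtain ⟨h1, h2⟩ := integral_gueMeasure hQ.ofReal_abs
  have h3 := gue_mul_eigenvalue_abs hF'
  have h4 : 0 < ∫ g : Fin N → Fin N → ℝ, Real.exp (-traceSq g) := by
    refine integral_exp_pos ?_
    have h := (PolyBounded.const (E := Fin N → Fin N → ℝ) ((1 : ℝ) : ℂ)).integrable_of_ofReal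
      (f := fun _ => 1) (μ := volume) continuous_traceSq one_pos
      (fun g => by rw [one_mul]; exact norm_sq_le_traceSq g)
    simpa only [one_mul] using h
  simp only [habs]
  refine ⟨h1, mul_left_cancel₀ h4.ne' ?_⟩
  rw [h2] at h3
  simp only [mul_assoc] at h3 ⊢
  rw [← h3]
  ring

end GaussianComparison

end BoseGas
end

noncomputable section
namespace BoseGas

/-! ### The harmonic well -/

/-- Turns the defining recursion, which contains a derivative, into a three-term recursion, and
lowers the index in the orthogonality integrals. -/
theorem derivative_physHermite_succ (k : ℕ) :
    Polynomial.derivative (physHermite (k + 1)) =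
      Polynomial.C (2 * (k + 1 : ℝ)) * physHermite k := by
  have hC : ∀ k : ℕ, Polynomial.C (2 * (k + 1 : ℝ)) = 2 * (k + 1 : Polynomial ℝ) := fun k => by
    rw [map_mul, map_add, map_natCast, map_one, Polynomial.C_ofNat]
  induction k with
  | zero => simp [physHermite, Polynomial.C_ofNat]
  | succ k ih =>
    rw [hC] at ih ⊢
    have h : Polynomial.derivative (Polynomial.derivative (physHermite (k + 1))) =
        2 * (k + 1 : Polynomial ℝ) * Polynomial.derivative (physHermite k) := by
      rw [ih, ← hC, Polynomial.derivative_C_mul]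
    rw [physHermite, Polynomial.derivative_sub, h]
    simp only [Polynomial.derivative_mul, Polynomial.derivative_X, Polynomial.derivative_ofNat]
    rw [ih]
    have h2 : physHermite (k + 1) = 2 * Polynomial.X * physHermite k -
        Polynomial.derivative (physHermite k) := rfl
    push_cast
    linear_combination (-2 * ((k : Polynomial ℝ) + 1)) * h2

/-- The monic Hermite polynomials. -/
def monicHermite (k : ℕ) : Polynomial ℝ := Polynomial.C ((2 : ℝ) ^ k)⁻¹ * physHermite k

theorem monicHermite_monic (k : ℕ) : (monicHermite k).natDegree = k ∧ (monicHermite k).Monic := by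
  refine monic_of_rec (by simp [monicHermite, physHermite]) ?_ (fun k => (k + 1 : ℝ) / 2)
    (fun k => ?_) k
  · apply Polynomial.funext
    intro x
    simp [monicHermite, physHermite]
  · apply Polynomial.funext
    intro x
    have h : physHermite (k + 2) = 2 * Polynomial.X * physHermite (k + 1) -
        Polynomial.C (2 * (k + 1 : ℝ)) * physHermite k := by
      rw [← derivative_physHermite_succ]
      rfl
    simp only [monicHermite, h, Polynomial.eval_mul, Polynomial.eval_sub, Polynomial.eval_C,
      Polynomial.eval_X, Polynomial.eval_ofNat]
    field_simp
    ring

theorem integrable_eval_mul_exp_neg_sq (p : Polynomial ℝ) :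
    Integrable fun x : ℝ => p.eval x * Real.exp (-x ^ 2) := by
  have hp : PolyBounded fun x : ℝ => ((p.eval x : ℝ) : ℂ) := by
    have hX : PolyBounded fun x : ℝ => (x : ℂ) := PolyBounded.linear Complex.ofRealCLM
    simp only [Polynomial.eval_eq_sum, Polynomial.sum, Complex.ofReal_sum, Complex.ofReal_mul,
      Complex.ofReal_pow]
    exact PolyBounded.sum fun k _ => (PolyBounded.const _).mul (hX.pow k)
  exact hp.integrable_of_ofReal (q := fun x => x ^ 2) (by fun_prop) one_pos
    fun x => by rw [one_mul, Real.norm_eq_abs, sq_abs]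

/-- `H_{k+1} e^{-x²}` is minus the derivative of `H_k e^{-x²}`, so one partial integration moves the
derivative to `p`. -/
theorem integral_eval_mul_physHermite_succ (p : Polynomial ℝ) (k : ℕ) :
    ∫ x : ℝ, (p * physHermite (k + 1)).eval x * Real.exp (-x ^ 2) =
      ∫ x : ℝ, (Polynomial.derivative p * physHermite k).eval x * Real.exp (-x ^ 2) := by
  rw [eq_comm, ← sub_eq_zero, ← integral_sub (integrable_eval_mul_exp_neg_sq _)
    (integrable_eval_mul_exp_neg_sq _)]
  refine integral_eq_zero_of_hasDerivAt_of_integrable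
    (f := fun x => (p * physHermite k).eval x * Real.exp (-x ^ 2)) (fun x => ?_)
    ((integrable_eval_mul_exp_neg_sq _).sub (integrable_eval_mul_exp_neg_sq _))
    (integrable_eval_mul_exp_neg_sq _)
  have h1 : HasDerivAt (fun x : ℝ => Real.exp (-x ^ 2))
      (Real.exp (-x ^ 2) * (-(2 * x))) x := by
    refine HasDerivAt.exp ?_
    simpa using (hasDerivAt_pow 2 x).fun_neg
  refine (((p * physHermite k).hasDerivAt x).fun_mul h1).congr_deriv ?_
  simp only [Polynomial.derivative_mul, physHermite, Polynomial.eval_mul, Polynomial.eval_add,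
    Polynomial.eval_sub, Polynomial.eval_X, Polynomial.eval_ofNat]
  ring

theorem integral_physHermite_mul (j k : ℕ) :
    ∫ x : ℝ, (physHermite j * physHermite k).eval x * Real.exp (-x ^ 2) =
      if j = k then √Real.pi * 2 ^ k * k.factorial else 0 := by
  have h0 : ∀ k : ℕ, ∫ x : ℝ, (physHermite 0 * physHermite k).eval x * Real.exp (-x ^ 2) =
      if 0 = k then √Real.pi * 2 ^ k * k.factorial else 0 := by
    intro k
    cases k with
    | zero =>
      have h := integral_gaussian 1
      simpa [physHermite] using h
    | succ k =>
      rw [integral_eval_mul_physHermite_succ]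
      simp [physHermite]
  induction j generalizing k with
  | zero => exact h0 k
  | succ j ih =>
    cases k with
    | zero =>
      rw [mul_comm, h0]
      simp
    | succ k =>
      rw [integral_eval_mul_physHermite_succ, derivative_physHermite_succ]
      have h : ∀ x : ℝ, (Polynomial.C (2 * (j + 1 : ℝ)) * physHermite j * physHermite k).eval x *
          Real.exp (-x ^ 2) = 2 * (j + 1 : ℝ) *
            ((physHermite j * physHermite k).eval x * Real.exp (-x ^ 2)) := fun x => by
        rw [mul_assoc, Polynomial.eval_C_mul, mul_assoc]
      simp only [h]
      rw [integral_const_mul, ih]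
      simp only [add_left_inj]
      split_ifs with h
      · subst h
        rw [Nat.factorial_succ]
        push_cast
        ring
      · simp

theorem cH_pos (k : ℕ) : 0 < cH k := Real.sqrt_pos.2 (by positivity)

theorem cH_sq (k : ℕ) : cH k ^ 2 = √Real.pi * ((2 : ℝ) ^ k)⁻¹ * k.factorial :=
  Real.sq_sqrt (by positivity)

theorem phiH_mul_phiH (j k : ℕ) (x : ℝ) : phiH j x * phiH k x =
    (((2 : ℝ) ^ j)⁻¹ / cH j * (((2 : ℝ) ^ k)⁻¹ / cH k)) *
      ((physHermite j * physHermite k).eval x * Real.exp (-x ^ 2)) := by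
  have h : Real.exp (-x ^ 2) = Real.exp (-x ^ 2 / 2) * Real.exp (-x ^ 2 / 2) := by
    rw [← Real.exp_add]
    ring_nf
  rw [phiH, phiH, h, Polynomial.eval_mul]
  ring

theorem integral_phiH_mul (j k : ℕ) : ∫ x : ℝ, phiH j x * phiH k x = if j = k then 1 else 0 := by
  simp only [phiH_mul_phiH]
  rw [integral_const_mul, integral_physHermite_mul]
  split_ifs with h
  · subst h
    have h1 := cH_sq j
    have h2 := cH_pos j
    have h3 : (((2 : ℝ) ^ j)⁻¹ / cH j * (((2 : ℝ) ^ j)⁻¹ / cH j)) *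
        (√Real.pi * 2 ^ j * j.factorial) =
        (√Real.pi * ((2 : ℝ) ^ j)⁻¹ * j.factorial) / cH j ^ 2 := by
      field_simp
    rw [h3, ← h1, div_self (by positivity)]
  · simp

theorem gue_average (N : ℕ) (x y : ℝ) :
    Integrable (fun g => ∏ l : Fin N, |x - gueEigenvalues g l| * |y - gueEigenvalues g l|)
      (gueMeasure N) ∧
    rhoH N x y = 1 / cH N ^ 2 * Real.exp (-x ^ 2 / 2 - y ^ 2 / 2) *
      ∫ g, ∏ l : Fin N, |x - gueEigenvalues g l| * |y - gueEigenvalues g l| ∂gueMeasure N := by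
  obtain ⟨hI, hA⟩ := gue_average_eq (N := N) x y
  refine ⟨hI, ?_⟩
  have h := densityMatrix_eq_average (𝕜 := ℝ) (Ω := Set.univ)
    (φ := fun k : Fin (N + 1) => phiH k) (χ := fun k : Fin N => phiH k)
    (fun k => (monicHermite_monic k).1) (fun k => (monicHermite_monic k).2)
    (a := fun x => Real.exp (-x ^ 2 / 2)) (b := fun k => 1 / cH k) (z := fun x => x)
    (fun x => rfl)
    (fun k x => by rw [phiH, monicHermite, Polynomial.eval_C_mul]; ring)
    (fun k x => by rw [phiH, monicHermite, Polynomial.eval_C_mul]; ring)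
    (fun j k => by
      simp only [conj_trivial, phiH_mul_phiH]
      exact ((integrable_eval_mul_exp_neg_sq _).const_mul _).integrableOn)
    (fun j k => by
      simp only [conj_trivial, Measure.restrict_univ, integral_phiH_mul, Fin.ext_iff])
    (W := fun t => vandermondeReal t * Real.exp (-sumSq t))
    (fun t => by
      simp only [Real.norm_eq_abs, sq_abs, ← Real.exp_nat_mul, ← Real.exp_sum]
      rw [mul_comm, vandermondeReal, sumSq, ← Finset.sum_neg_distrib]
      congr 2
      refine Finset.sum_congr rfl fun l _ => ?_
      push_cast
      ring)
    (x := x) (y := y)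
    (by simpa only [Set.pi_univ, Measure.restrict_univ, Real.norm_eq_abs] using hA)
  rw [rhoH, psiH, h]
  simp only [Real.norm_eq_abs, Real.abs_exp, sq_abs]
  rw [mul_assoc (_ ^ 2), ← Real.exp_add, div_pow, one_pow]
  congr 3
  ring

end BoseGas
end

/-! ### The four density matrices as random matrix averages -/

theorem mainTheorem6 (N : ℕ) :
    (∀ L : ℝ, 0 < L → ∀ x : ℝ,
      MeasureTheory.Integrable
        (fun U : BoseGas.UGroup N => ((BoseGas.anglesU U).map fun θ =>
          |2 * Real.sin (Real.pi * x / L - θ / 2)| * |2 * Real.sin (θ / 2)|).prod)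
        (BoseGas.haarProb (BoseGas.UGroup N)) ∧
      BoseGas.rhoC L N x 0 =
        1 / L * ∫ U : BoseGas.UGroup N, ((BoseGas.anglesU U).map fun θ =>
          |2 * Real.sin (Real.pi * x / L - θ / 2)| * |2 * Real.sin (θ / 2)|).prod
          ∂(BoseGas.haarProb (BoseGas.UGroup N))) ∧
    (∀ x y : ℝ,
      MeasureTheory.Integrable
        (fun g => ∏ l : Fin N, |x - BoseGas.gueEigenvalues g l| * |y - BoseGas.gueEigenvalues g l|)
        (BoseGas.gueMeasure N) ∧
      BoseGas.rhoH N x y =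
        1 / BoseGas.cH N ^ 2 * Real.exp (-x ^ 2 / 2 - y ^ 2 / 2) *
          ∫ g, ∏ l : Fin N, |x - BoseGas.gueEigenvalues g l| * |y - BoseGas.gueEigenvalues g l|
            ∂(BoseGas.gueMeasure N)) ∧
    (∀ L : ℝ, 0 < L → ∀ x ∈ Set.Icc 0 L, ∀ y ∈ Set.Icc 0 L,
      MeasureTheory.Integrable
        (fun S : BoseGas.SpGroup N => ((BoseGas.anglesSp S).map fun θ =>
          (2 * |Real.cos (Real.pi * x / L) - Real.cos θ|) *
            (2 * |Real.cos (Real.pi * y / L) - Real.cos θ|)).prod)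
        (BoseGas.haarProb (BoseGas.SpGroup N)) ∧
      BoseGas.rhoD L N x y =
        2 / L * Real.sin (Real.pi * x / L) * Real.sin (Real.pi * y / L) *
          ∫ S : BoseGas.SpGroup N, ((BoseGas.anglesSp S).map fun θ =>
            (2 * |Real.cos (Real.pi * x / L) - Real.cos θ|) *
              (2 * |Real.cos (Real.pi * y / L) - Real.cos θ|)).prod
            ∂(BoseGas.haarProb (BoseGas.SpGroup N))) ∧
    (1 ≤ N → ∀ L : ℝ, 0 < L → ∀ x ∈ Set.Icc 0 L, ∀ y ∈ Set.Icc 0 L,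
      MeasureTheory.Integrable
        (fun R : BoseGas.OPlusGroup N => ((BoseGas.anglesO R).map fun θ =>
          (2 * |Real.cos (Real.pi * x / L) - Real.cos θ|) *
            (2 * |Real.cos (Real.pi * y / L) - Real.cos θ|)).prod)
        (BoseGas.haarProb (BoseGas.OPlusGroup N)) ∧
      BoseGas.rhoN L N x y =
        1 / (2 * L) *
          ∫ R : BoseGas.OPlusGroup N, ((BoseGas.anglesO R).map fun θ =>
            (2 * |Real.cos (Real.pi * x / L) - Real.cos θ|) *
              (2 * |Real.cos (Real.pi * y / L) - Real.cos θ|)).prod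
            ∂(BoseGas.haarProb (BoseGas.OPlusGroup N))) := by
  exact ⟨fun _ hL x => BoseGas.circle_average hL N x, fun x y => BoseGas.gue_average N x y,
    fun _ hL _ hx _ hy => BoseGas.dirichlet_average hL N hx hy,
    fun hN _ hL x _ y _ => BoseGas.neumann_average hL hN x y⟩
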